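/- Consider the Subset Sum problem: given a vector $a=(a_1,\dots,a_n)$ of integers and an integer $t$, both written in binary, decide whether there is a set $X\subseteq\{1,\dots,n\}$ with $\sum_{e\in X}a_e=t$. Let $S=\bigl|\{\sum_{e\in X}a_e : X\subseteq\{1,\dots,n\}\}\bigr|$ be the number of distinct subset sums, and let $|(a,t)|$ be the number of bits of the input. Algorithms are programs for a random access machine with logarithmic cost: an elementary operation costs the total bit length of its operands, and space is the total bit length of all stored data. (a) There are a randomized algorithm (which may toss fair coins) and a polynomial $q$ such that, on every instance $(a,t)$, the algorithm never gives a wrong answer, its expected running time is at most $S\cdot q(|(a,t)|)$ (in particular it halts with probability $1$), and it uses space at most $q(|(a,t)|)$ for every outcome of the coin tosses. (b) There are a deterministic algorithm and a polynomial $q$ such that, on every instance $(a,t)$, the algorithm halts with the correct answer after time at most $S^2\cdot q(|(a,t)|)$ and uses space at most $q(|(a,t)|)$. -/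

import Mathlib

open scoped ENNReal

/-! ## A logarithmic-cost random access machine with coin tosses

Programs are structured programs over integer registers and an integer memory with indirect
addressing.  Every elementary operation costs the total bit length of its operands, space is the
total bit length of everything stored, and a program may toss fair coins. -/

namespace RAM

/-- The bit length of an integer, sign included. -/
def bitlen (z : ℤ) : ℕ := z.natAbs.size + 1

/-- An operand is an integer literal or a register. -/
inductive Operand where
  | lit (z : ℤ)
  | reg (x : ℕ)

/-- Arithmetic operations; `div` and `mod` are Euclidean integer division and remainder. -/
inductive Op where
  | add
  | sub
  | mul
  | div
  | mod

def Op.eval : Op → ℤ → ℤ → ℤ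
  | .add, y, z => y + z
  | .sub, y, z => y - z
  | .mul, y, z => y * z
  | .div, y, z => y / z
  | .mod, y, z => y % z

/-- Comparisons that guard conditionals and loops. -/
inductive Test where
  | lt (u v : Operand)
  | eq (u v : Operand)

/-- Programs. -/
inductive Cmd where
  | skip
  /-- `x := u o v` -/
  | assign (x : ℕ) (o : Op) (u v : Operand)
  /-- `x := mem[u]` -/
  | load (x : ℕ) (u : Operand)
  /-- `mem[u] := v` -/
  | store (u v : Operand)
  /-- `x :=` the outcome, 0 or 1, of a fair coin toss -/
  | flip (x : ℕ)
  | seq (c d : Cmd)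
  | ite (g : Test) (c d : Cmd)
  | while (g : Test) (c : Cmd)

/-- A deterministic program: one that never tosses a coin. -/
def Cmd.CoinFree : Cmd → Prop
  | .flip _ => False
  | .seq c d => c.CoinFree ∧ d.CoinFree
  | .ite _ c d => c.CoinFree ∧ d.CoinFree
  | .while _ c => c.CoinFree
  | _ => True

/-- The data: registers and memory cells, all but finitely many of which hold `0`. -/
structure Store where
  regs : ℕ →₀ ℤ
  mem : ℤ →₀ ℤ

/-- A configuration: the stack of commands still to be executed (its height is bounded in terms
of the program alone, so it is finite control) and the data. -/
structure Config where
  todo : List Cmd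
  store : Store

def Operand.eval (s : Store) : Operand → ℤ
  | .lit z => z
  | .reg x => s.regs x

def Test.holds (s : Store) : Test → Prop
  | .lt u v => u.eval s < v.eval s
  | .eq u v => u.eval s = v.eval s

def Test.cost (s : Store) : Test → ℕ
  | .lt u v => 1 + bitlen (u.eval s) + bitlen (v.eval s)
  | .eq u v => 1 + bitlen (u.eval s) + bitlen (v.eval s)

noncomputable def Store.setReg (s : Store) (x : ℕ) (v : ℤ) : Store :=
  { s with regs := s.regs.update x v }

noncomputable def Store.setMem (s : Store) (i v : ℤ) : Store :=
  { s with mem := s.mem.update i v }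

open Classical in
/-- One step of the machine; `b` is the coin used if the step is a coin toss. -/
noncomputable def step (b : Bool) : Config → Config
  | ⟨[], s⟩ => ⟨[], s⟩
  | ⟨.skip :: k, s⟩ => ⟨k, s⟩
  | ⟨.assign x o u v :: k, s⟩ => ⟨k, s.setReg x (o.eval (u.eval s) (v.eval s))⟩
  | ⟨.load x u :: k, s⟩ => ⟨k, s.setReg x (s.mem (u.eval s))⟩
  | ⟨.store u v :: k, s⟩ => ⟨k, s.setMem (u.eval s) (v.eval s)⟩
  | ⟨.flip x :: k, s⟩ => ⟨k, s.setReg x (if b then 1 else 0)⟩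
  | ⟨.seq c d :: k, s⟩ => ⟨c :: d :: k, s⟩
  | ⟨.ite g c d :: k, s⟩ => if g.holds s then ⟨c :: k, s⟩ else ⟨d :: k, s⟩
  | ⟨.while g c :: k, s⟩ => if g.holds s then ⟨c :: .while g c :: k, s⟩ else ⟨k, s⟩

/-- The logarithmic cost of the next step: at least `1` as long as the machine has not halted. -/
def cost : Config → ℕ
  | ⟨[], _⟩ => 0
  | ⟨.skip :: _, _⟩ => 1
  | ⟨.assign _ _ u v :: _, s⟩ => 1 + bitlen (u.eval s) + bitlen (v.eval s)
  | ⟨.load _ u :: _, s⟩ => 1 + bitlen (u.eval s) + bitlen (s.mem (u.eval s))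
  | ⟨.store u v :: _, s⟩ => 1 + bitlen (u.eval s) + bitlen (v.eval s)
  | ⟨.flip _ :: _, _⟩ => 1
  | ⟨.seq _ _ :: _, _⟩ => 1
  | ⟨.ite g _ _ :: _, s⟩ => g.cost s
  | ⟨.while g _ :: _, s⟩ => g.cost s

/-- The number of bits stored: contents of the registers, addresses and contents of the memory
cells. -/
noncomputable def Config.space (c : Config) : ℕ :=
  (c.store.regs.sum fun _ v => bitlen v) + c.store.mem.sum fun i v => bitlen i + bitlen v

def Config.Halted (c : Config) : Prop := c.todo = []

/-- The answer is found in register `0`. -/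
def Config.output (c : Config) : ℤ := c.store.regs 0

/-- `d` can occur in a run from `c`, for some outcome of the coin tosses. -/
def Reaches : Config → Config → Prop :=
  Relation.ReflTransGen fun c d => ∃ b, d = step b c

/-- The law of the configuration after `k` steps from `c`, with independent fair coins. -/
noncomputable def law (c : Config) : ℕ → PMF Config
  | 0 => PMF.pure c
  | k + 1 => (law c k).bind fun d => (PMF.uniformOfFintype Bool).map fun b => step b d

/-- The expected running time from `c`: the sum over all `k` of the expected cost of the `k`-th
step.  It is `∞` if the machine fails to halt with positive probability. -/
noncomputable def expectedTime (c : Config) : ℝ≥0∞ :=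
  ∑' k, ∑' d, law c k d * (cost d : ℝ≥0∞)

/-- The configuration after `k` steps of a deterministic program (coins are irrelevant there). -/
noncomputable def run (c : Config) (k : ℕ) : Config := (step false)^[k] c

/-- The time taken by the first `k` steps of a deterministic program. -/
noncomputable def time (c : Config) (k : ℕ) : ℕ := ∑ i ∈ Finset.range k, cost (run c i)

end RAM

/-! ## Subset Sum -/

namespace SubsetSum

/-- Some subset of the entries of `a` sums to `t`. -/
def Solvable {n : ℕ} (a : Fin n → ℤ) (t : ℤ) : Prop :=
  ∃ X : Finset (Fin n), ∑ e ∈ X, a e = t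

/-- The number of distinct subset sums. -/
def numSums {n : ℕ} (a : Fin n → ℤ) : ℕ :=
  (Finset.univ.image fun X : Finset (Fin n) => ∑ e ∈ X, a e).card

/-- The number of bits of the instance `(a, t)`. -/
def inputSize {n : ℕ} (a : Fin n → ℤ) (t : ℤ) : ℕ :=
  RAM.bitlen t + ∑ i, RAM.bitlen (a i)

/-- The initial configuration of program `P` on `(a, t)`: `n` and `t` are in registers `0` and
`1`, and the entries of `a` in the memory cells `0, …, n - 1`; everything else is `0`. -/
noncomputable def init (P : RAM.Cmd) {n : ℕ} (a : Fin n → ℤ) (t : ℤ) : RAM.Config where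
  todo := [P]
  store :=
    { regs := Finsupp.single 0 (n : ℤ) + Finsupp.single 1 t
      mem := ∑ i : Fin n, Finsupp.single ((i : ℕ) : ℤ) (a i) }

/-- `z` is the right answer on `(a, t)`: `1` for yes, `0` for no. -/
def IsAnswer {n : ℕ} (a : Fin n → ℤ) (t : ℤ) (z : ℤ) : Prop :=
  (Solvable a t ∧ z = 1) ∨ (¬ Solvable a t ∧ z = 0)

/-- Program `P` uses space at most `q` of the input size, whatever the coins. -/
def SpaceBound (P : RAM.Cmd) (q : Polynomial ℕ) : Prop :=
  ∀ (n : ℕ) (a : Fin n → ℤ) (t : ℤ) (d : RAM.Config),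
    RAM.Reaches (init P a t) d → d.space ≤ q.eval (inputSize a t)

/-- Whenever program `P` halts, its answer is right, whatever the coins. -/
def NeverErrs (P : RAM.Cmd) : Prop :=
  ∀ (n : ℕ) (a : Fin n → ℤ) (t : ℤ) (d : RAM.Config),
    RAM.Reaches (init P a t) d → d.Halted → IsAnswer a t d.output

end SubsetSum

/-! Fix moduli `q` (prime) and `m` with `8 * (n + 1) * m ≤ q`. Replace each entry by its residue in
`1, …, m` (`wt`) and append `n` zero entries, which get weight `m`. Some subset of `a` has sum
congruent to `t` modulo `m` only if some subset of the padded weights has total exactly `t % m + n *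
m`: at most `n` genuine entries weigh at most `n * m`, and the padding supplies the missing multiple
of `m` (`Inst.hit_of_dvd`).

Whether a total `R` is attained by `N = 2 * n` weights `b i` is decided in little space by the sum
of `ω ^ (-R) * ∏ (1 + ω ^ b i)` over the `(q - 1)`-th roots of unity `ω`. These are taken in `ZMod
(q ^ (N + 1))`, as the Teichmüller representatives `x ^ q ^ N`. By orthogonality the sum is `q - 1`
times the number of subsets whose total is `R` modulo `q - 1`. This number is at most `2 ^ N < q ^
(N + 1)` and `q - 1` is prime to `q`, so the sum vanishes only if the number does
(`characterSum_eq_zero_iff`). Since `q` is large, congruence modulo `q - 1` is equality (`hit_iff`).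
The sum has `q - 1` terms, each computable in polynomial time.

Self-reduction turns this test into a search. If there is no solution of the weight problem, the
answer is no. If a solution is found, its true sum is compared with `t`: equality proves the answer
yes, and otherwise `m` divides a nonzero difference between a subset sum and `t`, and the attempt is
inconclusive. An attempt thus never errs and costs `q` times a polynomial. It must succeed if `m`
separates `t` from the other subset sums.

At most `S` times the input size many primes fail to separate, since each nonzero difference has few
prime factors. With a Chebyshev bound, `exists_many_pairs` gives a length `j`, with `2 ^ j` at most
`S` times a polynomial, such that a polynomial fraction of the `4 ^ j` pairs below `2 ^ j` is good.
The programs need not know `S`. The deterministic one walks along a staircase in the `(q, m)` plane: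
at most `S` times a polynomial many attempts, each costing at most that much, whence `S ^ 2`. The
randomized one draws `j` with probability about `2 ^ (-j)` and then a random pair of length `j`. The
expectation of `q` is then polynomial, while a good pair appears with probability at least one over
`S` times a polynomial.

On the machine side, `Env.E` counts expected steps, with an infinite penalty for any configuration
that violates the register bound, the step cost bound, the fixed memory or the correctness of the
output. A finite bound uniform in the number of steps therefore yields expected time, worst-case
space and correctness together (`Env.expectedTime_le`, `Env.good_of_reaches`). Such bounds are
composed by Hoare-style rules (`Tri`) and, where coins are tossed, by direct estimates of `Env.E`.
-/

namespace RAM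

/-! ### Expected step counts with a safety requirement -/

/-- What a run has to respect: a bound on the registers, a bound on the cost of a step, a fixed
memory, and a set of admissible outputs. -/
structure Env where
  H : ℤ
  w : ℕ
  mem : ℤ →₀ ℤ
  ans : ℤ → Prop

/-- The registers that programs may use. -/
def numRegs : ℕ := 24

/-- All registers are bounded and all but the first few hold `0`. -/
def Env.Ok (V : Env) (f : ℕ →₀ ℤ) : Prop :=
  (∀ x, |f x| < V.H) ∧ ∀ x, numRegs ≤ x → f x = 0

/-- The configuration respects the bounds and, if halted, holds an admissible output. -/
def Env.Good (V : Env) (c : Config) : Prop :=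
  V.Ok c.store.regs ∧ c.store.mem = V.mem ∧ cost c ≤ V.w ∧ (c.todo = [] → V.ans (c.store.regs 0))

open Classical in
/-- One unit for each step, and an infinite penalty for a configuration that is not good. -/
noncomputable def Env.pay (V : Env) (c : Config) : ℝ≥0∞ :=
  if V.Good c then (if c.todo = [] then 0 else 1) else ⊤

/-- The average of `g` over the two possible next configurations. -/
noncomputable def avg (g : Config → ℝ≥0∞) (c : Config) : ℝ≥0∞ :=
  (g (step false c) + g (step true c)) / 2

/-- The expected total payment during the first `k` steps. -/
noncomputable def Env.E (V : Env) : ℕ → Config → ℝ≥0∞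
  | 0, _ => 0
  | k + 1, c => V.pay c + avg (V.E k) c

lemma avg_mono {g h : Config → ℝ≥0∞} (hgh : ∀ c, g c ≤ h c) (c : Config) : avg g c ≤ avg h c := by
  unfold avg
  gcongr <;> apply hgh

lemma avg_add (g h : Config → ℝ≥0∞) (c : Config) :
    avg (fun d => g d + h d) c = avg g c + avg h c := by
  unfold avg
  rw [← ENNReal.add_div]
  congr 1
  ring

lemma ennreal_half_add_self (a : ℝ≥0∞) : (a + a) / 2 = a := by
  rw [← two_mul, ENNReal.mul_div_right_comm, ENNReal.div_self (by norm_num) (by norm_num), one_mul]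

lemma avg_of_eq {g : Config → ℝ≥0∞} {c : Config} {d : Config} (h : ∀ b, step b c = d) :
    avg g c = g d := by
  simp only [avg, h, ennreal_half_add_self]

/-- Monotonicity in the number of steps lets the program rules below keep the same `k` on both
sides, so that no rule has to track how much of the step budget is left. -/
lemma Env.E_le_succ (V : Env) : ∀ k c, V.E k c ≤ V.E (k + 1) c
  | 0, _ => zero_le
  | k + 1, c => by
    rw [Env.E, Env.E]
    gcongr
    exact avg_mono (V.E_le_succ k) c

lemma Env.pay_of_good {V : Env} {c : Config} (h : V.Good c) : V.pay c ≤ 1 := by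
  unfold Env.pay
  rw [if_pos h]
  split_ifs <;> simp

/-- A step that does not depend on the coin. -/
lemma Env.E_step {V : Env} {c d : Config} (hg : V.Good c) (h : ∀ b, step b c = d) (k : ℕ) :
    V.E k c ≤ 1 + V.E k d := by
  cases k with
  | zero => simp [Env.E]
  | succ k =>
    rw [Env.E, avg_of_eq h]
    gcongr
    · exact Env.pay_of_good hg
    · exact V.E_le_succ k d

lemma Env.E_halted {V : Env} {s : Store} (hg : V.Good ⟨[], s⟩) (k : ℕ) : V.E k ⟨[], s⟩ = 0 := by
  induction k with
  | zero => rfl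
  | succ k ih =>
    rw [Env.E, avg_of_eq (d := ⟨[], s⟩) (fun b => by simp [step]), ih]
    simp [Env.pay, hg]

/-! ### From expected step counts to expected time -/

/-- `law` evolves forward from the start, whereas `Env.E` recurses backward from the first step.
Moving one averaging step from the law to the test function reconciles the two. -/
lemma tsum_law_succ (c : Config) (k : ℕ) (g : Config → ℝ≥0∞) :
    ∑' d, law c (k + 1) d * g d = ∑' d, law c k d * avg g d := by
  have key : ∀ (p : PMF Config) (r : Config → PMF Config),
      ∑' d, (p.bind r) d * g d = ∑' a, p a * ∑' d, r a d * g d := by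
    intro p r
    simp only [PMF.bind_apply, ← ENNReal.tsum_mul_right, ← ENNReal.tsum_mul_left]
    rw [ENNReal.tsum_comm]
    simp only [mul_assoc]
  rw [law, key]
  congr 1
  funext a
  congr 1
  have : ∀ (p : PMF Bool) (r : Bool → Config),
      ∑' d, (p.map r) d * g d = ∑' b, p b * g (r b) := by
    intro p r
    classical
    simp only [PMF.map_apply, ← ENNReal.tsum_mul_right]
    rw [ENNReal.tsum_comm]
    congr 1
    funext b
    rw [tsum_eq_single (r b)]
    · simp
    · intro d hd
      simp [hd]
  rw [this, tsum_bool, avg]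
  simp only [PMF.uniformOfFintype_apply, Fintype.card_bool]
  rw [← mul_add, mul_comm, div_eq_mul_inv]
  simp

lemma avg_iterate_succ (g : Config → ℝ≥0∞) (k : ℕ) (c : Config) :
    avg (avg^[k] g) c = avg^[k + 1] g c := by
  rw [Function.iterate_succ_apply']

lemma tsum_law (c : Config) (k : ℕ) : ∀ g : Config → ℝ≥0∞,
    ∑' d, law c k d * g d = avg^[k] g c := by
  induction k with
  | zero =>
    intro g
    rw [tsum_eq_single c]
    · simp [law]
    · intro d hd
      simp [law, hd]
  | succ k ih =>
    intro g
    rw [tsum_law_succ, ih, Function.iterate_succ_apply]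

lemma avg_sum (s : Finset ℕ) (g : ℕ → Config → ℝ≥0∞) (c : Config) :
    avg (fun d => ∑ i ∈ s, g i d) c = ∑ i ∈ s, avg (g i) c := by
  classical
  induction s using Finset.induction_on with
  | empty => simp [avg]
  | insert a s ha ih =>
    simp only [Finset.sum_insert ha]
    rw [avg_add, ih]

lemma Env.E_eq_sum (V : Env) (k : ℕ) : ∀ c,
    V.E k c = ∑ i ∈ Finset.range k, avg^[i] V.pay c := by
  induction k with
  | zero => intro c; simp [Env.E]
  | succ k ih =>
    intro c
    rw [Env.E, Finset.sum_range_succ', funext ih, avg_sum, add_comm]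
    simp only [avg_iterate_succ, Function.iterate_zero, id]

lemma Env.cost_le_pay (V : Env) (hw : 0 < V.w) (c : Config) : (cost c : ℝ≥0∞) ≤ V.w * V.pay c := by
  unfold Env.pay
  split_ifs with h1 h2
  · obtain ⟨k, s⟩ := c
    simp only at h2
    subst h2
    simp [cost]
  · simpa using h1.2.2.1
  · rw [ENNReal.mul_top (by simpa using hw.ne')]
    exact le_top

theorem Env.expectedTime_le {V : Env} (hw : 0 < V.w) {c : Config} {B : ℝ≥0∞}
    (h : ∀ k, V.E k c ≤ B) : expectedTime c ≤ V.w * B := by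
  calc expectedTime c ≤ ∑' k, V.w * avg^[k] V.pay c := by
        refine ENNReal.tsum_le_tsum fun k => ?_
        rw [← tsum_law, ← ENNReal.tsum_mul_left]
        refine ENNReal.tsum_le_tsum fun d => ?_
        rw [mul_left_comm]
        gcongr
        exact V.cost_le_pay hw d
    _ = V.w * ∑' k, avg^[k] V.pay c := ENNReal.tsum_mul_left
    _ ≤ V.w * B := by
        gcongr
        rw [ENNReal.tsum_eq_iSup_nat]
        refine iSup_le fun k => ?_
        rw [← V.E_eq_sum]
        exact h k

/-- Each of two nonnegative numbers is at most twice their average. -/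
lemma Env.E_step_le {V : Env} {c : Config} {B : ℝ≥0∞} (h : ∀ k, V.E k c ≤ B) (b : Bool) (k : ℕ) :
    V.E k (step b c) ≤ 2 * B := by
  have h1 : avg (V.E k) c ≤ B := le_trans (by rw [Env.E]; exact le_add_self) (h (k + 1))
  rw [avg, ENNReal.div_le_iff (by norm_num) (by norm_num), mul_comm] at h1
  refine le_trans ?_ h1
  cases b
  · exact le_self_add
  · exact le_add_self

lemma Env.good_of_E_le {V : Env} {c : Config} {B : ℝ≥0∞} (hB : B ≠ ⊤) (h : ∀ k, V.E k c ≤ B) :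
    V.Good c := by
  by_contra hg
  have h1 := h 1
  rw [Env.E, Env.pay, if_neg hg, top_add, top_le_iff] at h1
  exact hB h1

/-- A bound in expectation becomes a statement about every coin outcome: each step at most doubles
the bound, so it stays finite along any run, and finiteness rules out the infinite penalty. -/
theorem Env.good_of_reaches {V : Env} {c : Config} {B : ℝ≥0∞} (hB : B ≠ ⊤)
    (h : ∀ k, V.E k c ≤ B) {d : Config} (hd : Reaches c d) : V.Good d := by
  have : ∃ B' : ℝ≥0∞, B' ≠ ⊤ ∧ ∀ k, V.E k d ≤ B' := by
    induction hd with
    | refl => exact ⟨B, hB, h⟩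
    | tail _ hs ih =>
      obtain ⟨B', hB', h'⟩ := ih
      obtain ⟨b, rfl⟩ := hs
      exact ⟨2 * B', ENNReal.mul_ne_top (by norm_num) hB', Env.E_step_le h' b⟩
  obtain ⟨B', hB', h'⟩ := this
  exact Env.good_of_E_le hB' h'

/-! ### Deterministic runs -/

/-- Freedom from coins is inherited by the stack, so averaging over the coin is trivial along the
whole run. -/
lemma step_coinFree {c : Config} (hc : ∀ p ∈ c.todo, p.CoinFree) :
    (∀ b, step b c = step false c) ∧ ∀ p ∈ (step false c).todo, p.CoinFree := by
  classical
  obtain ⟨κ, s⟩ := c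
  rcases κ with _ | ⟨p, κ⟩
  · simp [step]
  · simp only [List.mem_cons, forall_eq_or_imp] at hc
    obtain ⟨hp, hκ⟩ := hc
    cases p <;> simp only [step, Cmd.CoinFree] at hp ⊢
    all_goals first
      | exact ⟨fun _ => trivial, hκ⟩
      | (split_ifs <;> simp_all [Cmd.CoinFree])
      | simp_all

lemma Env.E_eq_sum_run (V : Env) (k : ℕ) : ∀ {c : Config}, (∀ p ∈ c.todo, p.CoinFree) →
    V.E k c = ∑ i ∈ Finset.range k, V.pay (run c i) := by
  induction k with
  | zero => intro c _; simp [Env.E]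
  | succ k ih =>
    intro c hc
    rw [Env.E, avg_of_eq (step_coinFree hc).1, ih (step_coinFree hc).2, Finset.sum_range_succ',
      add_comm]
    rfl

theorem Env.exists_halted {V : Env} (hw : 0 < V.w) {c : Config} (hc : ∀ p ∈ c.todo, p.CoinFree)
    {B : ℕ} (h : ∀ k, V.E k c ≤ B) :
    ∃ k, (run c k).Halted ∧ V.ans (run c k).output ∧ time c k ≤ V.w * B := by
  have hgood : ∀ k, V.Good (run c k) := by
    intro k
    refine Env.good_of_reaches (by simp) h (d := run c k) ?_
    induction k with
    | zero => exact Relation.ReflTransGen.refl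
    | succ k ih =>
      refine ih.tail ⟨false, ?_⟩
      rw [run, Function.iterate_succ_apply']
      rfl
  have hex : ∃ k, (run c k).Halted := by
    by_contra hne
    push Not at hne
    -- A run that never halts pays exactly one unit per step, so `B + 1` steps already exceed the
    -- bound.
    have h1 := h (B + 1)
    rw [V.E_eq_sum_run _ hc, Finset.sum_congr rfl (g := fun _ => 1)] at h1
    · simp only [Finset.sum_const, Finset.card_range, nsmul_eq_mul, mul_one] at h1
      have : B + 1 ≤ B := by exact_mod_cast h1
      omega
    · intro i _
      have := hne i
      unfold Config.Halted at this
      simp [Env.pay, hgood, this]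
  obtain ⟨k, hk⟩ := hex
  refine ⟨k, hk, (hgood k).2.2.2 hk, ?_⟩
  have : (time c k : ℝ≥0∞) ≤ V.w * B := by
    unfold time
    push_cast
    calc ∑ i ∈ Finset.range k, (cost (run c i) : ℝ≥0∞)
        ≤ ∑ i ∈ Finset.range k, V.w * V.pay (run c i) :=
          Finset.sum_le_sum fun i _ => V.cost_le_pay hw _
      _ = V.w * V.E k c := by rw [V.E_eq_sum_run k hc, Finset.mul_sum]
      _ ≤ V.w * B := by gcongr; exact h k
  exact_mod_cast this

end RAM

namespace RAM

/-! ### Rules for programs -/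

/-- Update of one register. -/
noncomputable def upd (f : ℕ →₀ ℤ) (x : ℕ) (v : ℤ) : ℕ →₀ ℤ := f.update x v

@[simp] lemma upd_apply (f : ℕ →₀ ℤ) (x : ℕ) (v : ℤ) (y : ℕ) :
    upd f x v y = if y = x then v else f y := by
  classical
  simp [upd, Finsupp.update_apply]

/-- The value of an operand in terms of the registers. -/
@[simp] def Operand.val (f : ℕ →₀ ℤ) : Operand → ℤ
  | .lit z => z
  | .reg x => f x

/-- The truth of a test in terms of the registers. -/
@[simp] def Test.tr (f : ℕ →₀ ℤ) : Test → Prop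
  | .lt u v => u.val f < v.val f
  | .eq u v => u.val f = v.val f

lemma Operand.eval_mk (f : ℕ →₀ ℤ) (m : ℤ →₀ ℤ) (u : Operand) : u.eval ⟨f, m⟩ = u.val f := by
  cases u <;> rfl

lemma Test.holds_mk (f : ℕ →₀ ℤ) (m : ℤ →₀ ℤ) (g : Test) : g.holds ⟨f, m⟩ ↔ g.tr f := by
  cases g <;> simp [Test.holds, Operand.eval_mk]

/-- The bounds of the environment are consistent with each other. -/
structure Env.Fit (V : Env) : Prop where
  cost_le : ∀ y z, |y| < V.H → |z| < V.H → 1 + bitlen y + bitlen z ≤ V.w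
  mem_lt : ∀ i, |V.mem i| < V.H
  lit_lt : 1024 < V.H

lemma Env.Fit.w_pos {V : Env} (h : V.Fit) : 0 < V.w := by
  have h0 : |(0 : ℤ)| < V.H := by have := h.lit_lt; simp; omega
  have := h.cost_le 0 0 h0 h0
  omega

/-- Operands whose value always respects the bound. -/
class Operand.Small (u : Operand) : Prop where
  lt : ∀ {V : Env} {f : ℕ →₀ ℤ}, V.Fit → V.Ok f → |u.val f| < V.H

instance (x : ℕ) : (Operand.reg x).Small := ⟨fun _ hf => hf.1 x⟩

lemma Operand.small_lit {z : ℤ} (hz : |z| ≤ 1024) : (Operand.lit z).Small :=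
  ⟨fun hV _ => lt_of_le_of_lt hz hV.lit_lt⟩

instance : (Operand.lit 0).Small := Operand.small_lit (by norm_num)
instance : (Operand.lit 1).Small := Operand.small_lit (by norm_num)
instance : (Operand.lit 2).Small := Operand.small_lit (by norm_num)
instance : (Operand.lit 4).Small := Operand.small_lit (by norm_num)
instance : (Operand.lit 8).Small := Operand.small_lit (by norm_num)
instance : (Operand.lit 1024).Small := Operand.small_lit (by norm_num)

/-- Tests whose operands always respect the bound. -/
class Test.Small (g : Test) : Prop where
  cost_le : ∀ {V : Env} {f : ℕ →₀ ℤ}, V.Fit → V.Ok f → g.cost ⟨f, V.mem⟩ ≤ V.w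

instance (u v : Operand) [u.Small] [v.Small] : (Test.lt u v).Small :=
  ⟨fun {V f} hV hf => by
    rw [Test.cost, Operand.eval_mk, Operand.eval_mk]
    exact hV.cost_le _ _ (Operand.Small.lt hV hf) (Operand.Small.lt hV hf)⟩

instance (u v : Operand) [u.Small] [v.Small] : (Test.eq u v).Small :=
  ⟨fun {V f} hV hf => by
    rw [Test.cost, Operand.eval_mk, Operand.eval_mk]
    exact hV.cost_le _ _ (Operand.Small.lt hV hf) (Operand.Small.lt hV hf)⟩

/-- Program `c`, started on registers `f`, uses at most `T` steps, respects the environment, and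
ends with registers that satisfy `Q`. -/
def Tri (V : Env) (c : Cmd) (f : ℕ →₀ ℤ) (T : ℕ) (Q : (ℕ →₀ ℤ) → Prop) : Prop :=
  V.Ok f → ∃ f', V.Ok f' ∧ Q f' ∧
    ∀ κ k, V.E k ⟨c :: κ, ⟨f, V.mem⟩⟩ ≤ T + V.E k ⟨κ, ⟨f', V.mem⟩⟩

variable {V : Env} {f : ℕ →₀ ℤ} {Q : (ℕ →₀ ℤ) → Prop} {T : ℕ}

lemma Env.Ok.upd (hf : V.Ok f) {x : ℕ} (hx : x < numRegs) {v : ℤ} (hv : |v| < V.H) :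
    V.Ok (upd f x v) := by
  refine ⟨fun y => ?_, fun y hy => ?_⟩
  · rw [upd_apply]
    split_ifs
    · exact hv
    · exact hf.1 y
  · rw [upd_apply, if_neg (by omega)]
    exact hf.2 y hy

lemma Env.Ok.good (hf : V.Ok f) {c : Cmd} {κ : List Cmd}
    (hc : cost ⟨c :: κ, ⟨f, V.mem⟩⟩ ≤ V.w) : V.Good ⟨c :: κ, ⟨f, V.mem⟩⟩ :=
  ⟨hf, rfl, hc, by simp⟩

lemma Env.Fit.one_le (hV : V.Fit) : 1 ≤ V.w := hV.w_pos

lemma Tri.of_ok {c : Cmd} (h : V.Ok f → Tri V c f T Q) : Tri V c f T Q := fun hf => h hf hf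

lemma Tri.mono {c : Cmd} {T' : ℕ} {Q' : (ℕ →₀ ℤ) → Prop} (h : Tri V c f T' Q') (hT : T' ≤ T)
    (hQ : ∀ f', Q' f' → Q f') : Tri V c f T Q := by
  intro hf
  obtain ⟨f', h1, h2, h3⟩ := h hf
  exact ⟨f', h1, hQ _ h2, fun κ k => (h3 κ k).trans (by gcongr)⟩

lemma Tri.le {c : Cmd} {T' : ℕ} (h : Tri V c f T' Q) (hT : T' ≤ T) : Tri V c f T Q :=
  h.mono hT fun _ h => h

lemma Tri.skip (hV : V.Fit) (h : Q f) (hT : 1 ≤ T := by omega) : Tri V .skip f T Q := by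
  refine Tri.le (T' := 1) (fun hf => ⟨f, hf, h, fun κ k => ?_⟩) hT
  have := V.E_step (hf.good (c := .skip) (κ := κ) (by simpa [cost] using hV.one_le))
    (d := ⟨κ, ⟨f, V.mem⟩⟩) (by simp [step]) k
  simpa using this

lemma Tri.assign (hV : V.Fit) {x : ℕ} {o : Op} {u v : Operand} [u.Small] [v.Small] (w : ℤ)
    (hw : o.eval (u.val f) (v.val f) = w) (hx : x < numRegs) (hb : |w| < V.H)
    (h : Q (upd f x w)) (hT : 1 ≤ T := by omega) : Tri V (.assign x o u v) f T Q := by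
  subst hw
  refine Tri.le (T' := 1) (fun hf => ⟨_, hf.upd hx hb, h, fun κ k => ?_⟩) hT
  have := V.E_step (hf.good (c := .assign x o u v) (κ := κ) (by
      rw [cost, Operand.eval_mk, Operand.eval_mk]
      exact hV.cost_le _ _ (Operand.Small.lt hV hf) (Operand.Small.lt hV hf)))
    (d := ⟨κ, ⟨upd f x (o.eval (u.val f) (v.val f)), V.mem⟩⟩)
    (by intro b; rw [step, Operand.eval_mk, Operand.eval_mk]; rfl) k
  simpa using this

lemma Tri.load (hV : V.Fit) {x : ℕ} {u : Operand} [u.Small] (w : ℤ) (hw : V.mem (u.val f) = w)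
    (hx : x < numRegs) (h : Q (upd f x w)) (hT : 1 ≤ T := by omega) :
    Tri V (.load x u) f T Q := by
  subst hw
  refine Tri.le (T' := 1) (fun hf => ⟨_, hf.upd hx (hV.mem_lt _), h, fun κ k => ?_⟩) hT
  have := V.E_step (hf.good (c := .load x u) (κ := κ) (by
      rw [cost, Operand.eval_mk]
      exact hV.cost_le _ _ (Operand.Small.lt hV hf) (hV.mem_lt _)))
    (d := ⟨κ, ⟨upd f x (V.mem (u.val f)), V.mem⟩⟩)
    (by intro b; rw [step, Operand.eval_mk]; rfl) k
  simpa using this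

lemma Tri.seq (hV : V.Fit) {c d : Cmd} (T₁ T₂ : ℕ) {P : (ℕ →₀ ℤ) → Prop} (hc : Tri V c f T₁ P)
    (hd : ∀ f', P f' → Tri V d f' T₂ Q) (hT : T₁ + T₂ + 1 ≤ T := by omega) :
    Tri V (.seq c d) f T Q := by
  refine Tri.le (T' := T₁ + T₂ + 1) ?_ hT
  intro hf
  obtain ⟨f₁, h1, h2, h3⟩ := hc hf
  obtain ⟨f₂, h4, h5, h6⟩ := hd f₁ h2 h1
  refine ⟨f₂, h4, h5, fun κ k => ?_⟩
  have := V.E_step (hf.good (c := .seq c d) (κ := κ) (by simpa [cost] using hV.one_le))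
    (d := ⟨c :: d :: κ, ⟨f, V.mem⟩⟩) (by simp [step]) k
  calc _ ≤ _ := this
    _ ≤ 1 + (T₁ + (T₂ + V.E k ⟨κ, ⟨f₂, V.mem⟩⟩)) := by
        gcongr
        exact (h3 _ k).trans (by gcongr; exact h6 κ k)
    _ = _ := by push_cast; ring

lemma Tri.seq_assign (hV : V.Fit) {x : ℕ} {o : Op} {u v : Operand} [u.Small] [v.Small]
    {d : Cmd} (w : ℤ) (hw : o.eval (u.val f) (v.val f) = w) (hx : x < numRegs) (hb : |w| < V.H)
    (h : Tri V d (upd f x w) T Q) : Tri V (.seq (.assign x o u v) d) f (T + 2) Q :=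
  Tri.seq hV 1 T (Tri.assign hV w hw hx hb (Q := fun f' => f' = upd f x w) rfl)
    (fun _ hf' => hf' ▸ h)

lemma Tri.seq_load (hV : V.Fit) {x : ℕ} {u : Operand} [u.Small] {d : Cmd} (w : ℤ)
    (hw : V.mem (u.val f) = w) (hx : x < numRegs) (h : Tri V d (upd f x w) T Q) :
    Tri V (.seq (.load x u) d) f (T + 2) Q :=
  Tri.seq hV 1 T (Tri.load hV w hw hx (Q := fun f' => f' = upd f x w) rfl)
    (fun _ hf' => hf' ▸ h)

lemma Tri.ite (hV : V.Fit) {g : Test} [g.Small] {c d : Cmd}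
    (hc : g.tr f → Tri V c f T Q) (hd : ¬ g.tr f → Tri V d f T Q) :
    Tri V (.ite g c d) f (T + 1) Q := by
  intro hf
  have hg : ∀ κ, V.Good ⟨.ite g c d :: κ, ⟨f, V.mem⟩⟩ := fun κ =>
    hf.good (by rw [cost]; exact Test.Small.cost_le hV hf)
  by_cases h : g.tr f
  · obtain ⟨f₁, h1, h2, h3⟩ := hc h hf
    refine ⟨f₁, h1, h2, fun κ k => ?_⟩
    refine (V.E_step (hg κ) (d := ⟨c :: κ, ⟨f, V.mem⟩⟩)
      (by intro b; rw [step, Test.holds_mk, if_pos h]) k).trans ?_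
    calc _ ≤ 1 + (T + V.E k ⟨κ, ⟨f₁, V.mem⟩⟩) := by gcongr; exact h3 κ k
      _ = _ := by push_cast; ring
  · obtain ⟨f₁, h1, h2, h3⟩ := hd h hf
    refine ⟨f₁, h1, h2, fun κ k => ?_⟩
    refine (V.E_step (hg κ) (d := ⟨d :: κ, ⟨f, V.mem⟩⟩)
      (by intro b; rw [step, Test.holds_mk, if_neg h]) k).trans ?_
    calc _ ≤ 1 + (T + V.E k ⟨κ, ⟨f₁, V.mem⟩⟩) := by gcongr; exact h3 κ k
      _ = _ := by push_cast; ring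

lemma Env.E_while_true (hV : V.Fit) {g : Test} [g.Small] {c : Cmd} (hf : V.Ok f) (hg : g.tr f)
    (κ : List Cmd) (k : ℕ) : V.E k ⟨.while g c :: κ, ⟨f, V.mem⟩⟩ ≤
      1 + V.E k ⟨c :: .while g c :: κ, ⟨f, V.mem⟩⟩ :=
  V.E_step (hf.good (by rw [cost]; exact Test.Small.cost_le hV hf))
    (by intro b; rw [step, Test.holds_mk, if_pos hg]) k

lemma Env.E_while_false (hV : V.Fit) {g : Test} [g.Small] {c : Cmd} (hf : V.Ok f) (hg : ¬ g.tr f)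
    (κ : List Cmd) (k : ℕ) : V.E k ⟨.while g c :: κ, ⟨f, V.mem⟩⟩ ≤ 1 + V.E k ⟨κ, ⟨f, V.mem⟩⟩ :=
  V.E_step (hf.good (by rw [cost]; exact Test.Small.cost_le hV hf))
    (by intro b; rw [step, Test.holds_mk, if_neg hg]) k

/-- Loops, with an invariant indexed by a bound on the number of remaining rounds. -/
lemma Tri.while (hV : V.Fit) {g : Test} [g.Small] {c : Cmd} (I : ℕ → (ℕ →₀ ℤ) → Prop)
    (hs : ∀ j f, I j f → g.tr f → ∃ i, j = i + 1 ∧ Tri V c f T (I i)) (j : ℕ) (hI : I j f)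
    (hQ : ∀ j f, I j f → ¬ g.tr f → Q f) : Tri V (.while g c) f (j * (T + 1) + 1) Q := by
  induction j using Nat.strong_induction_on generalizing f with
  | _ j ih =>
    intro hf
    by_cases hg : g.tr f
    · obtain ⟨i, rfl, ht⟩ := hs j f hI hg
      obtain ⟨f₁, h1, h2, h3⟩ := ht hf
      obtain ⟨f₂, h4, h5, h6⟩ := ih i (by omega) h2 h1
      refine ⟨f₂, h4, h5, fun κ k => (Env.E_while_true hV hf hg κ k).trans ?_⟩
      calc _ ≤ 1 + (T + ((i * (T + 1) + 1 : ℕ) + V.E k ⟨κ, ⟨f₂, V.mem⟩⟩)) := by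
            gcongr
            exact (h3 _ k).trans (by gcongr; exact h6 κ k)
        _ = _ := by push_cast; ring
    · refine ⟨f, hf, hQ j f hI hg, fun κ k => (Env.E_while_false hV hf hg κ k).trans ?_⟩
      gcongr
      simp

/-- Unlike the other commands, a toss has two successor states, which a `Tri` with its single final
state cannot express. Hence this is stated for `Env.E` directly. -/
lemma Env.E_flip (hV : V.Fit) (hf : V.Ok f) (x : ℕ) (κ : List Cmd) (k : ℕ) :
    V.E k ⟨.flip x :: κ, ⟨f, V.mem⟩⟩ ≤
      1 + (V.E k ⟨κ, ⟨upd f x 0, V.mem⟩⟩ + V.E k ⟨κ, ⟨upd f x 1, V.mem⟩⟩) / 2 := by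
  cases k with
  | zero => simp [Env.E]
  | succ k =>
    rw [Env.E]
    gcongr
    · exact Env.pay_of_good (hf.good (by simpa [cost] using hV.one_le))
    · unfold avg
      gcongr
      · exact V.E_le_succ k _
      · exact V.E_le_succ k _

/-! ### Space -/

lemma bitlen_le_of_abs_lt {v : ℤ} {β : ℕ} (h : |v| < 2 ^ β) : bitlen v ≤ β + 1 := by
  unfold bitlen
  have : v.natAbs < 2 ^ β := by
    zify
    exact h
  have := Nat.size_le.2 this
  omega

lemma Env.Good.space_le {c : Config} (h : V.Good c) {β : ℕ} (hH : V.H = 2 ^ β) :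
    c.space ≤ numRegs * (β + 1) + V.mem.sum fun i v => bitlen i + bitlen v := by
  obtain ⟨⟨h1, h2⟩, h3, -, -⟩ := h
  unfold Config.space
  rw [h3]
  gcongr
  rw [Finsupp.sum]
  calc ∑ x ∈ c.store.regs.support, bitlen (c.store.regs x)
      ≤ ∑ x ∈ c.store.regs.support, (β + 1) :=
        Finset.sum_le_sum fun x _ => bitlen_le_of_abs_lt (hH ▸ h1 x)
    _ = c.store.regs.support.card * (β + 1) := by simp
    _ ≤ _ := by
        gcongr
        calc _ ≤ (Finset.range numRegs).card := by
              refine Finset.card_le_card fun x hx => ?_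
              rw [Finset.mem_range]
              by_contra hx'
              exact Finsupp.mem_support_iff.1 hx (h2 x (not_lt.1 hx'))
          _ = numRegs := by simp

/-! ### Frames -/

/-- `f'` agrees with `f` outside the registers in `S`. -/
def Frame (S : List ℕ) (f f' : ℕ →₀ ℤ) : Prop := ∀ x, x ∉ S → f' x = f x

lemma Frame.refl (S : List ℕ) (f : ℕ →₀ ℤ) : Frame S f f := fun _ _ => rfl

lemma Frame.upd {S : List ℕ} {f f' : ℕ →₀ ℤ} (h : Frame S f f') {x : ℕ} (hx : x ∈ S) (v : ℤ) :
    Frame S f (upd f' x v) := by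
  intro y hy
  rw [upd_apply, if_neg (by rintro rfl; exact hy hx), h y hy]

lemma Frame.trans {S S' : List ℕ} {f f' f'' : ℕ →₀ ℤ} (h : Frame S f f') (h' : Frame S' f' f'')
    (hS : S' ⊆ S) : Frame S f f'' :=
  fun x hx => (h' x fun hx' => hx (hS hx')).trans (h x hx)

end RAM

namespace SubsetSum

/-! ### Counting subset sums with Teichmüller representatives -/

section Teichmuller

variable {q N : ℕ}

/-- Each `q`-th power improves a congruence by one factor `q`. So `x ^ q ^ N` depends only on the
residue of `x` modulo `q`: it is the Teichmüller representative of that residue. -/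
lemma pow_prime_pow_congr {x y : ℕ} (h : (x : ℤ) ≡ y [ZMOD q]) :
    ((x : ZMod (q ^ (N + 1))) ^ q ^ N) = (y : ZMod (q ^ (N + 1))) ^ q ^ N := by
  have h1 : ((q : ℕ) : ℤ) ∣ (y : ℤ) - x := h.dvd
  have h2 := dvd_sub_pow_of_dvd_sub (R := ℤ) h1 N
  have h3 : ((x ^ q ^ N : ℤ) : ZMod (q ^ (N + 1))) = ((y ^ q ^ N : ℤ) : ZMod (q ^ (N + 1))) := by
    rw [ZMod.intCast_eq_intCast_iff]
    refine Int.modEq_iff_dvd.2 ?_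
    exact_mod_cast h2
  exact_mod_cast h3

/-- Euler's theorem, as `q ^ N * (q - 1)` is the totient of `q ^ (N + 1)`. -/
lemma teichmuller_pow_pred (hq : q.Prime) {x : ℕ} (hx : x ∈ Finset.Ico 1 q) :
    ((x : ZMod (q ^ (N + 1))) ^ q ^ N) ^ (q - 1) = 1 := by
  rw [Finset.mem_Ico] at hx
  have hc : x.Coprime (q ^ (N + 1)) :=
    Nat.Coprime.pow_right _ (Nat.coprime_of_lt_prime (by omega) hx.2 hq).symm
  have := Nat.ModEq.pow_totient hc
  rw [Nat.totient_prime_pow_succ hq, pow_mul, ← ZMod.natCast_eq_natCast_iff] at this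
  exact_mod_cast this

lemma isUnit_of_not_dvd (hq : q.Prime) {z : ℤ} (hz : ¬ (q : ℤ) ∣ z) :
    IsUnit ((z : ℤ) : ZMod (q ^ (N + 1))) := by
  rw [ZMod.coe_int_isUnit_iff_isCoprime]
  push_cast
  refine IsCoprime.pow_left ?_
  exact (Int.prime_iff_natAbs_prime.2 (by simpa using hq)).coprime_iff_not_dvd.2 hz

/-- Orthogonality. The ring has zero divisors, so the usual cancellation of `w ^ k - 1` needs this
element to be a unit, not only nonzero. -/
lemma sum_teichmuller_pow (hq : q.Prime) (k : ℕ) :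
    ∑ x ∈ Finset.Ico 1 q, ((x : ZMod (q ^ (N + 1))) ^ q ^ N) ^ k =
      if q - 1 ∣ k then ((q - 1 : ℕ) : ZMod (q ^ (N + 1))) else 0 := by
  have := Fact.mk hq
  split_ifs with hk
  · obtain ⟨d, rfl⟩ := hk
    rw [Finset.sum_congr rfl (g := fun _ => 1)]
    · simp
    · intro x hx
      rw [pow_mul, teichmuller_pow_pred hq hx, one_pow]
  · obtain ⟨g, hg⟩ := IsCyclic.exists_generator (α := (ZMod q)ˣ)
    set y : ℕ := (g : ZMod q).val with hy
    have hyg : ((y : ℕ) : ZMod q) = g := by simp [hy]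
    have hy0 : (g : ZMod q) ≠ 0 := g.ne_zero
    set w : ZMod (q ^ (N + 1)) := (y : ZMod (q ^ (N + 1))) ^ q ^ N with hw
    set σ := ∑ x ∈ Finset.Ico 1 q, ((x : ZMod (q ^ (N + 1))) ^ q ^ N) ^ k with hσ
    -- Multiplication by the generator `g` permutes the nonzero residues modulo `q`, and Teichmüller
    -- representatives multiply accordingly.
    have hmul : σ * w ^ k = σ := by
      rw [hσ, Finset.sum_mul]
      have hval : ∀ x ∈ Finset.Ico 1 q, ((x : ℕ) : ZMod q) ≠ 0 := by
        intro x hx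
        rw [Finset.mem_Ico] at hx
        rw [Ne, ZMod.natCast_eq_zero_iff]
        exact fun h => absurd (Nat.le_of_dvd (by omega) h) (by omega)
      refine Finset.sum_bij (fun x _ => ((x : ZMod q) * g).val) ?_ ?_ ?_ ?_
      · intro x hx
        rw [Finset.mem_Ico]
        refine ⟨?_, ZMod.val_lt _⟩
        rw [Nat.one_le_iff_ne_zero, Ne, ZMod.val_eq_zero]
        exact mul_ne_zero (hval x hx) hy0
      · intro x hx x' hx' h
        have h1 := mul_right_cancel₀ hy0 (ZMod.val_injective q h)
        rw [Finset.mem_Ico] at hx hx'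
        rw [ZMod.natCast_eq_natCast_iff] at h1
        exact Nat.ModEq.eq_of_lt_of_lt h1 hx.2 hx'.2
      · intro x hx
        have hx0 := hval x hx
        refine ⟨((x : ZMod q) * (g : ZMod q)⁻¹).val, ?_, ?_⟩
        · rw [Finset.mem_Ico]
          refine ⟨?_, ZMod.val_lt _⟩
          rw [Nat.one_le_iff_ne_zero, Ne, ZMod.val_eq_zero]
          exact mul_ne_zero hx0 (inv_ne_zero hy0)
        · rw [Finset.mem_Ico] at hx
          simp only [ZMod.natCast_val, ZMod.cast_id', id]
          rw [mul_assoc, inv_mul_cancel₀ hy0, mul_one, ZMod.val_natCast_of_lt hx.2]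
      · intro x hx
        rw [hw, ← mul_pow, ← mul_pow]
        congr 1
        rw [← Nat.cast_mul]
        refine pow_prime_pow_congr ?_
        rw [← ZMod.intCast_eq_intCast_iff]
        push_cast
        simp [hyg]
    -- Modulo `q` the power `q ^ N` is an iterate of Frobenius, hence trivial, and the element
    -- reduces to `g ^ k - 1`. This is nonzero because `g` has order `q - 1`, which does not divide
    -- `k`.
    have hu : IsUnit (w ^ k - 1) := by
      have : w ^ k - 1 = (((y : ℤ) ^ q ^ N) ^ k - 1 : ℤ) := by
        push_cast
        rfl
      rw [this]
      refine isUnit_of_not_dvd hq ?_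
      rw [← ZMod.intCast_zmod_eq_zero_iff_dvd]
      push_cast
      rw [hyg, ZMod.pow_card_pow]
      intro h
      apply hk
      have h1 : g ^ k = 1 := by
        ext
        push_cast
        exact sub_eq_zero.1 h
      have h2 := orderOf_dvd_of_pow_eq_one h1
      rwa [orderOf_eq_card_of_forall_mem_zpowers hg, Nat.card_eq_fintype_card,
        ZMod.card_units] at h2
    have h0 : σ * (w ^ k - 1) = 0 := by rw [mul_sub, hmul, mul_one, sub_self]
    exact (hu.mul_left_eq_zero).1 h0

/-- The character sum vanishes iff no subset has the prescribed residue. -/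
theorem characterSum_eq_zero_iff (hq : q.Prime) (s : Finset ℕ) (hs : s.card ≤ N) (b : ℕ → ℕ)
    (ρ : ℕ) :
    ∑ x ∈ Finset.Ico 1 q, ((x : ZMod (q ^ (N + 1))) ^ q ^ N) ^ ρ *
      ∏ i ∈ s, (1 + ((x : ZMod (q ^ (N + 1))) ^ q ^ N) ^ b i) = 0 ↔
    ¬ ∃ Y ⊆ s, q - 1 ∣ ρ + ∑ i ∈ Y, b i := by
  classical
  -- Expanding the product over subsets and exchanging the sums leaves, by orthogonality, `q - 1`
  -- for each subset of the right residue.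
  have h1 : ∑ x ∈ Finset.Ico 1 q, ((x : ZMod (q ^ (N + 1))) ^ q ^ N) ^ ρ *
      ∏ i ∈ s, (1 + ((x : ZMod (q ^ (N + 1))) ^ q ^ N) ^ b i) =
      (((q - 1) * (s.powerset.filter fun Y => q - 1 ∣ ρ + ∑ i ∈ Y, b i).card : ℕ) :
        ZMod (q ^ (N + 1))) := by
    simp_rw [Finset.prod_one_add, Finset.mul_sum]
    rw [Finset.sum_comm]
    simp_rw [Finset.prod_pow_eq_pow_sum, ← pow_add, sum_teichmuller_pow hq]
    rw [← Finset.sum_filter, Finset.sum_const, nsmul_eq_mul, mul_comm]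
    push_cast
    rfl
  rw [h1, ZMod.natCast_eq_zero_iff]
  have hcop : (q ^ (N + 1)).Coprime (q - 1) := by
    refine Nat.Coprime.pow_left _ ?_
    have := hq.two_le
    exact Nat.coprime_of_lt_prime (by omega) (by omega) hq
  rw [hcop.dvd_mul_left]
  -- This is why the modulus is `q ^ (N + 1)`: the number of subsets is smaller, so it cannot vanish
  -- by accident.
  have hlt : (s.powerset.filter fun Y => q - 1 ∣ ρ + ∑ i ∈ Y, b i).card < q ^ (N + 1) := by
    calc _ ≤ s.powerset.card := Finset.card_filter_le _ _
      _ = 2 ^ s.card := Finset.card_powerset s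
      _ ≤ 2 ^ N := Nat.pow_le_pow_right (by norm_num) hs
      _ < 2 ^ (N + 1) := Nat.pow_lt_pow_right (by norm_num) (by omega)
      _ ≤ q ^ (N + 1) := Nat.pow_le_pow_left hq.two_le _
  constructor
  · rintro hd ⟨Y, hY, hY'⟩
    have := Nat.eq_zero_of_dvd_of_lt hd hlt
    rw [Finset.card_eq_zero] at this
    have hmem : Y ∈ s.powerset.filter fun Y => q - 1 ∣ ρ + ∑ i ∈ Y, b i := by simp [hY, hY']
    rw [this] at hmem
    simp at hmem
  · intro hne
    have : s.powerset.filter (fun Y => q - 1 ∣ ρ + ∑ i ∈ Y, b i) = ∅ := by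
      refine Finset.filter_eq_empty_iff.2 fun Y hY hY' => hne ⟨Y, Finset.mem_powerset.1 hY, hY'⟩
    simp [this]

end Teichmuller

end SubsetSum

namespace SubsetSum

/-! ### Many pairs of primes without collisions -/

/-- Chebyshev's argument: with `M = 2 ^ j`, the least common multiple of `1, …, M` is at least `2 ^
M / (M + 1)`, and it is a product of one prime power at most `M` for each prime below `M`. -/
lemma two_pow_le_mul_primesBelow {j : ℕ} (hj : 2 ≤ j) :
    2 ^ j ≤ 4 * j * (Nat.primesBelow (2 ^ j)).card := by
  have h4 : 2 ^ 2 ≤ 2 ^ j := Nat.pow_le_pow_right (by norm_num) hj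
  have hnp : ¬ (2 ^ j).Prime := Nat.Prime.not_prime_pow hj
  have hle : Nat.primesLE (2 ^ j) = Nat.primesBelow (2 ^ j) := by
    ext p
    simp only [Nat.mem_primesLE, Nat.mem_primesBelow]
    constructor
    · rintro ⟨h1, h2⟩
      exact ⟨lt_of_le_of_ne h1 (by rintro rfl; exact hnp h2), h2⟩
    · rintro ⟨h1, h2⟩
      exact ⟨h1.le, h2⟩
  have h1 := Chebyshev.two_pow_le_mul_lcmUpto (2 ^ j)
  rw [Nat.lcmUpto_eq_prod_pow_log, hle] at h1
  set c := (Nat.primesBelow (2 ^ j)).card with hc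
  have hpos : 1 ≤ c := Finset.card_pos.2 ⟨2, Nat.mem_primesBelow.2 ⟨by omega, Nat.prime_two⟩⟩
  have h2 : ∏ p ∈ Nat.primesBelow (2 ^ j), p ^ p.log (2 ^ j) ≤ (2 ^ j) ^ c := by
    refine Finset.prod_le_pow_card _ _ _ fun p _ => ?_
    exact Nat.pow_log_le_self p (by positivity)
  have h3 : 2 ^ 2 ^ j ≤ 2 ^ (j + 1 + j * c) := by
    calc 2 ^ 2 ^ j ≤ (2 ^ j + 1) * (2 ^ j) ^ c := h1.trans (by gcongr)
      _ ≤ 2 ^ (j + 1) * (2 ^ j) ^ c := by gcongr; rw [pow_succ]; omega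
      _ = _ := by rw [pow_add _ (j + 1), pow_mul]
  have h4 := (Nat.pow_le_pow_iff_right (by norm_num)).1 h3
  nlinarith [Nat.mul_le_mul_left j hpos]

variable {n : ℕ}

/-- No subset sum other than `t` is congruent to `t` modulo `m`. -/
def Separates (a : Fin n → ℤ) (t : ℤ) (m : ℕ) : Prop :=
  ∀ X : Finset (Fin n), (m : ℤ) ∣ ∑ e ∈ X, a e - t → ∑ e ∈ X, a e = t

/-- The pairs of moduli on which the modular test can be run. -/
def Admissible (n q m : ℕ) : Prop := q.Prime ∧ 8 * (n + 1) * m ≤ q ∧ 1 ≤ m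

lemma abs_lt_two_pow_bitlen (z : ℤ) : |z| < 2 ^ RAM.bitlen z := by
  have h : z.natAbs < 2 ^ RAM.bitlen z :=
    (Nat.lt_size_self _).trans_le (Nat.pow_le_pow_right (by norm_num) (by simp [RAM.bitlen]))
  zify at h
  exact h

lemma one_le_bitlen (z : ℤ) : 1 ≤ RAM.bitlen z := by simp [RAM.bitlen]

lemma abs_add_sum_abs_lt (a : Fin n → ℤ) (t : ℤ) (s : Finset (Fin n)) :
    |t| + ∑ i ∈ s, |a i| < 2 ^ (RAM.bitlen t + ∑ i ∈ s, RAM.bitlen (a i)) := by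
  induction s using Finset.induction_on with
  | empty => simpa using abs_lt_two_pow_bitlen t
  | insert i s hi ih =>
    rw [Finset.sum_insert hi, Finset.sum_insert hi]
    have h1 := abs_lt_two_pow_bitlen (a i)
    have h2 : RAM.bitlen t + (RAM.bitlen (a i) + ∑ i ∈ s, RAM.bitlen (a i)) =
        RAM.bitlen (a i) + (RAM.bitlen t + ∑ i ∈ s, RAM.bitlen (a i)) := by ring
    rw [h2, pow_add]
    have h3 : (2 : ℤ) ^ 1 ≤ 2 ^ RAM.bitlen (a i) :=
      pow_le_pow_right₀ (by norm_num) (one_le_bitlen _)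
    -- The sign bit makes both powers at least `2`, so their product dominates their sum.
    have h4 : (2 : ℤ) ^ 1 ≤ 2 ^ (RAM.bitlen t + ∑ i ∈ s, RAM.bitlen (a i)) :=
      pow_le_pow_right₀ (by norm_num) (by have := one_le_bitlen t; omega)
    nlinarith

lemma abs_sum_sub_lt (a : Fin n → ℤ) (t : ℤ) (X : Finset (Fin n)) :
    |∑ e ∈ X, a e - t| < 2 ^ inputSize a t := by
  calc |∑ e ∈ X, a e - t| ≤ |∑ e ∈ X, a e| + |t| := abs_sub _ _
    _ ≤ ∑ e, |a e| + |t| := by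
        gcongr
        exact (Finset.abs_sum_le_sum_abs _ _).trans
          (Finset.sum_le_sum_of_subset_of_nonneg (Finset.subset_univ _) fun _ _ _ => abs_nonneg _)
    _ < _ := by
        rw [add_comm]
        exact abs_add_sum_abs_lt a t Finset.univ

lemma card_primeFactors_le {z L : ℕ} (hz : z ≠ 0) (h : z < 2 ^ L) : z.primeFactors.card ≤ L := by
  have h1 : 2 ^ z.primeFactors.card ≤ z := by
    calc 2 ^ z.primeFactors.card ≤ ∏ p ∈ z.primeFactors, p :=
          Finset.pow_card_le_prod _ _ _ fun p hp => (Nat.prime_of_mem_primeFactors hp).two_le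
      _ ≤ z := Nat.le_of_dvd (Nat.pos_of_ne_zero hz) (Nat.prod_primeFactors_dvd z)
  exact ((Nat.pow_lt_pow_iff_right (by norm_num)).1 (h1.trans_lt h)).le

/-- All but few primes separate the target from the other subset sums. -/
lemma exists_separating (a : Fin n → ℤ) (t : ℤ) (s : Finset ℕ) (hs : ∀ p ∈ s, p.Prime) :
    ∃ G ⊆ s, (∀ m ∈ G, Separates a t m) ∧ s.card ≤ G.card + numSums a * inputSize a t := by
  classical
  set D := Finset.univ.image fun X : Finset (Fin n) => ∑ e ∈ X, a e with hD
  -- The bad primes: those dividing the difference between `t` and some other subset sum.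
  set B := (D.erase t).biUnion fun z => (z - t).natAbs.primeFactors with hB
  have hBcard : B.card ≤ numSums a * inputSize a t := by
    calc B.card ≤ (D.erase t).card * inputSize a t := by
          refine Finset.card_biUnion_le_card_mul _ _ _ fun z hz => ?_
          rw [Finset.mem_erase] at hz
          obtain ⟨X, -, rfl⟩ := Finset.mem_image.1 hz.2
          refine card_primeFactors_le (by rw [Ne, Int.natAbs_eq_zero, sub_eq_zero]; exact hz.1) ?_
          have := abs_sum_sub_lt a t X
          zify
          exact this
      _ ≤ _ := by
          gcongr
          exact Finset.card_le_card (Finset.erase_subset _ _)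
  refine ⟨s \ B, Finset.sdiff_subset, fun m hm X hX => ?_, ?_⟩
  · by_contra hne
    rw [Finset.mem_sdiff] at hm
    refine hm.2 (Finset.mem_biUnion.2 ⟨∑ e ∈ X, a e, ?_, ?_⟩)
    · exact Finset.mem_erase.2 ⟨hne, Finset.mem_image_of_mem _ (Finset.mem_univ X)⟩
    · rw [Nat.mem_primeFactors]
      refine ⟨hs m hm.1, ?_, ?_⟩
      · exact Int.natCast_dvd.1 hX
      · rw [Ne, Int.natAbs_eq_zero, sub_eq_zero]
        exact hne
  · have := Finset.le_card_sdiff B s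
    omega

lemma card_le_inputSize (a : Fin n → ℤ) (t : ℤ) : n ≤ inputSize a t := by
  unfold inputSize
  calc n = ∑ i : Fin n, 1 := by simp
    _ ≤ ∑ i, RAM.bitlen (a i) := Finset.sum_le_sum fun i _ => one_le_bitlen _
    _ ≤ _ := Nat.le_add_left _ _

lemma one_le_numSums (a : Fin n → ℤ) : 1 ≤ numSums a :=
  Finset.card_pos.2 (Finset.univ_nonempty.image _)

lemma numSums_le (a : Fin n → ℤ) : numSums a ≤ 2 ^ n := by
  refine Finset.card_image_le.trans ?_
  simp

lemma exists_pow_two (x : ℕ) (hx : 1 < x) : ∃ u, x ≤ 2 ^ u ∧ 2 ^ u ≤ 2 * x := by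
  refine ⟨Nat.clog 2 x, Nat.le_pow_clog (by norm_num) x, ?_⟩
  have h := Nat.pow_pred_clog_lt_self (b := 2) (by norm_num) hx
  have hp : 0 < Nat.clog 2 x := Nat.clog_pos (by norm_num) hx
  have : Nat.clog 2 x = (Nat.clog 2 x).pred + 1 := (Nat.succ_pred_eq_of_pos hp).symm
  rw [this, pow_succ]
  omega

/-- There are many admissible pairs with a separating modulus, of size close to `numSums a`. -/
theorem exists_many_pairs (a : Fin n → ℤ) (t : ℤ) (L : ℕ) (hL : L = inputSize a t + 10) :
    ∃ j ≤ 8 * L, 2 ^ j ≤ 2 ^ 16 * numSums a * L ^ 4 ∧ ∃ G : Finset (ℕ × ℕ),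
      (∀ p ∈ G, p.1 < 2 ^ j ∧ p.2 < 2 ^ j ∧ Admissible n p.1 p.2 ∧ Separates a t p.2) ∧
      4 ^ j ≤ 2 ^ 21 * L ^ 4 * G.card := by
  classical
  have hn := card_le_inputSize a t
  set S := numSums a with hS
  have hS1 : 1 ≤ S := one_le_numSums a
  have hS2 : S ≤ 2 ^ L := (numSums_le a).trans (Nat.pow_le_pow_right (by norm_num) (by omega))
  have hL2 : L < 2 ^ L := Nat.lt_two_pow_self
  have hLsq : 1 ≤ L ^ 2 := Nat.one_le_pow _ _ (by omega)
  have hSL : 1 ≤ S * L ^ 2 := Nat.mul_pos hS1 hLsq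
  -- Separating primes `m` are taken below `2 ^ u`; the size of `u` makes at most half of the
  -- bad-prime estimate lost. The primes `q` are taken below `2 ^ (u + v)`, where `v` makes room for
  -- the demand `8 * (n + 1) * m ≤ q`.
  obtain ⟨u, hu1, hu2⟩ := exists_pow_two (32 * (S * L ^ 2)) (by omega)
  obtain ⟨v, hv1, hv2⟩ := exists_pow_two (512 * L ^ 2) (by omega)
  have hu3 : u ≤ 4 * L := by
    have hS3 : S ≤ 2 ^ (L - 10) :=
      (numSums_le a).trans (Nat.pow_le_pow_right (by norm_num) (by omega))
    have : 2 ^ u ≤ 2 ^ (6 + ((L - 10) + L * 2)) := by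
      calc 2 ^ u ≤ 2 ^ 6 * (S * L ^ 2) := by omega
        _ ≤ 2 ^ 6 * (2 ^ (L - 10) * (2 ^ L) ^ 2) := by gcongr
        _ = _ := by rw [pow_add, pow_add, pow_mul]
    have := (Nat.pow_le_pow_iff_right (by norm_num)).1 this
    omega
  have hv3 : v ≤ 4 * L := by
    have : 2 ^ v ≤ 2 ^ (10 + L * 2) := by
      calc 2 ^ v ≤ 2 ^ 10 * L ^ 2 := by omega
        _ ≤ 2 ^ 10 * (2 ^ L) ^ 2 := by gcongr
        _ = _ := by rw [pow_add, pow_mul]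
    have := (Nat.pow_le_pow_iff_right (by norm_num)).1 this
    omega
  have hu4 : 2 ≤ u := by
    by_contra h
    have : 2 ^ u ≤ 2 ^ 1 := Nat.pow_le_pow_right (by norm_num) (by omega)
    omega
  obtain ⟨G, hG1, hG2, hG3⟩ := exists_separating a t (Nat.primesBelow (2 ^ u))
    fun p hp => Nat.prime_of_mem_primesBelow hp
  have hGc : 2 ^ u ≤ 8 * u * G.card := by
    have h1 := two_pow_le_mul_primesBelow hu4
    have h2 : 4 * u * (S * inputSize a t) ≤ 16 * (S * L ^ 2) := by
      calc 4 * u * (S * inputSize a t) ≤ 4 * (4 * L) * (S * L) := by gcongr; omega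
        _ = _ := by ring
    have h3 : 4 * u * (Nat.primesBelow (2 ^ u)).card ≤
        4 * u * (G.card + S * inputSize a t) := by gcongr
    nlinarith
  set j := u + v with hj
  set P := (Nat.primesBelow (2 ^ j)).filter fun p => 8 * (n + 1) * 2 ^ u ≤ p with hP
  have hPc : 2 ^ j ≤ 8 * j * P.card := by
    have h1 := two_pow_le_mul_primesBelow (j := j) (by omega)
    have h2 : (Nat.primesBelow (2 ^ j)).card ≤ P.card + 8 * (n + 1) * 2 ^ u := by
      rw [← Finset.card_filter_add_card_filter_not (fun p => 8 * (n + 1) * 2 ^ u ≤ p)]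
      gcongr
      calc _ ≤ (Finset.range (8 * (n + 1) * 2 ^ u)).card := by
            refine Finset.card_le_card fun p hp => ?_
            simp only [Finset.mem_filter, not_le] at hp
            exact Finset.mem_range.2 hp.2
        _ = _ := Finset.card_range _
    -- Discarding all numbers below `8 * (n + 1) * 2 ^ u` costs at most half of the lower bound for
    -- the number of primes.
    have h3 : 8 * j * (8 * (n + 1) * 2 ^ u) ≤ 2 ^ j := by
      rw [hj, pow_add]
      calc 8 * (u + v) * (8 * (n + 1) * 2 ^ u) ≤ 8 * (4 * L + 4 * L) * (8 * L * 2 ^ u) := by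
            gcongr; omega
        _ = 2 ^ u * (512 * L ^ 2) := by ring
        _ ≤ _ := by gcongr
    have h4 : 4 * j * (Nat.primesBelow (2 ^ j)).card ≤
        4 * j * (P.card + 8 * (n + 1) * 2 ^ u) := by gcongr
    nlinarith
  refine ⟨j, by omega, ?_, P ×ˢ G, ?_, ?_⟩
  · calc 2 ^ j = 2 ^ u * 2 ^ v := by rw [hj, pow_add]
      _ ≤ (2 * (32 * (S * L ^ 2))) * (2 * (512 * L ^ 2)) := by gcongr
      _ = _ := by ring
  · rintro ⟨q, m⟩ hp
    obtain ⟨hq, hm⟩ := Finset.mem_product.1 hp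
    simp only [hP, Finset.mem_filter, Nat.mem_primesBelow] at hq
    have hm' := Nat.mem_primesBelow.1 (hG1 hm)
    refine ⟨hq.1.1, hm'.1.trans_le (Nat.pow_le_pow_right (by norm_num) (by omega)),
      ⟨hq.1.2, ?_, hm'.2.one_lt.le⟩, hG2 m hm⟩
    exact le_trans (by gcongr; exact hm'.1.le) hq.2
  · rw [Finset.card_product]
    -- The factor `2 ^ v`, polynomial in `L`, is lost because `m` ranges only below `2 ^ u`.
    calc 4 ^ j = 2 ^ v * (2 ^ u * 2 ^ j) := by
          rw [show 4 = 2 ^ 2 by norm_num, ← pow_mul, hj, ← pow_add, ← pow_add]; congr 1; ring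
      _ ≤ (2 * (512 * L ^ 2)) * ((8 * (4 * L) * G.card) * (8 * (8 * L) * P.card)) := by
          gcongr
          · exact hGc.trans (by gcongr)
          · exact hPc.trans (by gcongr; omega)
      _ = _ := by ring

end SubsetSum

namespace SubsetSum

open RAM

/-! ### The programs -/

notation "rN" => (0 : ℕ)
notation "rT" => (1 : ℕ)
notation "rq" => (2 : ℕ)
notation "rm" => (3 : ℕ)
notation "rFlag" => (4 : ℕ)
notation "rDone" => (5 : ℕ)
notation "rAns" => (6 : ℕ)
notation "rQ" => (7 : ℕ)
notation "rR" => (8 : ℕ)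
notation "rA" => (9 : ℕ)
notation "rE" => (10 : ℕ)
notation "rX" => (11 : ℕ)
notation "rAcc" => (12 : ℕ)
notation "rW" => (13 : ℕ)
notation "rPr" => (14 : ℕ)
notation "rI" => (15 : ℕ)
notation "rBase" => (16 : ℕ)
notation "rEx" => (17 : ℕ)
notation "rRes" => (18 : ℕ)
notation "rTmp" => (19 : ℕ)
notation "rz" => (20 : ℕ)
notation "rZ" => (21 : ℕ)
notation "rCoin" => (22 : ℕ)
notation "rN2" => (23 : ℕ)

infixr:60 " ;; " => Cmd.seq

/-- Multiply register `rRes` by `rBase ^ rEx`, modulo `rQ`. -/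
def powCmd : Cmd :=
  .while (.lt (.lit 0) (.reg rEx)) (
    .assign rTmp .mod (.reg rEx) (.lit 2) ;;
    .ite (.lt (.lit 0) (.reg rTmp))
      (.assign rRes .mul (.reg rRes) (.reg rBase) ;; .assign rRes .mod (.reg rRes) (.reg rQ))
      .skip ;;
    .assign rEx .div (.reg rEx) (.lit 2) ;;
    .assign rBase .mul (.reg rBase) (.reg rBase) ;;
    .assign rBase .mod (.reg rBase) (.reg rQ))

lemma abs_lt_of_mem {x H : ℤ} (h0 : 0 ≤ x) (h : x < H) : |x| < H := by rwa [abs_of_nonneg h0]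

variable {V : Env} {f : ℕ →₀ ℤ}

/-- Square and multiply: modulo `Q`, the product of `rRes` and `rBase` to the power `rEx` is
invariant, and each round removes one binary digit of the exponent. The room for `Q * Q` is for the
products before reduction. -/
lemma tri_powCmd (hV : V.Fit) {Q : ℕ} (hQ : 0 < Q) (hH : (Q : ℤ) * Q < V.H) {k j : ℕ}
    (hk : k < 2 ^ j) (h7 : f rQ = Q) (h16 : 0 ≤ f rBase ∧ f rBase < Q) (h17 : f rEx = k)
    (h18 : 0 ≤ f rRes ∧ f rRes < Q) :
    Tri V powCmd f (j * 20 + 1) fun f' => Frame [rBase, rEx, rRes, rTmp] f f' ∧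
      0 ≤ f' rRes ∧ f' rRes < Q ∧ (f' rRes : ZMod Q) = f rRes * f rBase ^ k := by
  have hQ' : (0 : ℤ) < Q := by exact_mod_cast hQ
  have hQH : (Q : ℤ) < V.H := by nlinarith
  refine Tri.le (Tri.while hV (T := 16) (fun i g => Frame [rBase, rEx, rRes, rTmp] f g ∧
    (0 ≤ g rBase ∧ g rBase < Q) ∧ (0 ≤ g rRes ∧ g rRes < Q) ∧ ∃ l : ℕ, g rEx = l ∧ l < 2 ^ i ∧
    (g rRes * g rBase ^ l : ZMod Q) = f rRes * f rBase ^ k) ?_ j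
    ⟨Frame.refl _ _, h16, h18, k, h17, hk, rfl⟩ ?_) (by omega)
  · rintro i g ⟨hF, ⟨hb0, hb1⟩, ⟨hr0, hr1⟩, l, hl, hli, heq⟩ hg
    simp only [Test.tr, Operand.val, hl] at hg
    have hl0 : 0 < l := by exact_mod_cast hg
    obtain ⟨i, rfl⟩ : ∃ i', i = i' + 1 := by
      cases i with
      | zero => simp at hli; omega
      | succ i => exact ⟨i, rfl⟩
    refine ⟨i, rfl, ?_⟩
    have hg7 : g rQ = Q := by rw [hF rQ (by simp), h7]
    have hbb : g rBase * g rBase < V.H := by nlinarith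
    refine Tri.of_ok fun hok => ?_
    have hlH : (l : ℤ) < V.H := by have := hok.1 rEx; rw [hl] at this; exact (le_abs_self _).trans_lt this
    have hm0 : 0 ≤ (l : ℤ) % 2 := Int.emod_nonneg _ (by norm_num)
    have hm2 : (l : ℤ) % 2 < 2 := Int.emod_lt_of_pos _ (by norm_num)
    refine Tri.seq_assign hV ((l : ℤ) % 2) (by simp [Op.eval, hl]) (by decide)
      (abs_lt_of_mem hm0 (by have := hV.lit_lt; omega)) (Tri.seq hV 6 7
      (P := fun g' => Frame [rBase, rEx, rRes, rTmp] f g' ∧ g' rBase = g rBase ∧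
        g' rEx = l ∧ (0 ≤ g' rRes ∧ g' rRes < Q) ∧
        (g' rRes : ZMod Q) = g rRes * g rBase ^ (l % 2))
      (Tri.ite hV (fun h => ?_) fun h => Tri.skip hV ?_) fun g' h => ?_)
    · refine Tri.seq_assign hV (g rRes * g rBase) (by simp [Op.eval]) (by decide)
        (abs_lt_of_mem (by positivity) (by nlinarith)) ?_
      refine Tri.assign hV (g rRes * g rBase % Q) (by simp [Op.eval, hg7]) (by decide)
        (abs_lt_of_mem (Int.emod_nonneg _ hQ'.ne')
          ((Int.emod_lt_of_pos _ hQ').trans hQH)) ?_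
      refine ⟨((hF.upd (by simp) _).upd (by simp) _).upd (by simp) _, by simp, by simp [hl],
        by simpa using ⟨Int.emod_nonneg _ hQ'.ne', Int.emod_lt_of_pos _ hQ'⟩, ?_⟩
      have : l % 2 = 1 := by simp at h; omega
      simp [this]
    · refine ⟨hF.upd (by simp) _, by simp, by simp [hl], by simpa using ⟨hr0, hr1⟩, ?_⟩
      have : l % 2 = 0 := by simp at h; omega
      simp [this]
    · obtain ⟨hF', hb', he', hr', heq'⟩ := h
      have hg7 : g' rQ = Q := by rw [hF' rQ (by simp), h7]
      refine Tri.seq_assign hV ((l / 2 : ℕ) : ℤ) (by simp [Op.eval, he']) (by decide)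
        (abs_lt_of_mem (by positivity) (by push_cast; omega)) ?_
      refine Tri.seq_assign hV (g rBase * g rBase) (by simp [Op.eval, hb']) (by decide)
        (abs_lt_of_mem (by positivity) hbb) ?_
      refine Tri.assign hV (g rBase * g rBase % Q) (by simp [Op.eval, hg7]) (by decide)
        (abs_lt_of_mem (Int.emod_nonneg _ hQ'.ne')
          ((Int.emod_lt_of_pos _ hQ').trans hQH)) ?_
      refine ⟨((hF'.upd (by simp) _).upd (by simp) _).upd (by simp) _,
        by simpa using ⟨Int.emod_nonneg _ hQ'.ne', Int.emod_lt_of_pos _ hQ'⟩, by simpa using hr',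
        l / 2, by simp, by rw [pow_succ] at hli; omega, ?_⟩
      simp only [upd_apply]
      norm_num
      rw [← heq, heq', mul_assoc, ← pow_two, ← pow_mul, ← pow_add, Nat.mod_add_div]
  · rintro i g ⟨hF, -, ⟨hr0, hr1⟩, l, hl, hli, heq⟩ hg
    simp only [Test.tr, Operand.val, hl] at hg
    have hl0 : l = 0 := by omega
    subst hl0
    exact ⟨hF, hr0, hr1, by simpa using heq⟩

end SubsetSum

/-! ### Evaluation of the character sum -/

namespace SubsetSum

open RAM

/-- Multiply `rPr` by `1 + rW ^ b`, where `b` is the weight of element `rI`. -/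
def factorCmd : Cmd :=
  .load rTmp (.reg rI) ;;
  .assign rTmp .sub (.reg rTmp) (.lit 1) ;;
  .assign rTmp .mod (.reg rTmp) (.reg rm) ;;
  .assign rEx .add (.reg rTmp) (.lit 1) ;;
  .assign rBase .add (.reg rW) (.lit 0) ;;
  .assign rRes .add (.reg rPr) (.lit 0) ;;
  powCmd ;;
  .assign rPr .add (.reg rPr) (.reg rRes) ;;
  .assign rPr .mod (.reg rPr) (.reg rQ) ;;
  .assign rI .add (.reg rI) (.lit 1)

/-- Add to `rAcc` the term of the character sum that belongs to `rX`. -/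
def pointCmd : Cmd :=
  .assign rBase .add (.reg rX) (.lit 0) ;;
  .assign rEx .div (.reg rQ) (.reg rq) ;;
  .assign rRes .add (.lit 1) (.lit 0) ;;
  powCmd ;;
  .assign rW .add (.reg rRes) (.lit 0) ;;
  .assign rTmp .sub (.reg rq) (.lit 1) ;;
  .assign rEx .sub (.lit 0) (.reg rR) ;;
  .assign rEx .mod (.reg rEx) (.reg rTmp) ;;
  .assign rBase .add (.reg rW) (.lit 0) ;;
  .assign rRes .add (.lit 1) (.lit 0) ;;
  powCmd ;;
  .assign rPr .add (.reg rRes) (.lit 0) ;;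
  .assign rI .add (.reg rE) (.lit 0) ;;
  .while (.lt (.reg rI) (.reg rN2)) factorCmd ;;
  .assign rAcc .add (.reg rAcc) (.reg rPr) ;;
  .assign rAcc .mod (.reg rAcc) (.reg rQ) ;;
  .assign rX .add (.reg rX) (.lit 1)

/-- Compute the character sum in `rAcc`. -/
def hitCmd : Cmd :=
  .assign rAcc .add (.lit 0) (.lit 0) ;;
  .assign rX .add (.lit 1) (.lit 0) ;;
  .while (.lt (.reg rX) (.reg rq)) pointCmd

/-- The weight of a number: its residue modulo `m` in `1, …, m`. -/
def wt (m : ℕ) (z : ℤ) : ℕ := ((z - 1) % m + 1).toNat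

lemma wt_cast {m : ℕ} (hm : 1 ≤ m) (z : ℤ) : (wt m z : ℤ) = (z - 1) % m + 1 := by
  unfold wt
  have := Int.emod_nonneg (z - 1) (b := (m : ℤ)) (by omega)
  omega

lemma wt_le {m : ℕ} (hm : 1 ≤ m) (z : ℤ) : wt m z ≤ m := by
  have := wt_cast hm z
  have := Int.emod_lt_of_pos (z - 1) (b := (m : ℤ)) (by omega)
  omega

/-- The standing assumptions on the moduli and the bounds of the environment. -/
structure Setting (V : Env) (β N q m : ℕ) : Prop where
  fit : V.Fit
  H : V.H = 2 ^ β
  mem_lt : ∀ i, |V.mem i| + 1 < V.H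
  prime : q.Prime
  one_le : 1 ≤ m
  le : m < q
  lt : (4 * ((q ^ (N + 1) : ℕ) : ℤ)) * (q ^ (N + 1) : ℕ) < V.H

variable {V : Env} {f : ℕ →₀ ℤ} {β N q m : ℕ}

lemma Setting.pos (h : Setting V β N q m) : 0 < q ^ (N + 1) := pow_pos h.prime.pos _

lemma Setting.le_pow (_ : Setting V β N q m) : q ≤ q ^ (N + 1) := Nat.le_self_pow (by omega) q

lemma Setting.two_mul_lt (h : Setting V β N q m) : 2 * ((q ^ (N + 1) : ℕ) : ℤ) < V.H := by
  have h1 := h.lt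
  have h2 : (0 : ℤ) < (q ^ (N + 1) : ℕ) := by exact_mod_cast h.pos
  nlinarith

lemma Setting.lt_two_pow (h : Setting V β N q m) {x : ℕ} (hx : x ≤ q ^ (N + 1)) : x < 2 ^ β := by
  have h1 := h.two_mul_lt
  rw [h.H] at h1
  have h2 : (0 : ℤ) < (q ^ (N + 1) : ℕ) := by exact_mod_cast h.pos
  have h3 : (x : ℤ) ≤ (q ^ (N + 1) : ℕ) := by exact_mod_cast hx
  have : (x : ℤ) < 2 ^ β := by linarith
  exact_mod_cast this

lemma Setting.abs_lt (h : Setting V β N q m) {x : ℤ} (h0 : 0 ≤ x)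
    (hx : x ≤ 2 * (q ^ (N + 1) : ℕ)) : |x| < V.H :=
  abs_lt_of_mem h0 (hx.trans_lt h.two_mul_lt)

lemma tri_factorCmd (h : Setting V β N q m) {i : ℕ} (hi : i + 1 ≤ q ^ (N + 1)) {w : ℤ}
    (hQ : f rQ = (q ^ (N + 1) : ℕ))
    (hm : f rm = m) (hI : f rI = i) (hW : f rW = w) (hw : 0 ≤ w ∧ w < (q ^ (N + 1) : ℕ))
    (hP : 0 ≤ f rPr ∧ f rPr < (q ^ (N + 1) : ℕ)) :
    Tri V factorCmd f (β * 20 + 30) fun f' =>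
      Frame [rTmp, rEx, rBase, rRes, rPr, rI] f f' ∧ f' rI = (i + 1 : ℕ) ∧
      (0 ≤ f' rPr ∧ f' rPr < (q ^ (N + 1) : ℕ)) ∧
      (f' rPr : ZMod (q ^ (N + 1))) = f rPr * (1 + w ^ wt m (V.mem i)) := by
  have hV := h.fit
  have h1 := h.one_le
  have hle := h.le
  have hqQ := h.le_pow
  have hpos := h.pos
  have hlt := h.lt
  have hlt2 := h.two_mul_lt
  set Q := q ^ (N + 1) with hQdef
  have hmodn : 0 ≤ (V.mem i - 1) % (m : ℤ) := Int.emod_nonneg _ (by omega)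
  have hmodl : (V.mem i - 1) % (m : ℤ) < m := Int.emod_lt_of_pos _ (by omega)
  have hwt := wt_cast h1 (V.mem i)
  have hwl := wt_le h1 (V.mem i)
  refine Tri.of_ok fun hok => ?_
  refine Tri.seq_load hV (V.mem i) (by simp [hI]) (by decide) ?_
  have hlow : |V.mem i - 1| < V.H := by
    have := h.mem_lt i
    have := abs_sub (V.mem i) 1
    simp only [abs_one] at this
    omega
  refine Tri.seq_assign hV (V.mem i - 1) (by simp [Op.eval]) (by decide) hlow ?_
  refine Tri.seq_assign hV ((V.mem i - 1) % m) (by simp [Op.eval, hm]) (by decide)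
    (h.abs_lt (by omega) (by omega)) ?_
  refine Tri.seq_assign hV (wt m (V.mem i)) (by simp [Op.eval, hwt]) (by decide)
    (h.abs_lt (by omega) (by omega)) ?_
  refine Tri.seq_assign hV w (by simp [Op.eval, hW]) (by decide)
    (h.abs_lt (by omega) (by omega)) ?_
  -- Since the power computation starts from `rPr` and not from `1`, its result only has to be added
  -- to `rPr` to give the factor `1 + w ^ b`.
  refine Tri.seq_assign hV (f rPr) (by simp [Op.eval]) (by decide)
    (h.abs_lt (by omega) (by omega)) ?_
  refine Tri.seq hV _ 15 (tri_powCmd hV hpos (by nlinarith) (k := wt m (V.mem i)) (j := β)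
    (h.lt_two_pow (by omega)) (by simp [hQ]) (by simpa using hw) (by simp) (by simpa using hP)) ?_
    (by omega)
  rintro g ⟨hF, h0, h2, heq⟩
  simp only [upd_apply] at heq
  norm_num at heq
  refine Tri.seq_assign hV (f rPr + g rRes) (by simp [Op.eval, hF rPr]) (by decide)
    (h.abs_lt (by omega) (by omega)) ?_
  refine Tri.seq_assign hV ((f rPr + g rRes) % Q) (by simp [Op.eval, hF rQ, hQ]) (by decide)
    (h.abs_lt (Int.emod_nonneg _ (by omega))
      (by have := Int.emod_lt_of_pos (f rPr + g rRes) (b := (Q : ℤ)) (by omega); omega)) ?_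
  refine Tri.assign hV (i + 1 : ℕ) (by simp [Op.eval, hF rI, hI]) (by decide)
    (h.abs_lt (by omega) (by omega)) ?_
  refine ⟨?_, by simp, ?_, ?_⟩
  · intro x hx
    have hx' := hx
    simp only [List.mem_cons, List.not_mem_nil, not_or] at hx
    simp [hx, hF x]
  · simpa using ⟨Int.emod_nonneg _ (by omega), Int.emod_lt_of_pos _ (by omega)⟩
  · simp [heq, mul_add]

lemma tri_factors (h : Setting V β N q m) {e : ℕ} (he : e ≤ N) {w : ℤ}
    (hQ : f rQ = (q ^ (N + 1) : ℕ))
    (hm : f rm = m) (hI : f rI = e) (hN : f rN2 = N) (hW : f rW = w)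
    (hw : 0 ≤ w ∧ w < (q ^ (N + 1) : ℕ)) (hP : 0 ≤ f rPr ∧ f rPr < (q ^ (N + 1) : ℕ)) :
    Tri V (.while (.lt (.reg rI) (.reg rN2)) factorCmd) f (N * (β * 20 + 31) + 1) fun f' =>
      Frame [rTmp, rEx, rBase, rRes, rPr, rI] f f' ∧
      (0 ≤ f' rPr ∧ f' rPr < (q ^ (N + 1) : ℕ)) ∧
      (f' rPr : ZMod (q ^ (N + 1))) =
        f rPr * ∏ i ∈ Finset.Ico e N, (1 + (w : ZMod (q ^ (N + 1))) ^ wt m (V.mem i)) := by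
  have hNQ : N < q ^ (N + 1) :=
    (Nat.lt_succ_self N).trans (Nat.lt_pow_self h.prime.one_lt)
  refine Tri.le (Tri.while h.fit (T := β * 20 + 30) (fun j g =>
    Frame [rTmp, rEx, rBase, rRes, rPr, rI] f g ∧ (0 ≤ g rPr ∧ g rPr < (q ^ (N + 1) : ℕ)) ∧
    ∃ i : ℕ, g rI = i ∧ e ≤ i ∧ i + j = N ∧ (g rPr : ZMod (q ^ (N + 1))) =
      f rPr * ∏ i ∈ Finset.Ico e i, (1 + (w : ZMod (q ^ (N + 1))) ^ wt m (V.mem i))) ?_ (N - e)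
    ⟨Frame.refl _ _, hP, e, hI, le_rfl, by omega, by simp⟩ ?_) (by gcongr; omega)
  · rintro j g ⟨hF, hP', i, hi, hei, hij, heq⟩ hg
    simp only [Test.tr, Operand.val, hi, hF rN2 (by simp), hN] at hg
    refine ⟨j - 1, by omega, ?_⟩
    refine Tri.mono (tri_factorCmd h (i := i) (w := w) (by omega) (by rw [hF rQ (by simp), hQ])
      (by rw [hF rm (by simp), hm]) hi (by rw [hF rW (by simp), hW]) hw hP') le_rfl ?_
    rintro g' ⟨hF', hI', hP'', heq'⟩
    refine ⟨hF.trans hF' (List.Subset.refl _), hP'', i + 1, hI', by omega, by omega, ?_⟩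
    rw [heq', heq, Finset.prod_Ico_succ_top hei, mul_assoc]
  · rintro j g ⟨hF, hP', i, hi, hei, hij, heq⟩ hg
    simp only [Test.tr, Operand.val, hi, hF rN2 (by simp), hN] at hg
    have : i = N := by omega
    subst this
    exact ⟨hF, hP', heq⟩

/-- The exponent that represents `-R`. -/
def negExp (q : ℕ) (R : ℤ) : ℕ := ((-R) % ((q : ℤ) - 1)).toNat

lemma tri_pointCmd (h : Setting V β N q m) {e x : ℕ} (he : e ≤ N) (hx : x < q)
    (hQ : f rQ = (q ^ (N + 1) : ℕ)) (hq : f rq = q)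
    (hm : f rm = m) (hE : f rE = e) (hN : f rN2 = N) (hX : f rX = x)
    (hA : 0 ≤ f rAcc ∧ f rAcc < (q ^ (N + 1) : ℕ)) :
    Tri V pointCmd f (N * (β * 20 + 31) + β * 40 + 60) fun f' =>
      Frame [rX, rAcc, rW, rPr, rI, rBase, rEx, rRes, rTmp] f f' ∧ f' rX = (x + 1 : ℕ) ∧
      (0 ≤ f' rAcc ∧ f' rAcc < (q ^ (N + 1) : ℕ)) ∧
      (f' rAcc : ZMod (q ^ (N + 1))) = f rAcc +
        ((x : ZMod (q ^ (N + 1))) ^ q ^ N) ^ negExp q (f rR) *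
        ∏ i ∈ Finset.Ico e N, (1 + ((x : ZMod (q ^ (N + 1))) ^ q ^ N) ^ wt m (V.mem i)) := by
  have hV := h.fit
  have h1 := h.one_le
  have hle := h.le
  have hqQ := h.le_pow
  have hpos := h.pos
  have hlt := h.lt
  have hlt2 := h.two_mul_lt
  have hdiv : q ^ (N + 1) / q = q ^ N := by
    rw [pow_succ, Nat.mul_div_cancel _ h.prime.pos]
  have hNQ : N < q ^ (N + 1) :=
    (Nat.lt_succ_self N).trans (Nat.lt_pow_self h.prime.one_lt)
  have hqN : q ^ N ≤ q ^ (N + 1) := Nat.pow_le_pow_right h.prime.pos (by omega)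
  set Q := q ^ (N + 1) with hQdef
  have hQ1 : 1 < Q := by omega
  have hexp : (negExp q (f rR) : ℤ) = (-f rR) % ((q : ℤ) - 1) :=
    Int.toNat_of_nonneg (Int.emod_nonneg _ (by omega))
  have hexpl : negExp q (f rR) < q := by
    have := Int.emod_lt_of_pos (-f rR) (b := (q : ℤ) - 1) (by omega)
    omega
  set ρ := negExp q (f rR) with hρ
  refine Tri.of_ok fun hok => ?_
  have hRb := hok.1 rR
  refine Tri.seq_assign hV x (by simp [Op.eval, hX]) (by decide) (h.abs_lt (by omega) (by omega)) ?_
  -- The quotient of `rQ` by `rq` is the exponent of the Teichmüller representative.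
  refine Tri.seq_assign hV (q ^ N : ℕ) (by simp only [Op.eval, Operand.val, upd_apply]; norm_num [hQ, hq, ← hdiv]) (by decide)
    (h.abs_lt (by omega) (by omega)) ?_
  refine Tri.seq_assign hV 1 (by simp [Op.eval]) (by decide) (h.abs_lt (by omega) (by omega)) ?_
  refine Tri.seq hV _ (N * (β * 20 + 31) + β * 20 + 50) (tri_powCmd hV hpos (by nlinarith) (k := q ^ N) (j := β)
    (h.lt_two_pow (by omega)) (by simp [hQ]) (by simp; omega) (by simp) (by simpa using hQ1)) ?_
    (by omega)
  rintro g ⟨hF, h0, h2, heq⟩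
  simp only [upd_apply] at heq
  norm_num at heq
  refine Tri.seq_assign hV (g rRes) (by simp [Op.eval]) (by decide) (h.abs_lt (by omega) (by omega)) ?_
  refine Tri.seq_assign hV (q - 1) (by simp [Op.eval, hF rq, hq]) (by decide)
    (h.abs_lt (by omega) (by omega)) ?_
  refine Tri.seq_assign hV (-f rR) (by simp [Op.eval, hF rR]) (by decide) (by rwa [abs_neg]) ?_
  refine Tri.seq_assign hV ρ (by simp [Op.eval, hexp]) (by decide)
    (h.abs_lt (by omega) (by omega)) ?_
  refine Tri.seq_assign hV (g rRes) (by simp [Op.eval]) (by decide) (h.abs_lt (by omega) (by omega)) ?_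
  refine Tri.seq_assign hV 1 (by simp [Op.eval]) (by decide) (h.abs_lt (by omega) (by omega)) ?_
  refine Tri.seq hV _ (N * (β * 20 + 31) + 30) (tri_powCmd hV hpos (by nlinarith) (k := ρ) (j := β)
    (h.lt_two_pow (by omega)) (by simp [hF rQ, hQ]) (by simpa using ⟨h0, h2⟩) (by simp) (by simpa using hQ1)) ?_
    (by omega)
  rintro g' ⟨hF', h0', h2', heq'⟩
  simp only [upd_apply] at heq'
  norm_num at heq'
  refine Tri.seq_assign hV (g' rRes) (by simp [Op.eval]) (by decide) (h.abs_lt (by omega) (by omega)) ?_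
  refine Tri.seq_assign hV e (by simp [Op.eval, hF' rE, hF rE, hE]) (by decide)
    (h.abs_lt (by omega) (by omega)) ?_
  refine Tri.seq hV _ 20 (tri_factors h (e := e) he (w := g rRes) (by simp [hF' rQ, hF rQ, hQ, hQdef])
    (by simp [hF' rm, hF rm, hm]) (by simp) (by simp [hF' rN2, hF rN2, hN]) (by simp [hF' rW])
    ⟨h0, h2⟩ (by simpa using ⟨h0', h2'⟩)) ?_ (by omega)
  rintro g'' ⟨hF'', hP, heq''⟩
  simp only [upd_apply] at heq''
  norm_num at heq''
  have hacc : g'' rAcc = f rAcc := by simp [hF'' rAcc, hF' rAcc, hF rAcc]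
  refine Tri.seq_assign hV (f rAcc + g'' rPr) (by simp [Op.eval, hacc]) (by decide)
    (h.abs_lt (by omega) (by omega)) ?_
  have hmod := Int.emod_nonneg (f rAcc + g'' rPr) (b := (Q : ℤ)) (by omega)
  have hmod' := Int.emod_lt_of_pos (f rAcc + g'' rPr) (b := (Q : ℤ)) (by omega)
  refine Tri.seq_assign hV ((f rAcc + g'' rPr) % Q)
    (by simp [Op.eval, hF'' rQ, hF' rQ, hF rQ, hQ]) (by decide) (h.abs_lt hmod (by omega)) ?_
  refine Tri.assign hV (x + 1 : ℕ) (by simp [Op.eval, hF'' rX, hF' rX, hF rX, hX]) (by decide)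
    (h.abs_lt (by omega) (by omega)) ?_
  refine ⟨?_, by simp, by simpa using ⟨hmod, hmod'⟩, ?_⟩
  · intro y hy
    simp only [List.mem_cons, List.not_mem_nil, not_or] at hy
    simp [hy, hF'' y, hF' y, hF y]
  · simp [heq'', heq', heq]

/-- Elements `e, …, N - 1` have a subset of total weight `R`. -/
def Hit (V : Env) (N m e : ℕ) (R : ℤ) : Prop :=
  ∃ Y ⊆ Finset.Ico e N, (∑ i ∈ Y, (wt m (V.mem i) : ℤ)) = R

/-- Both `R` and the possible totals are so small that a difference divisible by `q - 1` must be
zero. `R` may be negative here, because the self-reduction may subtract too much when there is no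
solution. -/
lemma hit_iff (h : Setting V β N q m) {e : ℕ} {R : ℤ} (hb : |R| + N * m < q - 1) :
    (∑ x ∈ Finset.Ico 1 q, ((x : ZMod (q ^ (N + 1))) ^ q ^ N) ^ negExp q R *
      ∏ i ∈ Finset.Ico e N, (1 + ((x : ZMod (q ^ (N + 1))) ^ q ^ N) ^ wt m (V.mem i)) = 0) ↔
    ¬ Hit V N m e R := by
  rw [characterSum_eq_zero_iff h.prime (Finset.Ico e N) (by simp) (fun i => wt m (V.mem i))]
  have hq := h.prime.two_le
  have hexp : (negExp q R : ℤ) = (-R) % ((q : ℤ) - 1) :=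
    Int.toNat_of_nonneg (Int.emod_nonneg _ (by omega))
  refine not_congr (exists_congr fun Y => and_congr_right fun hY => ?_)
  have hsum : (∑ i ∈ Y, (wt m (V.mem i) : ℤ)) ≤ N * m := by
    calc (∑ i ∈ Y, (wt m (V.mem i) : ℤ)) ≤ ∑ i ∈ Y, (m : ℤ) :=
          Finset.sum_le_sum fun i _ => by exact_mod_cast wt_le h.one_le _
      _ = (Y.card : ℤ) * m := by simp
      _ ≤ N * m := by
          gcongr
          simpa using (Finset.card_le_card hY).trans (by simp : (Finset.Ico e N).card ≤ N)
  have hsum0 : 0 ≤ ∑ i ∈ Y, (wt m (V.mem i) : ℤ) := Finset.sum_nonneg fun i _ => by positivity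
  have hR := abs_lt.1 (show |R| < q - 1 - N * m by linarith)
  set s := ∑ i ∈ Y, (wt m (V.mem i) : ℤ) with hs
  have hcast : (((q - 1 : ℕ) : ℤ)) = (q : ℤ) - 1 := by omega
  rw [← Int.natCast_dvd_natCast, hcast]
  push_cast
  rw [hexp, ← hs]
  have hd := Int.emod_add_mul_ediv (-R) ((q : ℤ) - 1)
  have : (-R) % ((q : ℤ) - 1) + s = (s - R) + ((q : ℤ) - 1) * (-((-R) / ((q : ℤ) - 1))) := by
    linarith
  rw [this, Int.dvd_add_left (Dvd.intro _ rfl)]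
  constructor
  · intro hdvd
    have := Int.eq_zero_of_abs_lt_dvd hdvd (abs_lt.2 ⟨by linarith, by linarith⟩)
    linarith
  · rintro rfl
    simp

lemma tri_hitCmd (h : Setting V β N q m) {e : ℕ} (he : e ≤ N)
    (hQ : f rQ = (q ^ (N + 1) : ℕ)) (hq : f rq = q)
    (hm : f rm = m) (hE : f rE = e) (hN : f rN2 = N) (hb : |f rR| + N * m < q - 1) :
    Tri V hitCmd f (q * (N * (β * 20 + 31) + β * 40 + 61) + 10) fun f' =>
      Frame [rX, rAcc, rW, rPr, rI, rBase, rEx, rRes, rTmp] f f' ∧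
      (f' rAcc = 0 ↔ ¬ Hit V N m e (f rR)) := by
  have hV := h.fit
  have hqQ := h.le_pow
  have hpos := h.pos
  have hq2 := h.prime.two_le
  set Q := q ^ (N + 1) with hQdef
  refine Tri.seq_assign hV 0 (by simp [Op.eval]) (by decide) (h.abs_lt (by omega) (by omega)) ?_
  refine Tri.seq_assign hV 1 (by simp [Op.eval]) (by decide) (h.abs_lt (by omega) (by omega)) ?_
  refine Tri.le (Tri.while h.fit (T := N * (β * 20 + 31) + β * 40 + 60) (fun j g =>
    Frame [rX, rAcc, rW, rPr, rI, rBase, rEx, rRes, rTmp] f g ∧ (0 ≤ g rAcc ∧ g rAcc < Q) ∧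
    ∃ x : ℕ, g rX = x ∧ 1 ≤ x ∧ x + j = q ∧ (g rAcc : ZMod Q) =
      ∑ x ∈ Finset.Ico 1 x, ((x : ZMod Q) ^ q ^ N) ^ negExp q (f rR) *
        ∏ i ∈ Finset.Ico e N, (1 + ((x : ZMod Q) ^ q ^ N) ^ wt m (V.mem i))) ?_ (q - 1)
    ⟨?_, ?_, 1, by simp, le_rfl, by omega, by simp⟩ ?_) (T' := _) ?_
  · rintro j g ⟨hF, hA, x, hX, hx1, hxj, heq⟩ hg
    simp only [Test.tr, Operand.val, hX, hF rq (by simp), hq] at hg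
    refine ⟨j - 1, by omega, ?_⟩
    refine Tri.mono (tri_pointCmd h (e := e) (x := x) he (by omega) (by rw [hF rQ (by simp), hQ])
      (by rw [hF rq (by simp), hq]) (by rw [hF rm (by simp), hm]) (by rw [hF rE (by simp), hE])
      (by rw [hF rN2 (by simp), hN]) hX hA) le_rfl ?_
    rintro g' ⟨hF', hX', hA', heq'⟩
    refine ⟨hF.trans hF' (List.Subset.refl _), hA', x + 1, hX', by omega, by omega, ?_⟩
    rw [heq', heq, Finset.sum_Ico_succ_top hx1, hF rR (by simp)]
  · exact ((Frame.refl _ f).upd (by simp) _).upd (by simp) _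
  · simpa using hpos
  · rintro j g ⟨hF, hA, x, hX, hx1, hxj, heq⟩ hg
    simp only [Test.tr, Operand.val, hX, hF rq (by simp), hq] at hg
    have : x = q := by omega
    subst this
    refine ⟨hF, ?_⟩
    rw [← hit_iff h hb, ← heq]
    constructor
    · intro h0
      simp [h0]
    · intro h0
      rw [ZMod.intCast_zmod_eq_zero_iff_dvd] at h0
      exact Int.eq_zero_of_dvd_of_nonneg_of_lt hA.1 hA.2 h0
  · have : (q - 1) * (N * (β * 20 + 31) + β * 40 + 60 + 1) ≤
        q * (N * (β * 20 + 31) + β * 40 + 61) := by gcongr; omega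
    omega

end SubsetSum

/-! ### Self-reduction -/

namespace SubsetSum

open RAM

/-- `rQ := rq ^ (rN2 + 1)`. -/
def powerCmd : Cmd :=
  .assign rQ .add (.reg rq) (.lit 0) ;;
  .assign rI .add (.lit 0) (.lit 0) ;;
  .while (.lt (.reg rI) (.reg rN2)) (
    .assign rQ .mul (.reg rQ) (.reg rq) ;;
    .assign rI .add (.reg rI) (.lit 1))

/-- Decide on element `rE`, and advance. -/
def reduceCmd : Cmd :=
  .assign rE .add (.reg rE) (.lit 1) ;;
  hitCmd ;;
  .ite (.eq (.reg rAcc) (.lit 0))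
    (.assign rTmp .sub (.reg rE) (.lit 1) ;;
     .load rTmp (.reg rTmp) ;;
     .assign rA .sub (.reg rA) (.reg rTmp) ;;
     .assign rTmp .sub (.reg rTmp) (.lit 1) ;;
     .assign rTmp .mod (.reg rTmp) (.reg rm) ;;
     .assign rTmp .add (.reg rTmp) (.lit 1) ;;
     .assign rR .sub (.reg rR) (.reg rTmp))
    .skip

/-- Try to settle the instance with the moduli in `rq` and `rm`. -/
def solveCmd : Cmd :=
  powerCmd ;;
  .assign rR .mod (.reg rT) (.reg rm) ;;
  .assign rTmp .mul (.reg rN) (.reg rm) ;;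
  .assign rR .add (.reg rR) (.reg rTmp) ;;
  .assign rA .add (.reg rT) (.lit 0) ;;
  .assign rE .add (.lit 0) (.lit 0) ;;
  .while (.lt (.reg rE) (.reg rN2)) reduceCmd ;;
  .ite (.eq (.reg rR) (.lit 0))
    (.ite (.eq (.reg rA) (.lit 0))
      (.assign rDone .add (.lit 1) (.lit 0) ;; .assign rAns .add (.lit 1) (.lit 0))
      .skip)
    (.assign rDone .add (.lit 1) (.lit 0) ;; .assign rAns .add (.lit 0) (.lit 0))

/-- Set `rFlag` to 1 or 0, according to whether the moduli are admissible. -/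
def checkCmd : Cmd :=
  .assign rFlag .add (.lit 1) (.lit 0) ;;
  .assign rX .add (.lit 2) (.lit 0) ;;
  .while (.lt (.reg rX) (.reg rq)) (
    .assign rTmp .mod (.reg rq) (.reg rX) ;;
    .ite (.eq (.reg rTmp) (.lit 0)) (.assign rFlag .add (.lit 0) (.lit 0)) .skip ;;
    .assign rX .add (.reg rX) (.lit 1)) ;;
  .assign rTmp .add (.reg rN) (.lit 1) ;;
  .assign rTmp .mul (.lit 8) (.reg rTmp) ;;
  .assign rTmp .mul (.reg rTmp) (.reg rm) ;;
  .ite (.lt (.reg rq) (.reg rTmp)) (.assign rFlag .add (.lit 0) (.lit 0)) .skip ;;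
  .ite (.lt (.reg rm) (.lit 1)) (.assign rFlag .add (.lit 0) (.lit 0)) .skip

/-- Check the moduli and, if they are admissible, try to settle the instance. -/
def bodyCmd : Cmd :=
  checkCmd ;; .ite (.eq (.reg rFlag) (.lit 1)) solveCmd .skip

variable {V : Env} {f : ℕ →₀ ℤ} {β N q m n : ℕ}

lemma tri_powerCmd (h : Setting V β N q m) (hq : f rq = q) (hN : f rN2 = N) :
    Tri V powerCmd f (N * 5 + 10) fun f' => Frame [rQ, rI] f f' ∧ f' rQ = (q ^ (N + 1) : ℕ) := by
  have hV := h.fit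
  have hqQ := h.le_pow
  have hpos := h.pos
  have hNQ : N < q ^ (N + 1) :=
    (Nat.lt_succ_self N).trans (Nat.lt_pow_self h.prime.one_lt)
  refine Tri.seq_assign hV q (by simp [Op.eval, hq]) (by decide) (h.abs_lt (by omega) (by omega)) ?_
  refine Tri.seq_assign hV 0 (by simp [Op.eval]) (by decide) (h.abs_lt (by omega) (by omega)) ?_
  refine Tri.le (Tri.while h.fit (T := 4) (fun j g => Frame [rQ, rI] f g ∧
    ∃ i : ℕ, g rI = i ∧ i + j = N ∧ g rQ = (q ^ (i + 1) : ℕ)) ?_ N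
    ⟨((Frame.refl _ f).upd (by simp) _).upd (by simp) _, 0, by simp, by simp, by simp⟩ ?_)
    (by omega)
  · rintro j g ⟨hF, i, hi, hij, hQ⟩ hg
    simp only [Test.tr, Operand.val, hi, hF rN2 (by simp), hN] at hg
    have hle : q ^ (i + 1 + 1) ≤ q ^ (N + 1) := Nat.pow_le_pow_right h.prime.pos (by omega)
    refine ⟨j - 1, by omega, ?_⟩
    refine Tri.seq_assign hV (q ^ (i + 1 + 1) : ℕ)
      (by simp [Op.eval, hF rq, hq, hQ, pow_succ]) (by decide)
      (h.abs_lt (by omega) (by omega)) ?_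
    refine Tri.assign hV (i + 1 : ℕ) (by simp [Op.eval, hi]) (by decide)
      (h.abs_lt (by omega) (by omega)) ?_
    exact ⟨(hF.upd (by simp) _).upd (by simp) _, i + 1, by simp, by omega, by simp⟩
  · rintro j g ⟨hF, i, hi, hij, hQ⟩ hg
    simp only [Test.tr, Operand.val, hi, hF rN2 (by simp), hN] at hg
    have : i = N := by omega
    subst this
    exact ⟨hF, hQ⟩

lemma hit_succ {V : Env} {N m e : ℕ} (he : e < N) (R : ℤ) :
    Hit V N m e R ↔ Hit V N m (e + 1) R ∨ Hit V N m (e + 1) (R - wt m (V.mem e)) := by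
  classical
  have hIco : Finset.Ico e N = insert e (Finset.Ico (e + 1) N) :=
    (Finset.insert_Ico_add_one_left_eq_Ico he).symm
  have hnot : ∀ Y ⊆ Finset.Ico (e + 1) N, e ∉ Y := fun Y hY h => by
    have := Finset.mem_Ico.1 (hY h)
    omega
  constructor
  · rintro ⟨Y, hY, hs⟩
    rw [hIco] at hY
    by_cases heY : e ∈ Y
    · right
      refine ⟨Y.erase e, ?_, ?_⟩
      · rwa [← Finset.subset_insert_iff]
      · rw [← hs, ← Finset.add_sum_erase _ _ heY]
        ring
    · left
      exact ⟨Y, (Finset.subset_insert_iff_of_notMem heY).1 hY, hs⟩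
  · rintro (⟨Y, hY, hs⟩ | ⟨Y, hY, hs⟩)
    · exact ⟨Y, hIco ▸ hY.trans (Finset.subset_insert _ _), hs⟩
    · refine ⟨insert e Y, hIco ▸ Finset.insert_subset_insert _ hY, ?_⟩
      rw [Finset.sum_insert (hnot Y hY), hs]
      ring

lemma hit_self {V : Env} {N m : ℕ} (R : ℤ) : Hit V N m N R ↔ R = 0 := by
  constructor
  · rintro ⟨Y, hY, hs⟩
    simp only [Finset.Ico_self, Finset.subset_empty] at hY
    subst hY
    simpa using hs.symm
  · rintro rfl
    exact ⟨∅, by simp, by simp⟩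

/-- What the self-reduction knows before it decides on element `e`. -/
def Reduced (V : Env) (N m : ℕ) (t R₀ : ℤ) (e : ℕ) (A R : ℤ) : Prop :=
  (∃ X ⊆ Finset.range e, A = t - ∑ i ∈ X, V.mem i ∧ R = R₀ - ∑ i ∈ X, (wt m (V.mem i) : ℤ)) ∧
    (Hit V N m 0 R₀ ↔ Hit V N m e R)

/-- If the later elements alone attain `R`, dropping element `e` keeps solvability. -/
lemma Reduced.skip {t R₀ A R : ℤ} {e : ℕ} (h : Reduced V N m t R₀ e A R) (he : e < N)
    (hh : Hit V N m (e + 1) R) : Reduced V N m t R₀ (e + 1) A R := by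
  obtain ⟨⟨X, hX, h1, h2⟩, h3⟩ := h
  refine ⟨⟨X, hX.trans (Finset.range_subset_range.2 (by omega)), h1, h2⟩, h3.trans ?_⟩
  rw [hit_succ he]
  tauto

/-- If the later elements alone do not attain `R`, any solution must use `e`. No test of whether
using `e` leads to a solution is needed: the equivalence also transports unsolvability, and the last
step reads it off from `R ≠ 0`. -/
lemma Reduced.subtract {t R₀ A R : ℤ} {e : ℕ} (h : Reduced V N m t R₀ e A R) (he : e < N)
    (hh : ¬ Hit V N m (e + 1) R) :
    Reduced V N m t R₀ (e + 1) (A - V.mem e) (R - wt m (V.mem e)) := by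
  classical
  obtain ⟨⟨X, hX, h1, h2⟩, h3⟩ := h
  have heX : e ∉ X := fun h => by simpa using hX h
  refine ⟨⟨insert e X, ?_, ?_, ?_⟩, h3.trans ?_⟩
  · rw [Finset.range_add_one]
    exact Finset.insert_subset_insert _ hX
  · rw [Finset.sum_insert heX, h1]
    ring
  · rw [Finset.sum_insert heX, h2]
    ring
  · rw [hit_succ he]
    tauto

lemma Reduced.abs_le {t R₀ A R : ℤ} {e : ℕ} (h : Reduced V N m t R₀ e A R) (he : e ≤ N) :
    |A| ≤ |t| + ∑ i ∈ Finset.range N, |V.mem i| := by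
  obtain ⟨⟨X, hX, rfl, -⟩, -⟩ := h
  refine (abs_sub _ _).trans ?_
  gcongr
  refine (Finset.abs_sum_le_sum_abs _ _).trans
    (Finset.sum_le_sum_of_subset_of_nonneg (hX.trans (Finset.range_subset_range.2 he))
      fun _ _ _ => abs_nonneg _)

lemma Reduced.bounds {t R₀ A R : ℤ} {e : ℕ} (h : Reduced V N m t R₀ e A R) (he : e ≤ N)
    (hm : 1 ≤ m) : R₀ - N * m ≤ R ∧ R ≤ R₀ := by
  obtain ⟨⟨X, hX, -, rfl⟩, -⟩ := h
  have h1 : (∑ i ∈ X, (wt m (V.mem i) : ℤ)) ≤ N * m := by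
    calc (∑ i ∈ X, (wt m (V.mem i) : ℤ)) ≤ ∑ i ∈ X, (m : ℤ) :=
          Finset.sum_le_sum fun i _ => by exact_mod_cast wt_le hm _
      _ = (X.card : ℤ) * m := by simp
      _ ≤ N * m := by
          gcongr
          have := Finset.card_le_card hX
          simp at this
          omega
  have h2 : 0 ≤ ∑ i ∈ X, (wt m (V.mem i) : ℤ) := Finset.sum_nonneg fun i _ => by positivity
  constructor <;> linarith

lemma tri_reduceCmd (h : Setting V β N q m) {e : ℕ} (he : e < N) {t R₀ : ℤ}
    (hQ : f rQ = (q ^ (N + 1) : ℕ)) (hq : f rq = q) (hm : f rm = m) (hE : f rE = e)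
    (hN : f rN2 = N) (hR0 : 0 ≤ R₀) (hb : R₀ + 2 * (N * m) < q - 1)
    (ht : |t| + ∑ i ∈ Finset.range N, |V.mem i| < V.H)
    (hred : Reduced V N m t R₀ e (f rA) (f rR)) :
    Tri V reduceCmd f (q * (N * (β * 20 + 31) + β * 40 + 61) + 40) fun f' =>
      Frame [rR, rA, rE, rX, rAcc, rW, rPr, rI, rBase, rEx, rRes, rTmp] f f' ∧
      f' rE = (e + 1 : ℕ) ∧ Reduced V N m t R₀ (e + 1) (f' rA) (f' rR) := by
  have hV := h.fit
  have h1 := h.one_le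
  have hle := h.le
  have hqQ := h.le_pow
  have hpos := h.pos
  have hNQ : N < q ^ (N + 1) :=
    (Nat.lt_succ_self N).trans (Nat.lt_pow_self h.prime.one_lt)
  have hRb := hred.bounds he.le h1
  have hNm : (0 : ℤ) ≤ N * m := by positivity
  refine Tri.seq_assign hV (e + 1 : ℕ) (by simp [Op.eval, hE]) (by decide)
    (h.abs_lt (by omega) (by omega)) ?_
  refine Tri.seq hV _ 20 (tri_hitCmd h (e := e + 1) (by omega) (by simp [hQ]) (by simp [hq])
    (by simp [hm]) (by simp) (by simp [hN]) ?_) ?_ (by omega)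
  · have : |f rR| ≤ R₀ + N * m := abs_le.2 ⟨by linarith, by linarith⟩
    simp only [upd_apply]
    norm_num
    linarith
  rintro g ⟨hF, hhit⟩
  simp only [upd_apply] at hhit
  norm_num at hhit
  refine Tri.ite hV (fun hg => ?_) fun hg => ?_
  · simp only [Test.tr, Operand.val] at hg
    have hred' := hred.subtract he (hhit.1 hg)
    have hmodn : 0 ≤ (V.mem e - 1) % (m : ℤ) := Int.emod_nonneg _ (by omega)
    have hmodl : (V.mem e - 1) % (m : ℤ) < m := Int.emod_lt_of_pos _ (by omega)
    have hwt := wt_cast h1 (V.mem e)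
    have hwl := wt_le h1 (V.mem e)
    have hlow : |V.mem e - 1| < V.H := by
      have := h.mem_lt e
      have := abs_sub (V.mem e) 1
      simp only [abs_one] at this
      omega
    have hRb' := hred'.bounds (by omega) h1
    refine Tri.seq_assign hV e (by simp [Op.eval, hF rE]) (by decide)
      (h.abs_lt (by omega) (by omega)) ?_
    refine Tri.seq_load hV (V.mem e) (by simp) (by decide) ?_
    refine Tri.seq_assign hV (f rA - V.mem e) (by simp [Op.eval, hF rA]) (by decide)
      ((hred'.abs_le (by omega)).trans_lt ht) ?_
    refine Tri.seq_assign hV (V.mem e - 1) (by simp [Op.eval]) (by decide) hlow ?_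
    refine Tri.seq_assign hV ((V.mem e - 1) % m) (by simp [Op.eval, hF rm, hm]) (by decide)
      (h.abs_lt (by omega) (by omega)) ?_
    refine Tri.seq_assign hV (wt m (V.mem e)) (by simp [Op.eval, hwt]) (by decide)
      (h.abs_lt (by omega) (by omega)) ?_
    refine Tri.assign hV (f rR - wt m (V.mem e)) (by simp [Op.eval, hF rR]) (by decide) ?_ ?_
    · have : |f rR - wt m (V.mem e)| ≤ R₀ + N * m := abs_le.2 ⟨by linarith, by linarith⟩
      have := h.two_mul_lt
      omega
    · refine ⟨?_, by simp [hF rE], by simpa using hred'⟩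
      intro y hy
      simp only [List.mem_cons, List.not_mem_nil, not_or] at hy
      simp [hy, hF y]
  · simp only [Test.tr, Operand.val] at hg
    rw [hhit, not_not] at hg
    refine Tri.skip hV ⟨?_, by simp [hF rE], ?_⟩
    · intro y hy
      simp only [List.mem_cons, List.not_mem_nil, not_or] at hy
      simp [hy, hF y]
    · simpa [hF rA, hF rR] using hred.skip he hg

end SubsetSum

/-! ### One attempt with a pair of moduli -/

namespace SubsetSum

open RAM

/-- The environment belongs to the instance `(a, t)`. -/
structure Inst (V : Env) (β : ℕ) {n : ℕ} (a : Fin n → ℤ) (t : ℤ) : Prop where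
  fit : V.Fit
  H : V.H = 2 ^ β
  mem_lt : ∀ i, |V.mem i| + 1 < V.H
  mem_eq : ∀ i : Fin n, V.mem ((i : ℕ) : ℤ) = a i
  mem_zero : ∀ i : ℕ, n ≤ i → V.mem (i : ℤ) = 0
  lt : |t| + ∑ i ∈ Finset.range (2 * n), |V.mem i| < V.H

variable {V : Env} {f : ℕ →₀ ℤ} {β q m n : ℕ} {a : Fin n → ℤ} {t : ℤ}

lemma wt_modEq (hm : 1 ≤ m) (z : ℤ) : (wt m z : ℤ) ≡ z [ZMOD m] := by
  rw [wt_cast hm]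
  have := (Int.mod_modEq (z - 1) m).add_right 1
  simpa using this

/-- The empty memory cells after the input serve as padding. Choosing residues in `1, …, m` and not
in `0, …, m - 1` makes each of them worth `m`. -/
lemma wt_zero (hm : 1 ≤ m) : wt m 0 = m := by
  have h1 := wt_cast hm 0
  have h2 : ((0 : ℤ) - 1) % m = m - 1 := by
    rw [← Int.add_emod_right, Int.emod_eq_of_lt] <;> omega
  omega

lemma Inst.sum_map (h : Inst V β a t) (X : Finset (Fin n)) :
    ∑ i ∈ X.map Fin.valEmbedding, V.mem (i : ℤ) = ∑ e ∈ X, a e := by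
  rw [Finset.sum_map]
  exact Finset.sum_congr rfl fun e _ => h.mem_eq e

lemma Inst.exists_sum (h : Inst V β a t) (X : Finset ℕ) :
    ∃ X' : Finset (Fin n), ∑ e ∈ X', a e = ∑ i ∈ X, V.mem (i : ℤ) := by
  classical
  refine ⟨Finset.univ.filter fun i => (i : ℕ) ∈ X, ?_⟩
  rw [← h.sum_map]
  refine Finset.sum_subset_zero_on_sdiff ?_ ?_ fun _ _ => rfl
  · intro i hi
    simp only [Finset.mem_map, Finset.mem_filter, Finset.mem_univ, true_and] at hi
    obtain ⟨e, he, rfl⟩ := hi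
    exact he
  · intro i hi
    simp only [Finset.mem_sdiff, Finset.mem_map, Finset.mem_filter, Finset.mem_univ,
      true_and] at hi
    refine h.mem_zero i ?_
    by_contra hlt
    exact hi.2 ⟨⟨i, by omega⟩, hi.1, rfl⟩

/-- A solution modulo `m` is found among the padded weights. -/
lemma Inst.hit_of_dvd (h : Inst V β a t) (hm : 1 ≤ m) {X : Finset (Fin n)}
    (hX : (m : ℤ) ∣ ∑ e ∈ X, a e - t) : Hit V (2 * n) m 0 (t % m + n * m) := by
  classical
  set Y := X.map Fin.valEmbedding with hY
  have hYlt : ∀ i ∈ Y, i < n := by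
    intro i hi
    obtain ⟨e, -, rfl⟩ := Finset.mem_map.1 hi
    exact e.2
  have hYn : Y.card ≤ n := by
    rw [hY, Finset.card_map]
    exact (Finset.card_le_univ X).trans (by simp)
  set s := ∑ i ∈ Y, (wt m (V.mem i) : ℤ) with hs
  have hs0 : 0 ≤ s := Finset.sum_nonneg fun i _ => by positivity
  have hsn : s ≤ n * m := by
    calc s ≤ ∑ i ∈ Y, (m : ℤ) :=
          Finset.sum_le_sum fun i _ => by exact_mod_cast wt_le hm _
      _ = (Y.card : ℤ) * m := by simp
      _ ≤ n * m := by gcongr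
  have hmod : s ≡ t % m + n * m [ZMOD m] := by
    have h1 : s ≡ ∑ i ∈ Y, V.mem (i : ℤ) [ZMOD m] := Int.ModEq.sum fun i _ => wt_modEq hm _
    rw [h.sum_map] at h1
    have h2 : (∑ e ∈ X, a e) ≡ t [ZMOD m] := (Int.modEq_iff_dvd.2 hX).symm
    refine (h1.trans h2).trans ?_
    simpa using (Int.mod_modEq t m).symm
  -- The deficit is `j * m`; the next bounds show `0 ≤ j ≤ n`, so `j` padding cells make up for it.
  obtain ⟨j, hj⟩ := hmod.dvd
  have ht0 := Int.emod_nonneg t (b := (m : ℤ)) (by omega)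
  have ht1 := Int.emod_lt_of_pos t (b := (m : ℤ)) (by omega)
  have hj0 : 0 ≤ j := by
    by_contra hneg
    nlinarith
  have hjn : j ≤ n := by
    by_contra hneg
    have : (m : ℤ) * (n + 1) ≤ m * j := by gcongr; omega
    nlinarith
  obtain ⟨l, rfl⟩ := Int.eq_ofNat_of_zero_le hj0
  have hdisj : Disjoint Y (Finset.Ico n (n + l)) := by
    rw [Finset.disjoint_left]
    intro i hi hi'
    have := hYlt i hi
    have := Finset.mem_Ico.1 hi'
    omega
  refine ⟨Y ∪ Finset.Ico n (n + l), ?_, ?_⟩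
  · intro i hi
    rw [Finset.mem_Ico]
    rcases Finset.mem_union.1 hi with hi | hi
    · have := hYlt i hi
      omega
    · have := Finset.mem_Ico.1 hi
      omega
  · rw [Finset.sum_union hdisj, ← hs, Finset.sum_congr rfl (s₁ := Finset.Ico n (n + l))
      (g := fun _ => (m : ℤ))]
    · simp
      linarith
    · intro i hi
      rw [h.mem_zero i (Finset.mem_Ico.1 hi).1, wt_zero hm]

lemma Inst.isAnswer_one (h : Inst V β a t) {R₀ : ℤ}
    (hred : Reduced V (2 * n) m t R₀ (2 * n) 0 0) : IsAnswer a t 1 := by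
  obtain ⟨⟨X, -, h1, -⟩, -⟩ := hred
  obtain ⟨X', hX'⟩ := h.exists_sum X
  exact Or.inl ⟨⟨X', by rw [hX']; linarith⟩, rfl⟩

lemma Inst.isAnswer_zero (h : Inst V β a t) (hm : 1 ≤ m) {A R : ℤ} (hR : R ≠ 0)
    (hred : Reduced V (2 * n) m t (t % m + n * m) (2 * n) A R) : IsAnswer a t 0 := by
  refine Or.inr ⟨?_, rfl⟩
  rintro ⟨X, hX⟩
  have := h.hit_of_dvd (t := t) hm (X := X) (by simp [hX])
  rw [hred.2, hit_self] at this
  exact hR this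

/-- The subset that was found has the right weight, hence a sum congruent to `t` modulo `m`, yet the
sum differs from `t` by `A`. -/
lemma Inst.not_separates (h : Inst V β a t) (hm : 1 ≤ m) {A : ℤ} (hA : A ≠ 0)
    (hred : Reduced V (2 * n) m t (t % m + n * m) (2 * n) A 0) : ¬ Separates a t m := by
  intro hsep
  obtain ⟨⟨X, -, h1, h2⟩, -⟩ := hred
  obtain ⟨X', hX'⟩ := h.exists_sum X
  refine hA ?_
  rw [h1, ← hX', hsep X' ?_, sub_self]
  rw [hX']
  have h3 : (∑ i ∈ X, (wt m (V.mem i) : ℤ)) ≡ ∑ i ∈ X, V.mem (i : ℤ) [ZMOD m] :=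
    Int.ModEq.sum fun i _ => wt_modEq hm _
  rw [show (∑ i ∈ X, (wt m (V.mem i) : ℤ)) = t % m + n * m by linarith] at h3
  have h4 : t % m + n * m ≡ t [ZMOD m] := by simpa using Int.mod_modEq t m
  exact (h4.symm.trans h3).dvd

/-- The outcome of an attempt: undecided, or decided with the right answer. -/
def Outcome (a : Fin n → ℤ) (t : ℤ) (m : ℕ) (f : ℕ →₀ ℤ) : Prop :=
  (f rDone = 0 ∧ ¬ Separates a t m) ∨ (f rDone = 1 ∧ IsAnswer a t (f rAns))

/-- A bound for the number of steps of `solveCmd`. -/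
def solveTime (β n q : ℕ) : ℕ :=
  2 * n * (q * (2 * n * (β * 20 + 31) + β * 40 + 61) + 41) + 2 * n * 5 + 50

/-- The registers that an attempt may change. -/
def bodyRegs : List ℕ :=
  [rFlag, rDone, rAns, rQ, rR, rA, rE, rX, rAcc, rW, rPr, rI, rBase, rEx, rRes, rTmp]

lemma tri_solveCmd (hi : Inst V β a t) (h : Setting V β (2 * n) q m)
    (hadm : 8 * (n + 1) * m ≤ q) (hN : f rN = n) (hT : f rT = t) (hq : f rq = q)
    (hm : f rm = m) (hN2 : f rN2 = (2 * n : ℕ)) (hdone : f rDone = 0) :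
    Tri V solveCmd f (solveTime β n q) fun f' =>
      Frame [rDone, rAns, rQ, rR, rA, rE, rX, rAcc, rW, rPr, rI, rBase, rEx, rRes, rTmp] f f' ∧
      Outcome a t m f' := by
  have hV := h.fit
  have h1 := h.one_le
  have hle := h.le
  have hqQ := h.le_pow
  have hpos := h.pos
  have hlit := hV.lit_lt
  have ht0 := Int.emod_nonneg t (b := (m : ℤ)) (by omega)
  have ht1 := Int.emod_lt_of_pos t (b := (m : ℤ)) (by omega)
  have hnm : (8 : ℤ) * (n * m) + 8 * m ≤ q := by
    have : ((8 * (n + 1) * m : ℕ) : ℤ) ≤ q := by exact_mod_cast hadm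
    push_cast at this
    linarith
  have hnm0 : (0 : ℤ) ≤ n * m := by positivity
  have htH : |t| < V.H := lt_of_le_of_lt (le_add_of_nonneg_right
    (Finset.sum_nonneg fun _ _ => abs_nonneg _)) hi.lt
  unfold solveTime
  refine Tri.seq hV _ (2 * n * (q * (2 * n * (β * 20 + 31) + β * 40 + 61) + 41) + 30)
    (tri_powerCmd h hq (by simp [hN2])) ?_ (by omega)
  rintro g ⟨hF, hQ⟩
  refine Tri.seq_assign hV (t % m) (by simp [Op.eval, hF rT, hT, hF rm, hm]) (by decide)
    (h.abs_lt ht0 (by omega)) ?_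
  refine Tri.seq_assign hV (n * m) (by simp [Op.eval, hF rN, hN, hF rm, hm]) (by decide)
    (h.abs_lt hnm0 (by omega)) ?_
  refine Tri.seq_assign hV (t % m + n * m) (by simp [Op.eval]) (by decide)
    (h.abs_lt (by omega) (by omega)) ?_
  refine Tri.seq_assign hV t (by simp [Op.eval, hF rT, hT]) (by decide) htH ?_
  refine Tri.seq_assign hV 0 (by simp [Op.eval]) (by decide) (h.abs_lt le_rfl (by omega)) ?_
  refine Tri.seq hV (2 * n * (q * (2 * n * (β * 20 + 31) + β * 40 + 61) + 41) + 1) 10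
    (P := fun g' => Frame [rDone, rAns, rQ, rR, rA, rE, rX, rAcc, rW, rPr, rI, rBase, rEx, rRes,
      rTmp] f g' ∧ g' rDone = 0 ∧
      Reduced V (2 * n) m t (t % m + n * m) (2 * n) (g' rA) (g' rR)) ?_ ?_
  · refine Tri.while hV (fun j g' => Frame [rQ, rR, rA, rE, rX, rAcc, rW, rPr, rI, rBase, rEx,
      rRes, rTmp] f g' ∧ g' rQ = (q ^ (2 * n + 1) : ℕ) ∧ ∃ e : ℕ, g' rE = e ∧ e + j = 2 * n ∧
      Reduced V (2 * n) m t (t % m + n * m) e (g' rA) (g' rR)) ?_ _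
      ⟨?_, by simp [hQ], 0, by simp, by simp, ?_⟩ ?_
    · rintro j g' ⟨hF', hQ', e, he, hej, hred⟩ hg
      simp only [Test.tr, Operand.val, he, hF' rN2 (by simp), hN2] at hg
      refine ⟨j - 1, by omega, ?_⟩
      refine Tri.mono (tri_reduceCmd h (e := e) (by omega) hQ' (by rw [hF' rq (by simp), hq])
        (by rw [hF' rm (by simp), hm]) he (by rw [hF' rN2 (by simp), hN2]) (by omega)
        (by push_cast; linarith) hi.lt hred) le_rfl ?_
      rintro g'' ⟨hF'', hE'', hred''⟩
      exact ⟨hF'.trans hF'' (by simp), by rw [hF'' rQ (by simp), hQ'], e + 1, hE'', by omega,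
        hred''⟩
    · intro y hy
      simp only [List.mem_cons, List.not_mem_nil, not_or] at hy
      simp [hy, hF y]
    · simp only [upd_apply]
      norm_num
      exact ⟨⟨∅, by simp, by simp, by simp⟩, Iff.rfl⟩
    · rintro j g' ⟨hF', hQ', e, he, hej, hred⟩ hg
      simp only [Test.tr, Operand.val, he, hF' rN2 (by simp), hN2] at hg
      have : e = 2 * n := by omega
      subst this
      exact ⟨fun y hy => hF' y fun hy' => hy (by simp at hy' ⊢; tauto),
        by rw [hF' rDone (by simp), hdone], hred⟩
  · rintro g' ⟨hF', hd', hred⟩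
    refine Tri.ite hV (fun hR => ?_) fun hR => ?_
    · simp only [Test.tr, Operand.val] at hR
      rw [hR] at hred
      refine Tri.ite hV (fun hA => ?_) fun hA => Tri.skip hV ⟨hF', Or.inl ⟨hd', ?_⟩⟩
      · simp only [Test.tr, Operand.val] at hA
        rw [hA] at hred
        refine Tri.seq_assign hV 1 (by simp [Op.eval]) (by decide) (by simp; omega) ?_
        refine Tri.assign hV 1 (by simp [Op.eval]) (by decide) (by simp; omega)
          ⟨(hF'.upd (by simp) _).upd (by simp) _, Or.inr ⟨by simp, ?_⟩⟩
        simpa using hi.isAnswer_one hred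
      · exact hi.not_separates h1 hA hred
    · refine Tri.seq_assign hV 1 (by simp [Op.eval]) (by decide) (by simp; omega) ?_
      refine Tri.assign hV 0 (by simp [Op.eval]) (by decide) (by simp; omega)
        ⟨(hF'.upd (by simp) _).upd (by simp) _, Or.inr ⟨by simp, ?_⟩⟩
      simpa using hi.isAnswer_zero h1 hR hred

-- Trial division takes about `q` steps, which is within the cost of an attempt.
open Classical in
lemma tri_checkCmd (hV : V.Fit) (hN : f rN = n) (hq : f rq = q) (hm : f rm = m)
    (hH : ((8 * (n + 1) * (m + 1) : ℕ) : ℤ) < V.H) :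
    Tri V checkCmd f (q * 8 + 40) fun f' => Frame [rFlag, rX, rTmp] f f' ∧
      f' rFlag = if Admissible n q m then 1 else 0 := by
  have hlit := hV.lit_lt
  push_cast at hH
  have hnm0 : (0 : ℤ) ≤ n * m := by positivity
  refine Tri.of_ok fun hok => ?_
  have hqH : (q : ℤ) < V.H := by
    have := hok.1 rq
    rw [hq] at this
    exact (le_abs_self _).trans_lt this
  refine Tri.seq_assign hV 1 (by simp [Op.eval]) (by decide) (by simp; omega) ?_
  refine Tri.seq_assign hV 2 (by simp [Op.eval]) (by decide) (by simp; omega) ?_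
  refine Tri.seq hV (q * (7 + 1) + 1) 20 (P := fun g => Frame [rFlag, rX, rTmp] f g ∧
      g rFlag = if ∃ y, 2 ≤ y ∧ y < q ∧ y ∣ q then 0 else 1) ?_ ?_
  · refine Tri.while hV (fun j g => Frame [rFlag, rX, rTmp] f g ∧
      -- The last alternative covers `q < 2`, where the loop is never entered and its counter
      -- already exceeds `q`.
      ∃ x : ℕ, g rX = x ∧ 2 ≤ x ∧ q ≤ x + j ∧ (x < q ∨ x ≤ q ∨ q < 2 ∧ x = 2) ∧
        g rFlag = if ∃ y, 2 ≤ y ∧ y < x ∧ y ∣ q then 0 else 1) ?_ _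
      ⟨((Frame.refl _ f).upd (by simp) _).upd (by simp) _, 2, by simp, le_rfl, by omega,
        by omega, ?_⟩ ?_
    · rintro j g ⟨hF, x, hx, h2, hxj, -, hfl⟩ hg
      simp only [Test.tr, Operand.val, hx, hF rq (by simp), hq] at hg
      have hxq : x < q := by omega
      refine ⟨j - 1, by omega, ?_⟩
      have hmod0 : 0 ≤ (q : ℤ) % x := Int.emod_nonneg _ (by omega)
      have hmod1 : (q : ℤ) % x < x := Int.emod_lt_of_pos _ (by omega)
      have hex : (∃ y, 2 ≤ y ∧ y < x + 1 ∧ y ∣ q) ↔ (∃ y, 2 ≤ y ∧ y < x ∧ y ∣ q) ∨ x ∣ q := by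
        constructor
        · rintro ⟨y, h1, h3, h4⟩
          rcases Nat.lt_succ_iff_lt_or_eq.1 h3 with h3 | rfl
          · exact Or.inl ⟨y, h1, h3, h4⟩
          · exact Or.inr h4
        · rintro (⟨y, h1, h3, h4⟩ | h4)
          · exact ⟨y, h1, by omega, h4⟩
          · exact ⟨x, h2, by omega, h4⟩
      refine Tri.seq_assign hV ((q : ℤ) % x) (by simp [Op.eval, hF rq, hq, hx]) (by decide)
        (abs_lt_of_mem hmod0 (by omega)) ?_
      refine Tri.seq hV 2 2 (P := fun g' => Frame [rFlag, rX, rTmp] f g' ∧ g' rX = x ∧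
        g' rFlag = if ∃ y, 2 ≤ y ∧ y < x + 1 ∧ y ∣ q then 0 else 1)
        (Tri.ite hV (fun h => ?_) fun h => Tri.skip hV ?_) fun g' h => ?_
      · have hd : x ∣ q := by
          simp only [Test.tr, Operand.val, upd_apply, if_true] at h
          exact_mod_cast Int.dvd_of_emod_eq_zero h
        refine Tri.assign hV 0 (by simp [Op.eval]) (by decide) (by simp; omega)
          ⟨(hF.upd (by simp) _).upd (by simp) _, by simp [hx], ?_⟩
        rw [if_pos (hex.2 (Or.inr hd))]
        simp
      · have hd : ¬ x ∣ q := by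
          simp only [Test.tr, Operand.val, upd_apply, if_true] at h
          intro hd
          exact h (Int.emod_eq_zero_of_dvd (by exact_mod_cast hd))
        refine ⟨hF.upd (by simp) _, by simp [hx], ?_⟩
        simp only [hex, hd, or_false]
        simpa using hfl
      · obtain ⟨hF', hx', hfl'⟩ := h
        refine Tri.assign hV (x + 1 : ℕ) (by simp [Op.eval, hx']) (by decide)
          (abs_lt_of_mem (by positivity) (by omega)) ?_
        exact ⟨hF'.upd (by simp) _, x + 1, by simp, by omega, by omega, by omega,
          by simpa using hfl'⟩
    · rw [if_neg]
      · simp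
      · rintro ⟨y, h1, h2, -⟩
        omega
    · rintro j g ⟨hF, x, hx, h2, hxj, hor, hfl⟩ hg
      simp only [Test.tr, Operand.val, hx, hF rq (by simp), hq] at hg
      refine ⟨hF, ?_⟩
      rw [hfl]
      refine if_congr (exists_congr fun y => ?_) rfl rfl
      constructor
      · rintro ⟨h1, h3, h4⟩
        exact ⟨h1, by omega, h4⟩
      · rintro ⟨h1, h3, h4⟩
        exact ⟨h1, by omega, h4⟩
  · rintro g ⟨hF, hfl⟩
    refine Tri.seq_assign hV (n + 1) (by simp [Op.eval, hF rN, hN]) (by decide)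
      (abs_lt_of_mem (by omega) (by nlinarith)) ?_
    refine Tri.seq_assign hV (8 * (n + 1)) (by simp [Op.eval]) (by decide)
      (abs_lt_of_mem (by omega) (by nlinarith)) ?_
    refine Tri.seq_assign hV (8 * (n + 1) * m) (by simp [Op.eval, hF rm, hm]) (by decide)
      (abs_lt_of_mem (by positivity) (by nlinarith)) ?_
    have hF1 := ((hF.upd (x := rTmp) (by simp) (n + 1)).upd (x := rTmp) (by simp)
      (8 * (n + 1))).upd (x := rTmp) (by simp) (8 * (n + 1) * m)
    refine Tri.seq hV 2 2 (P := fun g' => Frame [rFlag, rX, rTmp] f g' ∧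
        g' rFlag = if (∃ y, 2 ≤ y ∧ y < q ∧ y ∣ q) ∨ ¬ 8 * (n + 1) * m ≤ q then 0 else 1)
      (Tri.ite hV (fun h => ?_) fun h => Tri.skip hV ?_) ?_
    · simp only [Test.tr, Operand.val, upd_apply] at h
      norm_num [hF rq, hq] at h
      refine Tri.assign hV 0 (by simp [Op.eval]) (by decide) (by simp; omega)
        ⟨hF1.upd (by simp) _, ?_⟩
      rw [if_pos (Or.inr (by rw [not_le]; exact_mod_cast h))]
      simp
    · simp only [Test.tr, Operand.val, upd_apply] at h
      norm_num [hF rq, hq] at h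
      have h' : 8 * (n + 1) * m ≤ q := by exact_mod_cast h
      refine ⟨hF1, ?_⟩
      simp only [h', not_true, or_false]
      simpa using hfl
    · rintro g' ⟨hF', hfl'⟩
      have hadm : Admissible n q m ↔ ¬ ((∃ y, 2 ≤ y ∧ y < q ∧ y ∣ q) ∨ ¬ 8 * (n + 1) * m ≤ q) ∧
          1 ≤ m := by
        unfold Admissible
        rw [Nat.prime_def_lt']
        push Not
        constructor
        · rintro ⟨⟨-, h1⟩, h2, h3⟩
          exact ⟨⟨h1, h2⟩, h3⟩
        -- Trial division does not exclude `q < 2`; the demand `8 * (n + 1) * m ≤ q` does.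
        · rintro ⟨⟨h1, h2⟩, h3⟩
          exact ⟨⟨by nlinarith, h1⟩, h2, h3⟩
      refine Tri.ite hV (fun h => ?_) fun h => Tri.skip hV ⟨hF', ?_⟩
      · simp only [Test.tr, Operand.val, hF' rm (by simp), hm] at h
        refine Tri.assign hV 0 (by simp [Op.eval]) (by decide) (by simp; omega)
          ⟨hF'.upd (by simp) _, ?_⟩
        rw [if_neg (by rw [hadm]; rintro ⟨-, h'⟩; omega)]
        simp
      · simp only [Test.tr, Operand.val, hF' rm (by simp), hm] at h
        rw [hfl']
        have h1m : 1 ≤ m := by omega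
        by_cases hc : (∃ y, 2 ≤ y ∧ y < q ∧ y ∣ q) ∨ ¬ 8 * (n + 1) * m ≤ q
        · rw [if_pos hc, if_neg (by rw [hadm]; exact fun h => h.1 hc)]
        · rw [if_neg hc, if_pos (hadm.2 ⟨hc, h1m⟩)]

open Classical in
/-- One attempt with the moduli `q` and `m`. -/
lemma tri_bodyCmd (hi : Inst V β a t) (hN : f rN = n) (hT : f rT = t) (hq : f rq = q)
    (hm : f rm = m) (hN2 : f rN2 = (2 * n : ℕ)) (hdone : f rDone = 0)
    (hH : ((8 * (n + 1) * (m + 1) : ℕ) : ℤ) < V.H)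
    (hH' : (4 * ((q ^ (2 * n + 1) : ℕ) : ℤ)) * (q ^ (2 * n + 1) : ℕ) < V.H) :
    Tri V bodyCmd f (q * 8 + solveTime β n q + 50) fun f' => Frame bodyRegs f f' ∧
      (f' rFlag = if Admissible n q m then 1 else 0) ∧
      ((f' rDone = 0 ∧ ¬ (Admissible n q m ∧ Separates a t m)) ∨
        (f' rDone = 1 ∧ IsAnswer a t (f' rAns))) := by
  have hV := hi.fit
  refine Tri.seq hV _ (solveTime β n q + 1) (tri_checkCmd hV hN hq hm hH) ?_
  rintro g ⟨hF, hfl⟩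
  have hsub : [rFlag, rX, rTmp] ⊆ bodyRegs := by simp [bodyRegs]
  refine Tri.ite hV (fun h => ?_) fun h => Tri.skip hV ?_ (by unfold solveTime; omega)
  · simp only [Test.tr, Operand.val, hfl] at h
    have hadm : Admissible n q m := by
      by_contra hn
      simp [hn] at h
    have hset : Setting V β (2 * n) q m := by
      refine ⟨hV, hi.H, hi.mem_lt, hadm.1, hadm.2.2, ?_, hH'⟩
      have h1 := hadm.2.1
      have h2 := hadm.2.2
      nlinarith
    refine Tri.mono (tri_solveCmd hi hset hadm.2.1 (by rw [hF rN (by simp), hN])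
      (by rw [hF rT (by simp), hT]) (by rw [hF rq (by simp), hq]) (by rw [hF rm (by simp), hm])
      (by rw [hF rN2 (by simp), hN2]) (by rw [hF rDone (by simp), hdone])) le_rfl ?_
    rintro g' ⟨hF', hout⟩
    refine ⟨?_, by rw [hF' rFlag (by simp), hfl], ?_⟩
    · intro y hy
      rw [hF' y (fun h => hy (by simp [bodyRegs] at h ⊢; tauto)), hF y (fun h => hy (hsub h))]
    · rcases hout with ⟨h1, h2⟩ | h1
      · exact Or.inl ⟨h1, fun h => h2 h.2⟩
      · exact Or.inr h1
  · simp only [Test.tr, Operand.val, hfl] at h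
    have hadm : ¬ Admissible n q m := by
      intro hn
      simp [hn] at h
    exact ⟨fun y hy => hF y fun h => hy (hsub h), hfl,
      Or.inl ⟨by rw [hF rDone (by simp), hdone], fun h => hadm h.1⟩⟩

end SubsetSum

namespace SubsetSum

open RAM

variable {n : ℕ}

/-! ### The environment of an instance -/

/-- The memory that holds the instance. -/
noncomputable def instMem (a : Fin n → ℤ) : ℤ →₀ ℤ :=
  ∑ i : Fin n, Finsupp.single ((i : ℕ) : ℤ) (a i)

/-- The registers that hold the instance. -/
noncomputable def instRegs (n : ℕ) (t : ℤ) : ℕ →₀ ℤ :=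
  Finsupp.single 0 (n : ℤ) + Finsupp.single 1 t

/-- The environment of an instance, with `β` bits for each register. -/
noncomputable def instEnv (β : ℕ) (a : Fin n → ℤ) (t : ℤ) : Env where
  H := 2 ^ β
  w := 2 * β + 3
  mem := instMem a
  ans := IsAnswer a t

lemma instMem_apply (a : Fin n → ℤ) (i : Fin n) : instMem a ((i : ℕ) : ℤ) = a i := by
  unfold instMem
  rw [Finsupp.finsetSum_apply, Finset.sum_eq_single i]
  · simp
  · intro j _ hj
    rw [Finsupp.single_apply, if_neg]
    intro h
    exact hj (Fin.ext (by exact_mod_cast h))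
  · simp

lemma instMem_of_forall_ne (a : Fin n → ℤ) {z : ℤ} (h : ∀ i : Fin n, ((i : ℕ) : ℤ) ≠ z) :
    instMem a z = 0 := by
  unfold instMem
  rw [Finsupp.finsetSum_apply]
  exact Finset.sum_eq_zero fun i _ => by rw [Finsupp.single_apply, if_neg (h i)]

lemma abs_instMem_lt (a : Fin n → ℤ) (t : ℤ) (z : ℤ) : |instMem a z| < 2 ^ inputSize a t := by
  by_cases h : ∃ i : Fin n, ((i : ℕ) : ℤ) = z
  · obtain ⟨i, rfl⟩ := h
    rw [instMem_apply]
    refine lt_of_le_of_lt ?_ (abs_add_sum_abs_lt a t Finset.univ)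
    have h1 := Finset.single_le_sum (f := fun i => |a i|) (fun i _ => abs_nonneg _)
      (Finset.mem_univ i)
    have h2 := abs_nonneg t
    linarith
  · push Not at h
    rw [instMem_of_forall_ne a h]
    simp

lemma instEnv_inst (β : ℕ) (a : Fin n → ℤ) (t : ℤ) (hβ : inputSize a t + 10 < β) :
    Inst (instEnv β a t) β a t := by
  have hp : (2 : ℤ) ^ (inputSize a t + 11) ≤ 2 ^ β := pow_le_pow_right₀ (by norm_num) (by omega)
  rw [pow_add] at hp
  have hp1 : (1 : ℤ) ≤ 2 ^ inputSize a t := one_le_pow₀ (by norm_num)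
  refine ⟨⟨fun y z hy hz => ?_, fun i => ?_, ?_⟩, rfl, fun i => ?_, fun i => instMem_apply a i,
    fun i hi => instMem_of_forall_ne a fun j => ?_, ?_⟩
  · have h1 := bitlen_le_of_abs_lt hy
    have h2 := bitlen_le_of_abs_lt hz
    simp only [instEnv]
    omega
  · have := abs_instMem_lt a t i
    simp only [instEnv]
    omega
  · simp only [instEnv]
    omega
  · have := abs_instMem_lt a t i
    simp only [instEnv]
    omega
  · have := j.2
    omega
  · have h1 : ∑ i ∈ Finset.range (2 * n), |instMem a i| = ∑ i : Fin n, |a i| := by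
      rw [two_mul, Finset.sum_range_add, Finset.sum_range, Finset.sum_congr rfl
        (fun i _ => by rw [instMem_apply]), Finset.sum_eq_zero (s := Finset.range n), add_zero]
      intro i _
      rw [instMem_of_forall_ne a fun j => ?_, abs_zero]
      have := j.2
      push_cast
      omega
    have h2 := abs_add_sum_abs_lt a t Finset.univ
    simp only [instEnv]
    rw [h1]
    refine h2.trans_le ?_
    simp only [inputSize] at hp hp1 ⊢
    linarith

lemma instRegs_apply (n : ℕ) (t : ℤ) (x : ℕ) :
    instRegs n t x = if x = 0 then (n : ℤ) else if x = 1 then t else 0 := by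
  unfold instRegs
  rcases x with _ | _ | x <;> simp

lemma instRegs_ok {β : ℕ} (a : Fin n → ℤ) (t : ℤ) (hβ : inputSize a t + 10 < β) :
    (instEnv β a t).Ok (instRegs n t) := by
  have hp : (2 : ℤ) ^ (inputSize a t) ≤ 2 ^ β := pow_le_pow_right₀ (by norm_num) (by omega)
  have hn : (n : ℤ) < 2 ^ inputSize a t := by
    exact_mod_cast (card_le_inputSize a t).trans_lt Nat.lt_two_pow_self
  have ht : |t| < 2 ^ inputSize a t := by
    have h1 := abs_add_sum_abs_lt a t Finset.univ
    have h2 : 0 ≤ ∑ i, |a i| := Finset.sum_nonneg fun _ _ => abs_nonneg _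
    unfold inputSize
    linarith
  refine ⟨fun x => ?_, fun x hx => ?_⟩
  · rw [instRegs_apply]
    simp only [instEnv]
    split_ifs
    · rw [abs_of_nonneg (by omega)]
      omega
    · omega
    · simp
  · rw [instRegs_apply]
    unfold numRegs at hx
    rw [if_neg (by omega), if_neg (by omega)]

lemma init_eq (P : Cmd) (β : ℕ) (a : Fin n → ℤ) (t : ℤ) :
    init P a t = ⟨[P], ⟨instRegs n t, (instEnv β a t).mem⟩⟩ := rfl

lemma instMem_space (a : Fin n → ℤ) (t : ℤ) :
    ((instMem a).sum fun i v => bitlen i + bitlen v) ≤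
      inputSize a t * (inputSize a t + 2) := by
  classical
  set L := inputSize a t with hL
  have hn := card_le_inputSize a t
  have hsub : (instMem a).support ⊆
      Finset.univ.image fun i : Fin n => ((i : ℕ) : ℤ) := by
    intro z hz
    by_contra hne
    simp only [Finset.mem_image, Finset.mem_univ, true_and, not_exists] at hne
    exact Finsupp.mem_support_iff.1 hz (instMem_of_forall_ne a hne)
  rw [Finsupp.sum]
  calc _ ≤ ∑ z ∈ Finset.univ.image (fun i : Fin n => ((i : ℕ) : ℤ)),
        (bitlen z + bitlen (instMem a z)) :=
        Finset.sum_le_sum_of_subset hsub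
    _ = ∑ i : Fin n, (bitlen ((i : ℕ) : ℤ) + bitlen (a i)) := by
        rw [Finset.sum_image]
        · simp only [instMem_apply]
        · intro i _ j _ hij
          exact Fin.ext (by simpa using hij)
    _ = ∑ i : Fin n, bitlen ((i : ℕ) : ℤ) + ∑ i, bitlen (a i) := Finset.sum_add_distrib
    _ ≤ ∑ _i : Fin n, (n + 1) + L := by
        gcongr with i
        · refine bitlen_le_of_abs_lt ?_
          rw [abs_of_nonneg (by positivity)]
          exact_mod_cast i.2.trans Nat.lt_two_pow_self
        · rw [hL, inputSize]
          omega
    _ = n * (n + 1) + L := by simp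
    _ ≤ L * (L + 1) + L := by gcongr
    _ = _ := by ring

lemma _root_.RAM.Tri.E_le {V : Env} {P : Cmd} {f : ℕ →₀ ℤ} {T : ℕ}
    (h : Tri V P f T fun f' => V.ans (f' 0)) (hf : V.Ok f) (k : ℕ) :
    V.E k ⟨[P], ⟨f, V.mem⟩⟩ ≤ T := by
  obtain ⟨f', h1, h2, h3⟩ := h hf
  refine (h3 [] k).trans ?_
  rw [Env.E_halted ⟨h1, rfl, by simp [cost], fun _ => h2⟩, add_zero]

/-! ### The deterministic algorithm -/

/-- Step through pairs of moduli until one settles the instance. -/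
def detCmd : Cmd :=
  .assign rN2 .add (.reg rN) (.reg rN) ;;
  .assign rm .add (.lit 1) (.lit 0) ;;
  .while (.eq (.reg rDone) (.lit 0)) (
    bodyCmd ;;
    .ite (.eq (.reg rFlag) (.lit 1))
      (.assign rm .add (.reg rm) (.lit 1))
      (.assign rq .add (.reg rq) (.lit 1))) ;;
  .assign rN .add (.reg rAns) (.lit 0)

lemma detCmd_coinFree : detCmd.CoinFree := by
  simp [detCmd, bodyCmd, checkCmd, solveCmd, powerCmd, reduceCmd, hitCmd, pointCmd, factorCmd,
    powCmd, Cmd.CoinFree]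

/-- A bound for the number of steps of an attempt, in units of the larger modulus. -/
def bodyTime (β L : ℕ) : ℕ :=
  2 * L * (2 * L * (β * 20 + 31) + β * 40 + 61) + 100 * L + 120

lemma body_le {β L q Q n : ℕ} (hn : n ≤ L) (hq : q ≤ Q) :
    q * 8 + solveTime β n q + 50 ≤ (Q + 1) * bodyTime β L := by
  unfold solveTime bodyTime
  have h1 : 2 * n * (q * (2 * n * (β * 20 + 31) + β * 40 + 61) + 41) ≤
      2 * L * (Q * (2 * L * (β * 20 + 31) + β * 40 + 61) + 41) := by gcongr
  have h2 : 0 ≤ 2 * L * (2 * L * (β * 20 + 31) + β * 40 + 61) := Nat.zero_le _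
  have h3 : 0 ≤ Q * L := Nat.zero_le _
  nlinarith

lemma isAnswer_abs_lt {a : Fin n → ℤ} {t z H : ℤ} (h : IsAnswer a t z) (hH : 1 < H) : |z| < H := by
  rcases h with ⟨-, rfl⟩ | ⟨-, rfl⟩ <;> simp <;> omega

/-- The bounds that make room for the moduli below `2 ^ ℓ`. -/
lemma room {β ℓ L q m n : ℕ} (hn : n + 10 ≤ L) (hℓ : L ≤ ℓ) (hβ : β = ℓ * (4 * L))
    (hq : q < 2 ^ ℓ) (hm : m < 2 ^ ℓ) :
    ((8 * (n + 1) * (m + 1) : ℕ) : ℤ) < 2 ^ β ∧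
    (4 * ((q ^ (2 * n + 1) : ℕ) : ℤ)) * (q ^ (2 * n + 1) : ℕ) < 2 ^ β := by
  constructor
  · have : 8 * (n + 1) * (m + 1) < 2 ^ β := by
      calc 8 * (n + 1) * (m + 1) ≤ 2 ^ 3 * 2 ^ n * 2 ^ ℓ := by
            gcongr
            · norm_num
            · exact Nat.lt_two_pow_self
            · exact hm
        _ = 2 ^ (3 + n + ℓ) := by rw [pow_add, pow_add]
        -- The factor `4 * L` in `β` is dictated by the other bound: four times the square of `q ^
        -- (2 * n + 1)` has at most `2 + 2 * ℓ * (2 * n + 1)` bits.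
        _ < 2 ^ β := Nat.pow_lt_pow_right (by norm_num) (by rw [hβ]; nlinarith)
    exact_mod_cast this
  · have : 4 * q ^ (2 * n + 1) * q ^ (2 * n + 1) < 2 ^ β := by
      calc 4 * q ^ (2 * n + 1) * q ^ (2 * n + 1)
          ≤ 2 ^ 2 * (2 ^ ℓ) ^ (2 * n + 1) * (2 ^ ℓ) ^ (2 * n + 1) := by gcongr; norm_num
        _ = 2 ^ (2 + ℓ * (2 * n + 1) + ℓ * (2 * n + 1)) := by
            rw [← pow_mul, ← pow_add, ← pow_add]
        _ < 2 ^ β := Nat.pow_lt_pow_right (by norm_num) (by rw [hβ]; nlinarith)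
    exact_mod_cast this

/-- The walk raises `m` after an inconclusive attempt and `q` if the pair is not admissible. It
cannot leave the rectangle below a good pair `(q₀, m₀)`. At `q = q₀` every `m` with `1 ≤ m ≤ m₀` is
admissible, so `q` is not raised further; at `m = m₀` the first admissible `q` settles the instance.
Hence there are at most `m₀ + q₀` moves. -/
lemma tri_detCmd {β ℓ L : ℕ} {a : Fin n → ℤ} {t : ℤ} (hL : L = inputSize a t + 10)
    (hℓ : L ≤ ℓ) (hβ : β = ℓ * (4 * L)) {q₀ m₀ : ℕ} (hq₀ : q₀ < 2 ^ ℓ)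
    (hadm : Admissible n q₀ m₀) (hsep : Separates a t m₀) :
    Tri (instEnv β a t) detCmd (instRegs n t)
      ((m₀ + q₀ + 1) * ((q₀ + 1) * bodyTime β L + 10) + 10)
      fun f' => IsAnswer a t (f' 0) := by
  classical
  have hn := card_le_inputSize a t
  have hβ' : inputSize a t + 10 < β := by rw [hβ]; nlinarith
  have hi := instEnv_inst β a t hβ'
  have hV := hi.fit
  have hlit := hV.lit_lt
  have hH : (instEnv β a t).H = 2 ^ β := rfl
  have hℓβ : (2 : ℤ) ^ ℓ < 2 ^ β := pow_lt_pow_right₀ (by norm_num) (by rw [hβ]; nlinarith)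
  have hm₀q : m₀ ≤ q₀ := by
    have := hadm.2.1
    nlinarith
  have hn2 : ((2 * n : ℕ) : ℤ) < 2 ^ ℓ := by
    have h1 : 2 * n < 2 ^ ℓ := by
      calc 2 * n < 2 * 2 ^ n := by gcongr; exact Nat.lt_two_pow_self
        _ = 2 ^ (n + 1) := by rw [pow_succ]; ring
        _ ≤ 2 ^ ℓ := Nat.pow_le_pow_right (by norm_num) (by omega)
    exact_mod_cast h1
  have hq₀' : (q₀ : ℤ) < 2 ^ ℓ := by exact_mod_cast hq₀
  refine Tri.seq_assign hV (2 * n : ℕ) (by simp [Op.eval, instRegs_apply, two_mul]) (by decide)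
    (abs_lt_of_mem (by positivity) (by omega)) ?_
  refine Tri.seq_assign hV 1 (by simp [Op.eval]) (by decide) (by simp; omega) ?_
  refine Tri.seq hV ((m₀ + q₀ + 1) * ((q₀ + 1) * bodyTime β L + 10) + 1) 2
    (P := fun g => IsAnswer a t (g rAns)) ?_ ?_
  · refine Tri.while hV (T := (q₀ + 1) * bodyTime β L + 9) (fun j g =>
      (g rN = n ∧ g rT = t ∧ g rN2 = (2 * n : ℕ)) ∧
      ((g rDone = 1 ∧ IsAnswer a t (g rAns)) ∨ (g rDone = 0 ∧ ∃ q m : ℕ, g rq = q ∧ g rm = m ∧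
        1 ≤ m ∧ m ≤ m₀ ∧ q ≤ q₀ ∧ (m₀ - m) + (q₀ - q) + 1 ≤ j))) ?_ _
      ⟨by simp [instRegs_apply], Or.inr ⟨by simp [instRegs_apply], 0, 1,
        by simp [instRegs_apply], by simp, le_rfl, hadm.2.2, Nat.zero_le _, by omega⟩⟩ ?_
    · rintro j g ⟨⟨hN, hT, hN2⟩, h | ⟨hd, q, m, hq, hm, hm1, hmm, hqq, hj⟩⟩ hg
      · simp [h.1] at hg
      · refine ⟨j - 1, by omega, ?_⟩
        obtain ⟨hr1, hr2⟩ := room (n := n) (by omega) hℓ hβ (q := q) (m := m) (by omega) (by omega)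
        refine Tri.seq hV _ 2 (tri_bodyCmd hi hN hT hq hm hN2 hd hr1 hr2) ?_ ?_
        · rintro g' ⟨hF, hfl, hout⟩
          have hFN : g' rN = n ∧ g' rT = t ∧ g' rN2 = (2 * n : ℕ) := by
            rw [hF rN (by simp [bodyRegs]), hF rT (by simp [bodyRegs]),
              hF rN2 (by simp [bodyRegs])]
            exact ⟨hN, hT, hN2⟩
          have hq' : g' rq = q := by rw [hF rq (by simp [bodyRegs]), hq]
          have hm' : g' rm = m := by rw [hF rm (by simp [bodyRegs]), hm]
          refine Tri.ite hV (fun h => ?_) fun h => ?_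
          · refine Tri.assign hV (m + 1 : ℕ) (by simp [Op.eval, hm']) (by decide)
              (abs_lt_of_mem (by positivity) (by push_cast; omega)) ⟨by simpa using hFN, ?_⟩
            rcases hout with ⟨hd', hns⟩ | hdone
            · have hA : Admissible n q m := by
                by_contra hA
                simp [hfl, hA] at h
              have hne : m ≠ m₀ := by
                rintro rfl
                exact hns ⟨hA, hsep⟩
              exact Or.inr ⟨by simpa using hd', q, m + 1, by simpa using hq', by simp, by omega,
                by omega, hqq, by omega⟩
            · exact Or.inl (by simpa using hdone)
          · refine Tri.assign hV (q + 1 : ℕ) (by simp [Op.eval, hq']) (by decide)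
              (abs_lt_of_mem (by positivity) (by push_cast; omega)) ⟨by simpa using hFN, ?_⟩
            rcases hout with ⟨hd', hns⟩ | hdone
            · have hA : ¬ Admissible n q m := by
                intro hA
                simp [hfl, hA] at h
              have hne : q ≠ q₀ := by
                rintro rfl
                refine hA ⟨hadm.1, le_trans ?_ hadm.2.1, hm1⟩
                gcongr
              exact Or.inr ⟨by simpa using hd', q + 1, m, by simp, by simpa using hm', hm1,
                hmm, by omega, by omega⟩
            · exact Or.inl (by simpa using hdone)
        · have := body_le (β := β) (n := n) (L := L) (by omega) hqq
          omega
    · rintro j g ⟨-, h | ⟨hd, -⟩⟩ hg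
      · exact h.2
      · simp [hd] at hg
  · intro g hg
    exact Tri.assign hV (g rAns) (by simp [Op.eval]) (by decide)
      (isAnswer_abs_lt hg (by omega)) (by simpa using hg)

end SubsetSum

namespace SubsetSum

open RAM

/-! ### The law of the random moduli -/

/-- The expectation of `h` when two numbers are extended by random binary digits, at most `i`
times, and before each extension the process stops with probability one half. -/
noncomputable def grow : ℕ → (ℕ → ℕ → ℝ≥0∞) → ℕ → ℕ → ℝ≥0∞
  | 0, h, q, m => h q m
  | i + 1, h, q, m => (h q m + (∑ x ∈ Finset.range 2, ∑ y ∈ Finset.range 2,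
      grow i h (2 * q + x) (2 * m + y)) / 4) / 2

lemma grow_add (g h : ℕ → ℕ → ℝ≥0∞) (i q m : ℕ) :
    grow i (fun q m => g q m + h q m) q m = grow i g q m + grow i h q m := by
  induction i generalizing q m with
  | zero => rfl
  | succ i ih =>
    simp only [grow, ih, Finset.sum_add_distrib, ENNReal.add_div]
    ring

lemma grow_mul (c : ℝ≥0∞) (h : ℕ → ℕ → ℝ≥0∞) (i q m : ℕ) :
    grow i (fun q m => c * h q m) q m = c * grow i h q m := by
  induction i generalizing q m with
  | zero => rfl
  | succ i ih =>
    simp only [grow, ih, ← Finset.mul_sum, div_eq_mul_inv]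
    ring

lemma ennreal_quarter (a : ℝ≥0∞) : (4 * a) / 4 = a := by
  rw [mul_comm, ENNReal.mul_div_cancel_right (by norm_num) (by norm_num)]

lemma grow_const (c : ℝ≥0∞) (i q m : ℕ) : grow i (fun _ _ => c) q m = c := by
  induction i generalizing q m with
  | zero => rfl
  | succ i ih =>
    simp only [grow, ih, Finset.sum_const, Finset.card_range, nsmul_eq_mul]
    rw [← mul_assoc, show (((2 : ℕ) : ℝ≥0∞) * ((2 : ℕ) : ℝ≥0∞)) = 4 by norm_num, ennreal_quarter,
      ennreal_half_add_self]

/-- A further digit is drawn with probability one half and at most doubles `q + 1`, so each possible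
length contributes at most the initial `q + 1` to the expectation. -/
lemma grow_succ_le (i q m : ℕ) :
    grow i (fun q _ => (q : ℝ≥0∞) + 1) q m ≤ (i + 1) * ((q : ℝ≥0∞) + 1) := by
  induction i generalizing q m with
  | zero => simp [grow]
  | succ i ih =>
    unfold grow
    calc _ ≤ ((q : ℝ≥0∞) + 1 + (∑ x ∈ Finset.range 2, ∑ y ∈ Finset.range 2,
          ((i : ℝ≥0∞) + 1) * (2 * (q + 1))) / 4) / 2 := by
          gcongr with x hx y hy
          refine (ih _ _).trans ?_
          gcongr
          have : x ≤ 1 := by simpa [Nat.lt_succ_iff] using Finset.mem_range.1 hx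
          have h2 : 2 * q + x + 1 ≤ 2 * (q + 1) := by omega
          exact_mod_cast h2
      _ ≤ ((2 : ℝ≥0∞) * ((i + 1 + 1) * (q + 1))) / 2 := by
          simp only [Finset.sum_const, Finset.card_range, nsmul_eq_mul]
          rw [← mul_assoc, show (((2 : ℕ) : ℝ≥0∞) * ((2 : ℕ) : ℝ≥0∞)) = 4 by norm_num,
            ennreal_quarter]
          gcongr
          calc (q : ℝ≥0∞) + 1 + (i + 1) * (2 * (q + 1))
              ≤ (q : ℝ≥0∞) + 1 + (i + 1) * (2 * (q + 1)) + (q + 1) := le_self_add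
            _ = _ := by ring
      _ = _ := by
          rw [mul_comm, ENNReal.mul_div_cancel_right (by norm_num) (by norm_num)]
          push_cast
          ring

/-- Exactly `j` digits are drawn with probability at least `1 / (2 * 2 ^ j)`, and then each of the
`4 ^ j` pairs of digit strings is equally likely. -/
lemma le_grow (g : ℕ → ℕ → ℝ≥0∞) (j i : ℕ) (hji : j ≤ i) (q m : ℕ) :
    (∑ x ∈ Finset.range (2 ^ j), ∑ y ∈ Finset.range (2 ^ j), g (2 ^ j * q + x) (2 ^ j * m + y)) /
      (2 * 8 ^ j) ≤ grow i g q m := by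
  induction j generalizing i q m with
  | zero =>
    have h2 : g q m / 2 ≤ grow i g q m := by
      cases i with
      | zero => exact ENNReal.half_le_self
      | succ i =>
        unfold grow
        gcongr
        exact le_self_add
    simpa using h2
  | succ j ih =>
    obtain ⟨i, rfl⟩ : ∃ i', i = i' + 1 := ⟨i - 1, by omega⟩
    -- The first digit drawn, `u`, is the leading one of the appended block.
    have hsplit : ∀ F : ℕ → ℝ≥0∞, ∀ p, ∑ x ∈ Finset.range (2 ^ (j + 1)), F (2 ^ (j + 1) * p + x) =
        ∑ u ∈ Finset.range 2, ∑ x ∈ Finset.range (2 ^ j), F (2 ^ j * (2 * p + u) + x) := by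
      intro F p
      rw [pow_succ, mul_two, Finset.sum_range_add, Finset.sum_range_succ, Finset.sum_range_one]
      congr 1 <;> refine Finset.sum_congr rfl fun x _ => ?_ <;> congr 1 <;> ring
    unfold grow
    calc _ = ((∑ u ∈ Finset.range 2, ∑ v ∈ Finset.range 2, (∑ x ∈ Finset.range (2 ^ j),
          ∑ y ∈ Finset.range (2 ^ j), g (2 ^ j * (2 * q + u) + x) (2 ^ j * (2 * m + v) + y)) /
            (2 * 8 ^ j)) / 4) / 2 := by
          have h1 : ∀ x, ∑ y ∈ Finset.range (2 ^ (j + 1)),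
              g x (2 ^ (j + 1) * m + y) = ∑ v ∈ Finset.range 2, ∑ y ∈ Finset.range (2 ^ j),
                g x (2 ^ j * (2 * m + v) + y) := fun x => hsplit (g x) m
          simp_rw [h1]
          rw [hsplit (fun x => ∑ v ∈ Finset.range 2, ∑ y ∈ Finset.range (2 ^ j),
                g x (2 ^ j * (2 * m + v) + y)) q]
          simp only [div_eq_mul_inv, ← Finset.sum_mul]
          rw [mul_assoc, mul_assoc]
          congr 1
          · refine Finset.sum_congr rfl fun u _ => ?_
            rw [Finset.sum_comm]
          · rw [← ENNReal.mul_inv (by simp) (by simp), ← ENNReal.mul_inv (by simp) (by simp)]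
            congr 1
            ring
      _ ≤ _ := by
          gcongr
          refine le_trans ?_ le_add_self
          gcongr with u _ v _
          exact ih i (by omega) _ _

lemma card_le_grow (G : Finset (ℕ × ℕ)) (j i : ℕ) (hji : j ≤ i)
    (hG : ∀ p ∈ G, p.1 < 2 ^ j ∧ p.2 < 2 ^ j) (g : ℕ → ℕ → ℝ≥0∞)
    (hg : ∀ p ∈ G, 1 ≤ g p.1 p.2) : (G.card : ℝ≥0∞) / (2 * 8 ^ j) ≤ grow i g 0 0 := by
  refine le_trans ?_ (le_grow g j i hji 0 0)
  gcongr
  simp only [mul_zero, zero_add]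
  rw [← Finset.sum_product' (f := fun x y => g x y)]
  calc (G.card : ℝ≥0∞) = ∑ p ∈ G, 1 := by simp
    _ ≤ ∑ p ∈ G, g p.1 p.2 := Finset.sum_le_sum hg
    _ ≤ _ := Finset.sum_le_sum_of_subset fun p hp => by
        rw [Finset.mem_product, Finset.mem_range, Finset.mem_range]
        exact hG p hp

/-! ### The randomized algorithm -/

/-- Extend both moduli by a random digit. -/
def growCmd : Cmd :=
  .assign rz .mul (.reg rz) (.lit 2) ;;
  .assign rq .mul (.reg rq) (.lit 2) ;;
  .assign rm .mul (.reg rm) (.lit 2) ;;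
  .flip rCoin ;;
  .assign rq .add (.reg rq) (.reg rCoin) ;;
  .flip rCoin ;;
  .assign rm .add (.reg rm) (.reg rCoin)

/-- Draw random moduli. -/
def drawCmd : Cmd :=
  .while (.lt (.reg rz) (.reg rZ)) (
    .flip rCoin ;;
    .ite (.eq (.reg rCoin) (.lit 0)) (.assign rz .add (.reg rZ) (.lit 0)) growCmd)

/-- Compute in `rZ` a cap for the size of the moduli. -/
def capCmd : Cmd :=
  .assign rZ .mul (.reg rT) (.reg rT) ;;
  .assign rZ .add (.reg rZ) (.lit 1) ;;
  .assign rZ .mul (.reg rZ) (.lit 4) ;;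
  .assign rZ .mul (.reg rZ) (.lit 1024) ;;
  .assign rI .add (.lit 0) (.lit 0) ;;
  .while (.lt (.reg rI) (.reg rN)) (
    .load rTmp (.reg rI) ;;
    .assign rTmp .mul (.reg rTmp) (.reg rTmp) ;;
    .assign rTmp .add (.reg rTmp) (.lit 1) ;;
    .assign rTmp .mul (.reg rTmp) (.lit 4) ;;
    .assign rZ .mul (.reg rZ) (.reg rTmp) ;;
    .assign rI .add (.reg rI) (.lit 1)) ;;
  .assign rZ .mul (.reg rZ) (.reg rZ) ;;
  .assign rZ .mul (.reg rZ) (.reg rZ) ;;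
  .assign rZ .mul (.reg rZ) (.reg rZ)

/-- Try random pairs of moduli until one settles the instance. -/
def randLoop : Cmd :=
  .while (.eq (.reg rDone) (.lit 0)) (
    .assign rz .add (.lit 1) (.lit 0) ;;
    .assign rq .add (.lit 0) (.lit 0) ;;
    .assign rm .add (.lit 0) (.lit 0) ;;
    drawCmd ;;
    bodyCmd)

/-- The randomized algorithm. -/
def randCmd : Cmd :=
  .assign rN2 .add (.reg rN) (.reg rN) ;;
  capCmd ;;
  randLoop ;;
  .assign rN .add (.reg rAns) (.lit 0)

section Draw

variable {V : Env} {f : ℕ →₀ ℤ} {κ : List Cmd} {k : ℕ} {B B₀ B₁ : ℝ≥0∞}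

lemma E_seq_le (hV : V.Fit) (hf : V.Ok f) {c d : Cmd}
    (h : V.E k ⟨c :: d :: κ, ⟨f, V.mem⟩⟩ ≤ B) :
    V.E k ⟨.seq c d :: κ, ⟨f, V.mem⟩⟩ ≤ 1 + B := by
  refine (V.E_step (hf.good (by simpa [cost] using hV.one_le))
    (d := ⟨c :: d :: κ, ⟨f, V.mem⟩⟩) (by simp [step]) k).trans ?_
  gcongr

lemma E_seq_flip_le (hV : V.Fit) (hf : V.Ok f) {d : Cmd} {x : ℕ}
    (h0 : V.E k ⟨d :: κ, ⟨upd f x 0, V.mem⟩⟩ ≤ B₀) (h1 : V.E k ⟨d :: κ, ⟨upd f x 1, V.mem⟩⟩ ≤ B₁) :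
    V.E k ⟨.seq (.flip x) d :: κ, ⟨f, V.mem⟩⟩ ≤ 2 + (B₀ + B₁) / 2 := by
  calc _ ≤ 1 + (1 + (B₀ + B₁) / 2) := by
        refine E_seq_le hV hf ((Env.E_flip hV hf x _ k).trans ?_)
        gcongr
    _ = _ := by ring

lemma E_seq_assign_le (hV : V.Fit) (hf : V.Ok f) {x : ℕ} {o : Op} {u v : Operand} [u.Small]
    [v.Small] {d : Cmd} (w : ℤ) (hw : o.eval (u.val f) (v.val f) = w) (hx : x < numRegs)
    (hb : |w| < V.H) (h : V.E k ⟨d :: κ, ⟨upd f x w, V.mem⟩⟩ ≤ B) :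
    V.E k ⟨.seq (.assign x o u v) d :: κ, ⟨f, V.mem⟩⟩ ≤ 2 + B := by
  obtain ⟨f', -, rfl, h3⟩ :=
    Tri.assign hV w hw hx hb (Q := fun f' => f' = upd f x w) rfl (T := 1) le_rfl hf
  calc _ ≤ 1 + (1 + B) := by
        refine E_seq_le hV hf ((h3 _ k).trans ?_)
        push_cast
        gcongr
    _ = _ := by ring

lemma E_assign_le (hV : V.Fit) (hf : V.Ok f) {x : ℕ} {o : Op} {u v : Operand} [u.Small]
    [v.Small] (w : ℤ) (hw : o.eval (u.val f) (v.val f) = w) (hx : x < numRegs)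
    (hb : |w| < V.H) (h : V.E k ⟨κ, ⟨upd f x w, V.mem⟩⟩ ≤ B) :
    V.E k ⟨.assign x o u v :: κ, ⟨f, V.mem⟩⟩ ≤ 1 + B := by
  obtain ⟨f', -, rfl, h3⟩ :=
    Tri.assign hV w hw hx hb (Q := fun f' => f' = upd f x w) rfl (T := 1) le_rfl hf
  refine (h3 _ k).trans ?_
  push_cast
  gcongr

lemma E_ite_true_le (hV : V.Fit) (hf : V.Ok f) {g : Test} [g.Small] {c d : Cmd} (hg : g.tr f)
    (h : V.E k ⟨c :: κ, ⟨f, V.mem⟩⟩ ≤ B) : V.E k ⟨.ite g c d :: κ, ⟨f, V.mem⟩⟩ ≤ 1 + B := by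
  refine (V.E_step (hf.good (by rw [cost]; exact Test.Small.cost_le hV hf))
    (d := ⟨c :: κ, ⟨f, V.mem⟩⟩) (by intro b; rw [step, Test.holds_mk, if_pos hg]) k).trans ?_
  gcongr

lemma E_ite_false_le (hV : V.Fit) (hf : V.Ok f) {g : Test} [g.Small] {c d : Cmd} (hg : ¬ g.tr f)
    (h : V.E k ⟨d :: κ, ⟨f, V.mem⟩⟩ ≤ B) : V.E k ⟨.ite g c d :: κ, ⟨f, V.mem⟩⟩ ≤ 1 + B := by
  refine (V.E_step (hf.good (by rw [cost]; exact Test.Small.cost_le hV hf))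
    (d := ⟨d :: κ, ⟨f, V.mem⟩⟩) (by intro b; rw [step, Test.holds_mk, if_neg hg]) k).trans ?_
  gcongr

end Draw

end SubsetSum

/-! ### Expected cost of drawing the moduli -/

namespace SubsetSum

open RAM

section Draw

variable {V : Env} {f : ℕ →₀ ℤ} {κ : List Cmd} {k : ℕ}

lemma half_shift (c a b : ℝ≥0∞) : (c + a + (c + b)) / 2 = c + (a + b) / 2 := by
  rw [show c + a + (c + b) = (c + c) + (a + b) by ring, ENNReal.add_div, ennreal_half_add_self]

/-- The bound `B x y` on the continuation may depend on the two digits; two independent tosses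
average it over the four pairs. -/
lemma E_growCmd_le (hV : V.Fit) (hf : V.Ok f) {z q m J : ℕ} (hz : f rz = z) (hq : f rq = q)
    (hm : f rm = m) (hzJ : z < 2 ^ J) (hqJ : q < 2 ^ J) (hmJ : m < 2 ^ J)
    (hJ : (2 : ℤ) ^ (J + 1) < V.H) (B : ℕ → ℕ → ℝ≥0∞)
    (hB : ∀ f' x y, V.Ok f' → Frame [rz, rq, rm, rCoin] f f' → x < 2 → y < 2 →
      f' rz = (2 * z : ℕ) → f' rq = (2 * q + x : ℕ) → f' rm = (2 * m + y : ℕ) →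
      V.E k ⟨κ, ⟨f', V.mem⟩⟩ ≤ B x y) :
    V.E k ⟨growCmd :: κ, ⟨f, V.mem⟩⟩ ≤
      13 + (∑ x ∈ Finset.range 2, ∑ y ∈ Finset.range 2, B x y) / 4 := by
  have hlit := hV.lit_lt
  have hzJ' : (z : ℤ) < 2 ^ J := by exact_mod_cast hzJ
  have hqJ' : (q : ℤ) < 2 ^ J := by exact_mod_cast hqJ
  have hmJ' : (m : ℤ) < 2 ^ J := by exact_mod_cast hmJ
  rw [pow_succ] at hJ
  have hbz : |((2 * z : ℕ) : ℤ)| < V.H := abs_lt_of_mem (by positivity) (by push_cast; omega)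
  have hbq : |((2 * q : ℕ) : ℤ)| < V.H := abs_lt_of_mem (by positivity) (by push_cast; omega)
  have hbm : |((2 * m : ℕ) : ℤ)| < V.H := abs_lt_of_mem (by positivity) (by push_cast; omega)
  have hok1 := ((hf.upd (x := rz) (by decide) hbz).upd (x := rq) (by decide) hbq).upd (x := rm)
    (by decide) hbm
  set f₁ := upd (upd (upd f rz (2 * z : ℕ)) rq (2 * q : ℕ)) rm (2 * m : ℕ) with hf₁
  have hq1 : f₁ rq = (2 * q : ℕ) := by simp [hf₁]
  have hm1 : f₁ rm = (2 * m : ℕ) := by simp [hf₁]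
  have hz1 : f₁ rz = (2 * z : ℕ) := by simp [hf₁]
  have hF1 : Frame [rz, rq, rm, rCoin] f f₁ :=
    (((Frame.refl _ f).upd (by simp) _).upd (by simp) _).upd (by simp) _
  have hcoin : ∀ x : ℕ, x < 2 → |(x : ℤ)| < V.H := fun x hx =>
    abs_lt_of_mem (by positivity) (by omega)
  have inner : ∀ x < 2, V.E k ⟨(.assign rq .add (.reg rq) (.reg rCoin) ;; .flip rCoin ;;
      .assign rm .add (.reg rm) (.reg rCoin)) :: κ, ⟨upd f₁ rCoin (x : ℕ), V.mem⟩⟩ ≤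
      5 + (B x 0 + B x 1) / 2 := by
    intro x hx
    have hok2 := hok1.upd (x := rCoin) (by decide) (hcoin x hx)
    have hbqx : |((2 * q + x : ℕ) : ℤ)| < V.H :=
      abs_lt_of_mem (by positivity) (by push_cast; omega)
    have hok3 := hok2.upd (x := rq) (by decide) hbqx
    have last : ∀ y < 2, V.E k ⟨.assign rm .add (.reg rm) (.reg rCoin) :: κ,
        ⟨upd (upd (upd f₁ rCoin (x : ℕ)) rq (2 * q + x : ℕ)) rCoin (y : ℕ), V.mem⟩⟩ ≤
        1 + B x y := by
      intro y hy
      have hok4 := hok3.upd (x := rCoin) (by decide) (hcoin y hy)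
      have hbmy : |((2 * m + y : ℕ) : ℤ)| < V.H :=
        abs_lt_of_mem (by positivity) (by push_cast; omega)
      refine E_assign_le hV hok4 (2 * m + y : ℕ) (by simp [Op.eval, hm1]) (by decide) hbmy
        (hB _ x y (hok4.upd (by decide) hbmy) ?_ hx hy (by simp [hz1]) (by simp) (by simp))
      exact (((hF1.upd (by simp) _).upd (by simp) _).upd (by simp) _).upd (by simp) _
    calc _ ≤ 2 + (2 + (1 + B x 0 + (1 + B x 1)) / 2) := by
          refine E_seq_assign_le hV hok2 (2 * q + x : ℕ) (by simp [Op.eval, hq1]) (by decide) hbqx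
            (E_seq_flip_le hV hok3 ?_ ?_)
          · exact_mod_cast last 0 (by norm_num)
          · exact_mod_cast last 1 (by norm_num)
      _ = _ := by rw [half_shift]; ring
  calc _ ≤ 2 + (2 + (2 + (2 + (5 + (B 0 0 + B 0 1) / 2 + (5 + (B 1 0 + B 1 1) / 2)) / 2))) := by
        refine E_seq_assign_le hV hf (2 * z : ℕ) (by simp [Op.eval, hz, mul_comm]) (by decide) hbz ?_
        refine E_seq_assign_le hV (hf.upd (by decide) hbz) (2 * q : ℕ)
          (by simp [Op.eval, hq, mul_comm]) (by decide) hbq ?_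
        refine E_seq_assign_le hV ((hf.upd (by decide) hbz).upd (by decide) hbq) (2 * m : ℕ)
          (by simp [Op.eval, hm, mul_comm]) (by decide) hbm ?_
        refine E_seq_flip_le hV hok1 ?_ ?_
        · exact_mod_cast inner 0 (by norm_num)
        · exact_mod_cast inner 1 (by norm_num)
    _ = 13 + ((B 0 0 + B 0 1 + (B 1 0 + B 1 1)) / 2) / 2 := by
        rw [half_shift, ← ENNReal.add_div]
        ring
    _ = _ := by
        simp only [Finset.sum_range_succ, Finset.sum_range_zero, zero_add]
        rw [div_eq_mul_inv, div_eq_mul_inv, div_eq_mul_inv, mul_assoc,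
          ← ENNReal.mul_inv (by simp) (by simp)]
        norm_num

/-- Induction on the number `i` of digits that may still be drawn. `rz` is `2 ^ s` after `s` digits,
and stopping is simulated by raising it to the cap. The assumptions on `Z` say that the cap takes
effect after exactly `J` digits. `h` bounds what happens after the draw, so its expectation under
`grow` appears. -/
lemma E_drawCmd_le (hV : V.Fit) {f₀ : ℕ →₀ ℤ} {Z J : ℕ} (hZ : f₀ rZ = Z) (hZJ : Z ≤ 2 ^ J)
    (hJZ : ∀ s < J, 2 ^ s < Z) (hJ : (2 : ℤ) ^ (J + 1) < V.H) (h : ℕ → ℕ → ℝ≥0∞)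
    (hh : ∀ f' q m, V.Ok f' → Frame [rz, rq, rm, rCoin] f₀ f' → f' rq = (q : ℕ) →
      f' rm = (m : ℕ) → q < 2 ^ J → m < 2 ^ J → V.E k ⟨κ, ⟨f', V.mem⟩⟩ ≤ h q m) :
    ∀ (i s : ℕ) (f : ℕ →₀ ℤ) (q m : ℕ), s + i = J → V.Ok f → Frame [rz, rq, rm, rCoin] f₀ f →
      f rz = (2 ^ s : ℕ) → f rq = q → f rm = m → q < 2 ^ s → m < 2 ^ s →
      V.E k ⟨drawCmd :: κ, ⟨f, V.mem⟩⟩ ≤ 1 + 20 * i + grow i h q m := by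
  have hlit := hV.lit_lt
  have hZH : |(Z : ℤ)| < V.H := by
    have : (Z : ℤ) ≤ 2 ^ J := by exact_mod_cast hZJ
    rw [pow_succ] at hJ
    exact abs_lt_of_mem (by positivity) (by omega)
  intro i
  induction i with
  | zero =>
    intro s f q m hs hf hF hz hq hm hqs hms
    have hg : ¬ (Test.lt (.reg rz) (.reg rZ)).tr f := by
      simp only [Test.tr, Operand.val, hz, hF rZ (by simp), hZ]
      have : Z ≤ 2 ^ s := by rw [show s = J by omega]; exact hZJ
      push Not
      exact_mod_cast this
    refine (Env.E_while_false hV hf hg κ k).trans ?_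
    obtain rfl : s = J := by omega
    simpa [grow] using hh f q m hf hF hq hm hqs hms
  | succ i ih =>
    intro s f q m hs hf hF hz hq hm hqs hms
    have hpow : 2 ^ s < 2 ^ J := Nat.pow_lt_pow_right (by norm_num) (by omega)
    have hg : (Test.lt (.reg rz) (.reg rZ)).tr f := by
      simp only [Test.tr, Operand.val, hz, hF rZ (by simp), hZ]
      exact_mod_cast hJZ s (by omega)
    have hok0 : V.Ok (upd f rCoin 0) := hf.upd (by decide) (by simp; omega)
    have hok1 : V.Ok (upd f rCoin 1) := hf.upd (by decide) (by simp; omega)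
    have hF0 := hF.upd (x := rCoin) (by simp) 0
    have hF1 := hF.upd (x := rCoin) (by simp) 1
    set S := (∑ x ∈ Finset.range 2, ∑ y ∈ Finset.range 2, grow i h (2 * q + x) (2 * m + y)) / 4
      with hS
    have b0 : V.E k ⟨.ite (.eq (.reg rCoin) (.lit 0)) (.assign rz .add (.reg rZ) (.lit 0)) growCmd ::
        drawCmd :: κ, ⟨upd f rCoin 0, V.mem⟩⟩ ≤ 1 + (1 + (1 + h q m)) := by
      refine E_ite_true_le hV hok0 (by simp) (E_assign_le hV hok0 Z
        (by simp [Op.eval, hF rZ, hZ]) (by decide) hZH ?_)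
      refine (Env.E_while_false hV (hok0.upd (by decide) hZH) (by simp [hF rZ, hZ]) κ k).trans ?_
      gcongr
      exact hh _ q m (hok0.upd (by decide) hZH) (hF0.upd (by simp) _) (by simp [hq])
        (by simp [hm]) (by omega) (by omega)
    have b1 : V.E k ⟨.ite (.eq (.reg rCoin) (.lit 0)) (.assign rz .add (.reg rZ) (.lit 0)) growCmd ::
        drawCmd :: κ, ⟨upd f rCoin 1, V.mem⟩⟩ ≤ 1 + (13 + (1 + 20 * i + S)) := by
      refine E_ite_false_le hV hok1 (by simp) ?_
      refine (E_growCmd_le hV hok1 (z := 2 ^ s) (q := q) (m := m) (J := J) (by simp [hz])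
        (by simp [hq]) (by simp [hm]) hpow (by omega) (by omega) hJ
        (fun x y => 1 + 20 * i + grow i h (2 * q + x) (2 * m + y)) ?_).trans ?_
      · intro f' x y hok' hF' hx hy hz' hq' hm'
        refine ih (s + 1) f' _ _ (by omega) hok' (hF1.trans hF' (by simp))
          (by rw [hz', pow_succ, mul_comm]) hq' hm' ?_ ?_ <;> rw [pow_succ] <;> omega
      · gcongr
        simp only [Finset.sum_add_distrib, Finset.sum_const, Finset.card_range, nsmul_eq_mul]
        rw [hS, ENNReal.add_div]
        gcongr
        refine le_of_eq ?_
        rw [show ((2 : ℕ) : ℝ≥0∞) * (((2 : ℕ) : ℝ≥0∞) * 1) + ((2 : ℕ) : ℝ≥0∞) *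
          (((2 : ℕ) : ℝ≥0∞) * (20 * (i : ℝ≥0∞))) = 4 * (1 + 20 * i) by push_cast; ring,
          ennreal_quarter]
    calc V.E k ⟨drawCmd :: κ, ⟨f, V.mem⟩⟩
        ≤ 1 + (2 + (1 + (1 + (1 + h q m)) + (1 + (13 + (1 + 20 * i + S)))) / 2) := by
          refine (Env.E_while_true hV hf hg κ k).trans ?_
          gcongr
          exact E_seq_flip_le hV hf b0 b1
      _ = 3 + ((18 + 20 * i) + (h q m + S)) / 2 := by
          rw [← add_assoc]
          congr 2
          · norm_num
          · ring
      -- The halving of the overhead is given away; only the halving of the expectation matters.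
      _ ≤ 3 + ((18 + 20 * i) + (h q m + S) / 2) := by
          rw [ENNReal.add_div]
          gcongr
          exact ENNReal.half_le_self
      _ = 1 + 20 * (i + 1 : ℕ) + grow (i + 1) h q m := by
          rw [grow, ← hS]
          push_cast
          ring

end Draw

end SubsetSum

/-! ### The cap and the randomized loop -/

namespace SubsetSum

open RAM

variable {V : Env} {f : ℕ →₀ ℤ} {β n : ℕ} {a : Fin n → ℤ} {t : ℤ} {k : ℕ}

/-- A number whose logarithm is comparable to the bit length of `z`. -/
def capFactor (z : ℤ) : ℕ := 4 * (z.natAbs * z.natAbs + 1)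

/-- A number whose logarithm is comparable to the size of the instance. -/
def capNat (a : Fin n → ℤ) (t : ℤ) : ℕ := 1024 * capFactor t * ∏ i, capFactor (a i)

lemma capFactor_cast (z : ℤ) : (capFactor z : ℤ) = 4 * (z * z + 1) := by
  unfold capFactor
  push_cast
  rw [abs_mul_abs_self]

lemma one_le_capFactor (z : ℤ) : 1 ≤ capFactor z := by unfold capFactor; omega

/-- Bit lengths are not a machine operation, but squaring is: `capFactor` lies between `2 ^ bitlen
z` and its square. Multiplying over the input estimates `2 ^ inputSize` up to squaring. -/
lemma two_pow_bitlen_le (z : ℤ) : 2 ^ bitlen z ≤ capFactor z := by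
  unfold bitlen capFactor
  rcases Nat.eq_zero_or_pos z.natAbs with h | h
  · simp [h]
  · have h1 : 0 < z.natAbs.size := Nat.size_pos.2 h
    have h2 : 2 ^ (z.natAbs.size - 1) ≤ z.natAbs := Nat.lt_size.1 (by omega)
    have h3 : 2 ^ (z.natAbs.size + 1) = 4 * 2 ^ (z.natAbs.size - 1) := by
      rw [show z.natAbs.size + 1 = (z.natAbs.size - 1) + 2 by omega, pow_add]
      ring
    rw [h3]
    nlinarith

lemma capFactor_le (z : ℤ) : capFactor z ≤ 2 ^ (2 * bitlen z) := by
  unfold bitlen capFactor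
  generalize z.natAbs = y
  have h : y + 1 ≤ 2 ^ y.size := Nat.lt_size_self y
  have h2 : 2 ^ (2 * (y.size + 1)) = 4 * (2 ^ y.size * 2 ^ y.size) := by ring
  have h3 := Nat.mul_le_mul h h
  rw [h2]
  nlinarith

lemma two_pow_le_capNat (a : Fin n → ℤ) (t : ℤ) : 2 ^ (inputSize a t + 10) ≤ capNat a t := by
  unfold inputSize capNat
  rw [pow_add, pow_add, ← Finset.prod_pow_eq_pow_sum, mul_comm, ← mul_assoc]
  gcongr
  · norm_num
  · exact two_pow_bitlen_le t
  · exact two_pow_bitlen_le _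

lemma capNat_le (a : Fin n → ℤ) (t : ℤ) : capNat a t ≤ 2 ^ (2 * (inputSize a t + 10)) := by
  unfold inputSize capNat
  calc 1024 * capFactor t * ∏ i, capFactor (a i)
      ≤ 2 ^ 20 * 2 ^ (2 * bitlen t) * ∏ i, 2 ^ (2 * bitlen (a i)) := by
        gcongr
        · norm_num
        · exact capFactor_le t
        · exact capFactor_le _
    _ = _ := by
        rw [Finset.prod_pow_eq_pow_sum, ← Finset.mul_sum, ← pow_add, ← pow_add]
        congr 1
        ring

/-- The cap keeps space polynomial for every coin outcome. The eighth power makes room for the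
length `j ≤ 8 * L` of `exists_many_pairs`. -/
lemma tri_capCmd (hi : Inst V β a t) (hN : f rN = n) (hT : f rT = t)
    (hH : ((capNat a t ^ 8 : ℕ) : ℤ) < V.H) :
    Tri V capCmd f (n * 14 + 30) fun f' => Frame [rZ, rI, rTmp] f f' ∧
      f' rZ = (capNat a t ^ 8 : ℕ) := by
  have hV := hi.fit
  have hlit := hV.lit_lt
  set F := fun j => 1024 * capFactor t * ∏ i ∈ Finset.range j, capFactor (V.mem (i : ℤ)) with hF
  have hF0 : F 0 = 1024 * capFactor t := by simp [hF]
  have hFs : ∀ j, F (j + 1) = F j * capFactor (V.mem (j : ℤ)) := fun j => by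
    simp only [hF, Finset.prod_range_succ]
    ring
  have hFn : F n = capNat a t := by
    simp only [hF, capNat, Finset.prod_range, hi.mem_eq]
  have hmono : Monotone F := monotone_nat_of_le_succ fun j => by
    rw [hFs]
    exact Nat.le_mul_of_pos_right _ (one_le_capFactor _)
  have hcap1 : 1 ≤ capNat a t := Nat.one_le_two_pow.trans (two_pow_le_capNat a t)
  have hbd : ∀ e ≤ 8, ((capNat a t ^ e : ℕ) : ℤ) < V.H := fun e he => by
    refine lt_of_le_of_lt ?_ hH
    exact_mod_cast Nat.pow_le_pow_right hcap1 he
  have hb1 : (capNat a t : ℤ) < V.H := by simpa using hbd 1 (by norm_num)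
  have hFH : ∀ j ≤ n, (F j : ℤ) < V.H := fun j hj => by
    refine lt_of_le_of_lt ?_ hb1
    rw [← hFn]
    exact_mod_cast hmono hj
  have hFpos : ∀ j, 1 ≤ F j := fun j => by
    have := hmono (Nat.zero_le j)
    have := one_le_capFactor t
    omega
  have hcH : (1024 * capFactor t : ℤ) < V.H := by
    have := hFH 0 (Nat.zero_le n)
    rw [hF0] at this
    exact_mod_cast this
  have hc := capFactor_cast t
  have htt : 0 ≤ t * t := mul_self_nonneg t
  have hnH : (n : ℤ) < V.H := by
    refine lt_of_le_of_lt ?_ hb1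
    have h1 := two_pow_le_capNat a t
    have h2 := card_le_inputSize a t
    have h3 : n < 2 ^ n := Nat.lt_two_pow_self
    have h4 : 2 ^ n ≤ 2 ^ (inputSize a t + 10) := Nat.pow_le_pow_right (by norm_num) (by omega)
    omega
  refine Tri.seq_assign hV (t * t) (by simp [Op.eval, hT]) (by decide)
    (abs_lt_of_mem htt (by omega)) ?_
  refine Tri.seq_assign hV (t * t + 1) (by simp [Op.eval]) (by decide)
    (abs_lt_of_mem (by omega) (by omega)) ?_
  refine Tri.seq_assign hV (capFactor t) (by simp [Op.eval, hc, mul_comm]) (by decide)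
    (abs_lt_of_mem (by omega) (by omega)) ?_
  refine Tri.seq_assign hV (F 0 : ℕ) (by simp [Op.eval, hF0, mul_comm]) (by decide)
    (abs_lt_of_mem (by omega) (hFH 0 (Nat.zero_le n))) ?_
  refine Tri.seq_assign hV 0 (by simp [Op.eval]) (by decide) (by simp; omega) ?_
  refine Tri.seq hV (n * (13 + 1) + 1) 10 (P := fun g => Frame [rZ, rI, rTmp] f g ∧
    g rZ = (capNat a t : ℕ)) ?_ ?_
  · refine Tri.while hV (fun j g => Frame [rZ, rI, rTmp] f g ∧ ∃ i : ℕ, g rI = i ∧ i + j = n ∧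
      g rZ = (F i : ℕ)) ?_ _ ⟨?_, 0, by simp, by simp, by simp⟩ ?_
    · rintro j g ⟨hFr, i, hi', hij, hZ⟩ hg
      simp only [Test.tr, Operand.val, hi', hFr rN (by simp), hN] at hg
      refine ⟨j - 1, by omega, ?_⟩
      have hcm := capFactor_cast (V.mem i)
      have hmm : 0 ≤ V.mem i * V.mem i := mul_self_nonneg _
      have hcmH : (capFactor (V.mem i) : ℤ) < V.H := by
        refine lt_of_le_of_lt ?_ (hFH (i + 1) (by omega))
        rw [hFs]
        exact_mod_cast Nat.le_mul_of_pos_left _ (hFpos i)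
      refine Tri.seq_load hV (V.mem i) (by simp [hi']) (by decide) ?_
      refine Tri.seq_assign hV (V.mem i * V.mem i) (by simp [Op.eval]) (by decide)
        (abs_lt_of_mem hmm (by omega)) ?_
      refine Tri.seq_assign hV (V.mem i * V.mem i + 1) (by simp [Op.eval]) (by decide)
        (abs_lt_of_mem (by omega) (by omega)) ?_
      refine Tri.seq_assign hV (capFactor (V.mem i)) (by simp [Op.eval, hcm, mul_comm])
        (by decide) (abs_lt_of_mem (by omega) (by omega)) ?_
      refine Tri.seq_assign hV (F (i + 1) : ℕ) (by simp [Op.eval, hZ, hFs]) (by decide)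
        (abs_lt_of_mem (by omega) (hFH _ (by omega))) ?_
      refine Tri.assign hV (i + 1 : ℕ) (by simp [Op.eval, hi']) (by decide)
        (abs_lt_of_mem (by positivity) (by omega)) ⟨?_, i + 1, by simp, by omega, by simp⟩
      intro y hy
      have hy' := hy
      simp only [List.mem_cons, List.not_mem_nil, not_or] at hy
      simp [hy, hFr y]
    · intro y hy
      simp only [List.mem_cons, List.not_mem_nil, not_or] at hy
      simp [hy]
    · rintro j g ⟨hFr, i, hi', hij, hZ⟩ hg
      simp only [Test.tr, Operand.val, hi', hFr rN (by simp), hN] at hg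
      have : i = n := by omega
      subst this
      exact ⟨hFr, by rw [hZ, hFn]⟩
  · rintro g ⟨hFr, hZ⟩
    refine Tri.seq_assign hV (capNat a t ^ 2 : ℕ) (by simp [Op.eval, hZ, pow_two]) (by decide)
      (abs_lt_of_mem (by positivity) (hbd 2 (by norm_num))) ?_
    refine Tri.seq_assign hV (capNat a t ^ 4 : ℕ)
      (by simp only [Op.eval, Operand.val, upd_apply]; push_cast; ring) (by decide)
      (abs_lt_of_mem (by positivity) (hbd 4 (by norm_num))) ?_
    refine Tri.assign hV (capNat a t ^ 8 : ℕ)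
      (by simp only [Op.eval, Operand.val, upd_apply]; push_cast; ring) (by decide)
      (abs_lt_of_mem (by positivity) hH) ⟨?_, by simp⟩
    exact ((hFr.upd (by simp) _).upd (by simp) _).upd (by simp) _

/-! ### The randomized loop -/

/-- The final instruction: copy the answer. -/
def finishCmd : Cmd := .assign rN .add (.reg rAns) (.lit 0)

lemma E_done_le (hi : Inst (instEnv β a t) β a t) (hf : (instEnv β a t).Ok f)
    (hd : f rDone = 1) (ha : IsAnswer a t (f rAns)) :
    (instEnv β a t).E k ⟨[randLoop, finishCmd], ⟨f, (instEnv β a t).mem⟩⟩ ≤ 2 := by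
  have hV := hi.fit
  have hlit := hV.lit_lt
  refine (Env.E_while_false hV hf (by simp [hd]) _ k).trans ?_
  have hb := isAnswer_abs_lt ha (show 1 < (instEnv β a t).H by omega)
  calc _ ≤ (1 : ℝ≥0∞) + (1 + 0) := by
        gcongr
        refine E_assign_le hV hf (f rAns) (by simp [Op.eval]) (by decide) hb ?_
        rw [Env.E_halted]
        exact ⟨hf.upd (by decide) hb, rfl, by simp [cost], fun _ => (by simpa using ha : IsAnswer a t _)⟩
    _ = 2 := by norm_num

open Classical in
/-- The indicator of the pairs that may fail to settle the instance. -/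
noncomputable def badPair (a : Fin n → ℤ) (t : ℤ) (q m : ℕ) : ℝ≥0∞ :=
  if Admissible n q m ∧ Separates a t m then 0 else 1

open Classical in
/-- The indicator of the pairs that settle the instance. -/
noncomputable def goodPair (a : Fin n → ℤ) (t : ℤ) (q m : ℕ) : ℝ≥0∞ :=
  if Admissible n q m ∧ Separates a t m then 1 else 0

lemma badPair_add_goodPair (a : Fin n → ℤ) (t : ℤ) (q m : ℕ) :
    badPair a t q m + goodPair a t q m = 1 := by
  unfold badPair goodPair
  split_ifs <;> simp

/-- The registers during the randomized loop, before the instance is settled. -/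
def Searching (a : Fin n → ℤ) (t : ℤ) (f : ℕ →₀ ℤ) : Prop :=
  f rN = n ∧ f rT = t ∧ f rN2 = (2 * n : ℕ) ∧ f rZ = (capNat a t ^ 8 : ℕ) ∧ f rDone = 0

/-- The expected number of steps of a round of the randomized loop. -/
def roundTime (β L J : ℕ) : ℕ := 11 + 20 * J + bodyTime β L * (J + 1)

/-- One round costs its expected time and restarts the loop only on a bad pair. Entering the loop
uses up one step, so the bound `W` is needed only for `k`. -/
lemma E_round_le {L ℓ J : ℕ} (hL : L = inputSize a t + 10) (hℓ : ℓ = 17 * L)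
    (hβ : β = ℓ * (4 * L)) (hJ : J ≤ 16 * L) (hZJ : capNat a t ^ 8 ≤ 2 ^ J)
    (hJZ : ∀ s < J, 2 ^ s < capNat a t ^ 8) {W : ℝ≥0∞}
    (ih : ∀ f, (instEnv β a t).Ok f → Searching a t f →
      (instEnv β a t).E k ⟨[randLoop, finishCmd], ⟨f, (instEnv β a t).mem⟩⟩ ≤ W)
    (hf : (instEnv β a t).Ok f) (hs : Searching a t f) :
    (instEnv β a t).E (k + 1) ⟨[randLoop, finishCmd], ⟨f, (instEnv β a t).mem⟩⟩ ≤
      roundTime β L J + W * grow J (badPair a t) 0 0 := by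
  classical
  have hn := card_le_inputSize a t
  have hβ' : inputSize a t + 10 < β := by rw [hβ]; nlinarith
  have hi := instEnv_inst β a t hβ'
  have hV := hi.fit
  have hlit := hV.lit_lt
  have hJH : (2 : ℤ) ^ (J + 1) < (instEnv β a t).H :=
    pow_lt_pow_right₀ (by norm_num) (by rw [hβ]; nlinarith)
  obtain ⟨hN, hT, hN2, hZ, hd⟩ := hs
  set V := instEnv β a t with hVdef
  set R : Cmd := .assign rz .add (.lit 1) (.lit 0) ;; .assign rq .add (.lit 0) (.lit 0) ;;
    .assign rm .add (.lit 0) (.lit 0) ;; drawCmd ;; bodyCmd with hR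
  have hfirst : V.E (k + 1) ⟨[randLoop, finishCmd], ⟨f, V.mem⟩⟩ ≤
      1 + V.E k ⟨[R, randLoop, finishCmd], ⟨f, V.mem⟩⟩ := by
    rw [Env.E, avg_of_eq (d := ⟨[R, randLoop, finishCmd], ⟨f, V.mem⟩⟩)]
    · gcongr
      refine Env.pay_of_good (hf.good ?_)
      rw [randLoop, cost]
      exact Test.Small.cost_le hV hf
    · intro b
      rw [randLoop, step, Test.holds_mk, if_pos (by simp [hd])]
  have hb1 : |(1 : ℤ)| < V.H := by simp; omega
  have hb0 : |(0 : ℤ)| < V.H := by simp; omega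
  have hok1 := hf.upd (x := rz) (by decide) hb1
  have hok2 := hok1.upd (x := rq) (by decide) hb0
  have hok3 := hok2.upd (x := rm) (by decide) hb0
  set f₁ := upd (upd (upd f rz 1) rq 0) rm 0 with hf₁
  -- After the draw: the attempt, then either the two closing steps or, at most for a bad pair,
  -- another search.
  set h : ℕ → ℕ → ℝ≥0∞ := fun q m =>
    (bodyTime β L : ℝ≥0∞) * ((q : ℝ≥0∞) + 1) + (2 + W * badPair a t q m) with hh
  have hdraw : V.E k ⟨[drawCmd, bodyCmd, randLoop, finishCmd], ⟨f₁, V.mem⟩⟩ ≤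
      1 + 20 * J + grow J h 0 0 := by
    refine E_drawCmd_le hV (f₀ := f₁) (Z := capNat a t ^ 8) (by simp [hf₁, hZ]) hZJ hJZ hJH h ?_
      J 0 f₁ 0 0 (by omega) hok3 (Frame.refl _ _) (by simp [hf₁]) (by simp [hf₁]) (by simp [hf₁])
      (by simp) (by simp)
    intro g q m hg hF hq hm hqJ hmJ
    have hJℓ : 2 ^ J ≤ 2 ^ ℓ := Nat.pow_le_pow_right (by norm_num) (by omega)
    obtain ⟨hr1, hr2⟩ := room (n := n) (L := L) (ℓ := ℓ) (q := q) (m := m) (by omega) (by omega)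
      hβ (by omega) (by omega)
    have hgN : g rN = n := by rw [hF rN (by simp)]; simp [hf₁, hN]
    have hgT : g rT = t := by rw [hF rT (by simp)]; simp [hf₁, hT]
    have hgN2 : g rN2 = (2 * n : ℕ) := by rw [hF rN2 (by simp)]; simp [hf₁, hN2]
    have hgd : g rDone = 0 := by rw [hF rDone (by simp)]; simp [hf₁, hd]
    have hgZ : g rZ = (capNat a t ^ 8 : ℕ) := by rw [hF rZ (by simp)]; simp [hf₁, hZ]
    obtain ⟨g', hg', ⟨hF', -, hout⟩, hE⟩ := tri_bodyCmd hi hgN hgT hq hm hgN2 hgd hr1 hr2 hg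
    refine (hE _ k).trans ?_
    have hT := body_le (β := β) (q := q) (n := n) (L := L) (by omega) le_rfl
    simp only [hh]
    refine add_le_add ?_ ?_
    · calc _ ≤ (((q + 1) * bodyTime β L : ℕ) : ℝ≥0∞) := by exact_mod_cast hT
        _ = _ := by push_cast; ring
    · rcases hout with ⟨hd', hns⟩ | ⟨hd', hans⟩
      · rw [badPair, if_neg hns, mul_one]
        refine le_trans (ih g' hg' ?_) le_add_self
        refine ⟨?_, ?_, ?_, ?_, hd'⟩
        · rw [hF' rN (by simp [bodyRegs]), hgN]
        · rw [hF' rT (by simp [bodyRegs]), hgT]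
        · rw [hF' rN2 (by simp [bodyRegs]), hgN2]
        · rw [hF' rZ (by simp [bodyRegs]), hgZ]
      · exact (E_done_le hi hg' hd' hans).trans le_self_add
  have hgrow : grow J h 0 0 ≤ bodyTime β L * (J + 1) + (2 + W * grow J (badPair a t) 0 0) := by
    simp only [hh]
    rw [grow_add (fun q _ => (bodyTime β L : ℝ≥0∞) * ((q : ℝ≥0∞) + 1)),
      grow_mul _ (fun q _ => (q : ℝ≥0∞) + 1), grow_add (fun _ _ => 2), grow_const, grow_mul]
    gcongr
    simpa using grow_succ_le J 0 0
  calc _ ≤ 1 + (2 + (2 + (2 + (1 + (1 + 20 * J +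
        (bodyTime β L * (J + 1) + (2 + W * grow J (badPair a t) 0 0))))))) := by
        refine hfirst.trans ?_
        gcongr
        refine E_seq_assign_le hV hf 1 (by simp [Op.eval]) (by decide) hb1 ?_
        refine E_seq_assign_le hV hok1 0 (by simp [Op.eval]) (by decide) hb0 ?_
        refine E_seq_assign_le hV hok2 0 (by simp [Op.eval]) (by decide) hb0 ?_
        refine E_seq_le hV hok3 (hdraw.trans ?_)
        gcongr
    _ = _ := by
        unfold roundTime
        push_cast
        ring

/-- The bound `X * ρ` reproduces itself: as `1 ≤ ρ * good`, `X + X * ρ * bad ≤ X * ρ * (good + bad)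
= X * ρ`. Induction on `k` needs no prior knowledge that the expectation is finite. -/
lemma E_randLoop_le {L ℓ J ρ : ℕ} (hL : L = inputSize a t + 10) (hℓ : ℓ = 17 * L)
    (hβ : β = ℓ * (4 * L)) (hJ : J ≤ 16 * L) (hZJ : capNat a t ^ 8 ≤ 2 ^ J)
    (hJZ : ∀ s < J, 2 ^ s < capNat a t ^ 8) (hρ : 1 ≤ ρ * grow J (goodPair a t) 0 0) :
    ∀ (k : ℕ) (f : ℕ →₀ ℤ), (instEnv β a t).Ok f → Searching a t f →
      (instEnv β a t).E k ⟨[randLoop, finishCmd], ⟨f, (instEnv β a t).mem⟩⟩ ≤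
        ((roundTime β L J * ρ : ℕ) : ℝ≥0∞) := by
  intro k
  induction k with
  | zero => intro f _ _; simp [Env.E]
  | succ k ih =>
    intro f hf hs
    refine (E_round_le hL hℓ hβ hJ hZJ hJZ ih hf hs).trans ?_
    have hsum : grow J (goodPair a t) 0 0 + grow J (badPair a t) 0 0 = 1 := by
      rw [add_comm, ← grow_add]
      simp only [badPair_add_goodPair]
      exact grow_const 1 J 0 0
    calc (roundTime β L J : ℝ≥0∞) + ((roundTime β L J * ρ : ℕ) : ℝ≥0∞) *
          grow J (badPair a t) 0 0
        ≤ (roundTime β L J : ℝ≥0∞) * (ρ * grow J (goodPair a t) 0 0) +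
          ((roundTime β L J * ρ : ℕ) : ℝ≥0∞) * grow J (badPair a t) 0 0 := by
          gcongr
          exact le_mul_of_one_le_right' hρ
      _ = ((roundTime β L J * ρ : ℕ) : ℝ≥0∞) *
          (grow J (goodPair a t) 0 0 + grow J (badPair a t) 0 0) := by push_cast; ring
      _ = _ := by rw [hsum, mul_one]

/-- Each good pair of length `j` has probability at least `1 / (2 * 8 ^ j)`. In `8 ^ j = 2 ^ j * 4 ^
j` one factor is bounded through the number of subset sums, the other through the number of good
pairs. -/
lemma one_le_mul_grow {L J : ℕ} (hL : L = inputSize a t + 10)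
    (hZJ : capNat a t ^ 8 ≤ 2 ^ J) :
    1 ≤ ((2 ^ 38 * numSums a * L ^ 8 : ℕ) : ℝ≥0∞) * grow J (goodPair a t) 0 0 := by
  obtain ⟨j, hj, hj2, G, hG, hcard⟩ := exists_many_pairs a t L hL
  have hjJ : j ≤ J := by
    have h1 := two_pow_le_capNat a t
    rw [← hL] at h1
    have h2 : 2 ^ (8 * L) ≤ 2 ^ J := by
      calc 2 ^ (8 * L) = (2 ^ L) ^ 8 := by rw [← pow_mul, mul_comm]
        _ ≤ capNat a t ^ 8 := by gcongr
        _ ≤ _ := hZJ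
    have := (Nat.pow_le_pow_iff_right (by norm_num)).1 h2
    omega
  have h1 := card_le_grow G j J hjJ (fun p hp => ⟨(hG p hp).1, (hG p hp).2.1⟩) (goodPair a t)
    fun p hp => by rw [goodPair, if_pos (hG p hp).2.2]
  refine le_trans ?_ (mul_le_mul_right h1 _)
  rw [← mul_div_assoc, ENNReal.le_div_iff_mul_le (Or.inl (by simp)) (Or.inl (by finiteness)),
    one_mul]
  have h2 : 2 * 8 ^ j ≤ 2 ^ 38 * numSums a * L ^ 8 * G.card := by
    calc 2 * 8 ^ j = 2 * (2 ^ j * 4 ^ j) := by rw [← mul_pow]; norm_num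
      _ ≤ 2 * ((2 ^ 16 * numSums a * L ^ 4) * (2 ^ 21 * L ^ 4 * G.card)) := by gcongr
      _ = _ := by ring
  exact_mod_cast h2

/-- The expected number of steps of the randomized algorithm. -/
lemma E_randCmd_le {L J : ℕ} (hL : L = inputSize a t + 10)
    (hβ : β = 17 * L * (4 * L)) (hJ : J ≤ 16 * L) (hZJ : capNat a t ^ 8 ≤ 2 ^ J)
    (hJZ : ∀ s < J, 2 ^ s < capNat a t ^ 8) (k : ℕ) :
    (instEnv β a t).E k (init randCmd a t) ≤
      ((n * 14 + 40 + roundTime β L J * (2 ^ 38 * numSums a * L ^ 8) : ℕ) : ℝ≥0∞) := by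
  have hn := card_le_inputSize a t
  have hβ' : inputSize a t + 10 < β := by rw [hβ]; nlinarith
  have hi := instEnv_inst β a t hβ'
  have hV := hi.fit
  have hf := instRegs_ok a t hβ'
  have hH : (instEnv β a t).H = 2 ^ β := rfl
  have hcapH : ((capNat a t ^ 8 : ℕ) : ℤ) < (instEnv β a t).H := by
    have : capNat a t ^ 8 < 2 ^ β := hZJ.trans_lt (Nat.pow_lt_pow_right (by norm_num)
      (by rw [hβ]; nlinarith))
    rw [hH]
    exact_mod_cast this
  have hnH : |((2 * n : ℕ) : ℤ)| < (instEnv β a t).H := by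
    have : 2 * n < 2 ^ β := by
      calc 2 * n < 2 * 2 ^ n := by gcongr; exact Nat.lt_two_pow_self
        _ = 2 ^ (n + 1) := by rw [pow_succ]; ring
        _ ≤ 2 ^ β := Nat.pow_le_pow_right (by norm_num) (by omega)
    rw [hH]
    exact abs_lt_of_mem (by positivity) (by exact_mod_cast this)
  rw [init_eq randCmd β]
  have hok1 := hf.upd (x := rN2) (by decide) hnH
  obtain ⟨g, hg, ⟨hF, hZ⟩, hE⟩ := tri_capCmd hi (f := upd (instRegs n t) rN2 (2 * n : ℕ))
    (by simp [instRegs_apply]) (by simp [instRegs_apply]) hcapH hok1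
  have hs : Searching a t g := by
    refine ⟨?_, ?_, ?_, hZ, ?_⟩
    · rw [hF rN (by simp)]; simp [instRegs_apply]
    · rw [hF rT (by simp)]; simp [instRegs_apply]
    · rw [hF rN2 (by simp)]; simp
    · rw [hF rDone (by simp)]; simp [instRegs_apply]
  calc _ ≤ (2 : ℝ≥0∞) + (1 + (((n * 14 + 30 : ℕ) : ℝ≥0∞) + (1 +
        ((roundTime β L J * (2 ^ 38 * numSums a * L ^ 8) : ℕ) : ℝ≥0∞)))) := by
        refine E_seq_assign_le hV hf (2 * n : ℕ) (by simp [Op.eval, instRegs_apply, two_mul])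
          (by decide) hnH ?_
        refine E_seq_le hV hok1 ((hE _ k).trans ?_)
        gcongr
        exact E_seq_le hV hg (E_randLoop_le hL rfl hβ hJ hZJ hJZ
          (one_le_mul_grow hL hZJ) k g hg hs)
    _ ≤ _ := by
        rw [show (2 : ℝ≥0∞) + (1 + (((n * 14 + 30 : ℕ) : ℝ≥0∞) + (1 +
          ((roundTime β L J * (2 ^ 38 * numSums a * L ^ 8) : ℕ) : ℝ≥0∞)))) =
          ((n * 14 + 34 + roundTime β L J * (2 ^ 38 * numSums a * L ^ 8) : ℕ) : ℝ≥0∞) by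
            push_cast; ring]
        exact_mod_cast (by omega)

end SubsetSum

namespace SubsetSum

open RAM

/-! ### Polynomial bounds -/

/-- `F` is the evaluation of a polynomial. -/
def IsPoly (F : ℕ → ℕ) : Prop := ∃ p : Polynomial ℕ, ∀ x, p.eval x = F x

lemma IsPoly.const (c : ℕ) : IsPoly fun _ => c := ⟨Polynomial.C c, by simp⟩

lemma IsPoly.id : IsPoly fun x => x := ⟨Polynomial.X, by simp⟩

lemma IsPoly.add {F G : ℕ → ℕ} (hF : IsPoly F) (hG : IsPoly G) : IsPoly fun x => F x + G x := by
  obtain ⟨p, hp⟩ := hF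
  obtain ⟨r, hr⟩ := hG
  exact ⟨p + r, by simp [hp, hr]⟩

lemma IsPoly.mul {F G : ℕ → ℕ} (hF : IsPoly F) (hG : IsPoly G) : IsPoly fun x => F x * G x := by
  obtain ⟨p, hp⟩ := hF
  obtain ⟨r, hr⟩ := hG
  exact ⟨p * r, by simp [hp, hr]⟩

lemma IsPoly.pow {F : ℕ → ℕ} (hF : IsPoly F) (e : ℕ) : IsPoly fun x => F x ^ e := by
  obtain ⟨p, hp⟩ := hF
  exact ⟨p ^ e, by simp [hp]⟩

lemma IsPoly.bodyTime {F G : ℕ → ℕ} (hF : IsPoly F) (hG : IsPoly G) :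
    IsPoly fun x => bodyTime (F x) (G x) := by
  unfold SubsetSum.bodyTime
  repeat' first | exact hF | exact hG | apply IsPoly.const | apply IsPoly.add | apply IsPoly.mul

/-- The number of bits of a register. -/
def regBits (x : ℕ) : ℕ := 17 * (x + 10) * (4 * (x + 10))

/-- A bound for the space. -/
def spaceBound (x : ℕ) : ℕ := numRegs * (regBits x + 1) + x * (x + 2)

/-- A bound for the time of the randomized algorithm, up to the number of subset sums. -/
def randBound (x : ℕ) : ℕ :=
  (2 * regBits x + 3) * (x * 14 + 40 +
    (11 + 20 * (16 * (x + 10)) + bodyTime (regBits x) (x + 10) * (16 * (x + 10) + 1)) *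
      (2 ^ 38 * (x + 10) ^ 8))

/-- A bound for the size of the moduli, up to the number of subset sums. -/
def moduliBound (x : ℕ) : ℕ := 2 ^ 16 * (x + 10) ^ 4

/-- A bound for the time of the deterministic algorithm, up to the square of the number of subset
sums. -/
def detBound (x : ℕ) : ℕ :=
  (2 * regBits x + 3) *
    (2 * moduliBound x * (moduliBound x * bodyTime (regBits x) (x + 10) + 10) + 10)

lemma isPoly_regBits : IsPoly regBits :=
  ((IsPoly.const 17).mul (IsPoly.id.add (.const 10))).mul
    ((IsPoly.const 4).mul (IsPoly.id.add (.const 10)))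

lemma isPoly_spaceBound : IsPoly spaceBound :=
  ((IsPoly.const numRegs).mul (isPoly_regBits.add (.const 1))).add
    (IsPoly.id.mul (IsPoly.id.add (.const 2)))

lemma isPoly_bodyTime : IsPoly fun x => bodyTime (regBits x) (x + 10) :=
  isPoly_regBits.bodyTime (IsPoly.id.add (.const 10))

lemma isPoly_randBound : IsPoly randBound :=
  (((IsPoly.const 2).mul isPoly_regBits).add (.const 3)).mul
    (((IsPoly.id.mul (.const 14)).add (.const 40)).add
      ((((IsPoly.const 11).add ((IsPoly.const 20).mul
        ((IsPoly.const 16).mul (IsPoly.id.add (.const 10))))).add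
        (isPoly_bodyTime.mul (((IsPoly.const 16).mul (IsPoly.id.add (.const 10))).add
          (.const 1)))).mul
        ((IsPoly.const (2 ^ 38)).mul ((IsPoly.id.add (.const 10)).pow 8))))

lemma isPoly_moduliBound : IsPoly moduliBound :=
  (IsPoly.const (2 ^ 16)).mul ((IsPoly.id.add (.const 10)).pow 4)

lemma isPoly_detBound : IsPoly detBound :=
  (((IsPoly.const 2).mul isPoly_regBits).add (.const 3)).mul
    ((((IsPoly.const 2).mul isPoly_moduliBound).mul
      ((isPoly_moduliBound.mul isPoly_bodyTime).add (.const 10))).add (.const 10))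

/-! ### The two algorithms -/

variable {n : ℕ}

lemma space_le {a : Fin n → ℤ} {t : ℤ} {d : Config}
    (h : (instEnv (regBits (inputSize a t)) a t).Good d) :
    d.space ≤ spaceBound (inputSize a t) :=
  (h.space_le rfl).trans (Nat.add_le_add_left (instMem_space a t) _)

lemma exists_E_randCmd_le (a : Fin n → ℤ) (t : ℤ) : ∃ B : ℕ,
    (∀ k, (instEnv (regBits (inputSize a t)) a t).E k (init randCmd a t) ≤ B) ∧
    (2 * regBits (inputSize a t) + 3) * B ≤ numSums a * randBound (inputSize a t) := by
  set x := inputSize a t with hx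
  have hcap2 : capNat a t ^ 8 ≤ 2 ^ (16 * (x + 10)) := by
    calc capNat a t ^ 8 ≤ (2 ^ (2 * (x + 10))) ^ 8 := by gcongr; exact capNat_le a t
      _ = _ := by rw [← pow_mul]; congr 1; ring
  set J := Nat.clog 2 (capNat a t ^ 8) with hJ
  have hJ16 : J ≤ 16 * (x + 10) := Nat.clog_le_of_le_pow hcap2
  refine ⟨_, fun k => E_randCmd_le (L := x + 10) (J := J) (by rw [hx]) rfl hJ16
    (Nat.le_pow_clog (by norm_num) _) (fun s hs => Nat.pow_lt_of_lt_clog hs) k, ?_⟩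
  have hS := one_le_numSums a
  have hn := card_le_inputSize a t
  set S := numSums a
  have hround : roundTime (regBits x) (x + 10) J ≤ 11 + 20 * (16 * (x + 10)) +
      bodyTime (regBits x) (x + 10) * (16 * (x + 10) + 1) := by
    unfold roundTime
    gcongr
  set ρ := 11 + 20 * (16 * (x + 10)) + bodyTime (regBits x) (x + 10) * (16 * (x + 10) + 1) with hρ
  calc (2 * regBits x + 3) * (n * 14 + 40 + roundTime (regBits x) (x + 10) J *
        (2 ^ 38 * S * (x + 10) ^ 8))
      ≤ (2 * regBits x + 3) * (S * (x * 14 + 40) + ρ * (2 ^ 38 * S * (x + 10) ^ 8)) := by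
        gcongr
        refine le_trans (by gcongr) (Nat.le_mul_of_pos_left _ hS)
    _ = S * randBound x := by
        unfold randBound
        rw [← hρ]
        ring

lemma exists_E_detCmd_le (a : Fin n → ℤ) (t : ℤ) : ∃ B : ℕ,
    (∀ k, (instEnv (regBits (inputSize a t)) a t).E k (init detCmd a t) ≤ B) ∧
    (2 * regBits (inputSize a t) + 3) * B ≤ numSums a ^ 2 * detBound (inputSize a t) := by
  set x := inputSize a t with hx
  obtain ⟨j, hj, hj2, G, hG, hcard⟩ := exists_many_pairs a t (x + 10) (by rw [hx])
  have hne : G.Nonempty := by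
    rw [Finset.nonempty_iff_ne_empty]
    rintro rfl
    simp at hcard
  obtain ⟨⟨q₀, m₀⟩, hp⟩ := hne
  obtain ⟨hq₀, hm₀, hadm, hsep⟩ := hG _ hp
  simp only at hq₀ hm₀ hadm hsep
  have hβ' : inputSize a t + 10 < regBits (inputSize a t) := by unfold regBits; nlinarith
  have htri := tri_detCmd (β := regBits x) (ℓ := 17 * (x + 10)) (L := x + 10) (by rw [hx])
    (by omega) rfl (hq₀.trans_le (Nat.pow_le_pow_right (by norm_num) (by omega))) hadm hsep
  refine ⟨_, fun k => htri.E_le (instRegs_ok a t hβ') k, ?_⟩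
  have hS := one_le_numSums a
  set S := numSums a
  set τ := bodyTime (regBits x) (x + 10) with hτ
  set K := moduliBound x with hK
  have hSK : 2 ^ j ≤ S * K := by
    rw [hK, moduliBound]
    calc 2 ^ j ≤ 2 ^ 16 * S * (x + 10) ^ 4 := hj2
      _ = _ := by ring
  calc (2 * regBits x + 3) * ((m₀ + q₀ + 1) * ((q₀ + 1) * τ + 10) + 10)
      -- Both moduli of the good pair are below `2 ^ j ≤ S * K`. One factor `S` comes from the
      -- number of attempts, the other from the cost of each.
      ≤ (2 * regBits x + 3) * ((2 * (S * K)) * ((S * K) * τ + S * 10) + S ^ 2 * 10) := by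
        gcongr
        · omega
        · omega
        · omega
        · exact Nat.le_mul_of_pos_left _ (pow_pos hS 2)
    _ = S ^ 2 * detBound x := by
        unfold detBound
        rw [← hK, ← hτ]
        ring

theorem randomized :
    ∃ (P : Cmd) (q : Polynomial ℕ), SpaceBound P q ∧ NeverErrs P ∧
      ∀ (n : ℕ) (a : Fin n → ℤ) (t : ℤ), expectedTime (init P a t) ≤
        ((numSums a * q.eval (inputSize a t) : ℕ) : ℝ≥0∞) := by
  obtain ⟨p, hp⟩ := isPoly_spaceBound
  obtain ⟨r, hr⟩ := isPoly_randBound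
  have hgood : ∀ (n : ℕ) (a : Fin n → ℤ) (t : ℤ) (d : Config), Reaches (init randCmd a t) d →
      (instEnv (regBits (inputSize a t)) a t).Good d := by
    intro n a t d hd
    obtain ⟨B, hB, -⟩ := exists_E_randCmd_le a t
    exact Env.good_of_reaches (ENNReal.natCast_ne_top B) hB hd
  -- The sum of the two polynomials serves as a common bound for space and time.
  refine ⟨randCmd, p + r, fun n a t d hd => ?_, fun n a t d hd hh => (hgood n a t d hd).2.2.2 hh,
    fun n a t => ?_⟩
  · rw [Polynomial.eval_add, hp]
    exact (space_le (hgood n a t d hd)).trans (Nat.le_add_right _ _)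
  · obtain ⟨B, hB, hle⟩ := exists_E_randCmd_le a t
    refine (Env.expectedTime_le (V := instEnv (regBits (inputSize a t)) a t)
      (Nat.succ_pos _) hB).trans ?_
    rw [Polynomial.eval_add, hr]
    have h2 : (2 * regBits (inputSize a t) + 3) * B ≤
        numSums a * (p.eval (inputSize a t) + randBound (inputSize a t)) :=
      hle.trans (Nat.mul_le_mul_left _ (Nat.le_add_left _ _))
    calc _ = (((2 * regBits (inputSize a t) + 3) * B : ℕ) : ℝ≥0∞) := by
          simp only [instEnv]
          push_cast
          rfl
      _ ≤ _ := by exact_mod_cast h2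

theorem deterministic :
    ∃ (P : Cmd) (q : Polynomial ℕ), P.CoinFree ∧ SpaceBound P q ∧
      ∀ (n : ℕ) (a : Fin n → ℤ) (t : ℤ), ∃ k : ℕ, (run (init P a t) k).Halted ∧
        IsAnswer a t (run (init P a t) k).output ∧
        time (init P a t) k ≤ numSums a ^ 2 * q.eval (inputSize a t) := by
  obtain ⟨p, hp⟩ := isPoly_spaceBound
  obtain ⟨r, hr⟩ := isPoly_detBound
  refine ⟨detCmd, p + r, detCmd_coinFree, fun n a t d hd => ?_, fun n a t => ?_⟩
  · obtain ⟨B, hB, -⟩ := exists_E_detCmd_le a t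
    rw [Polynomial.eval_add, hp]
    exact (space_le (Env.good_of_reaches (ENNReal.natCast_ne_top B) hB hd)).trans
      (Nat.le_add_right _ _)
  · obtain ⟨B, hB, hle⟩ := exists_E_detCmd_le a t
    obtain ⟨k, h1, h2, h3⟩ := Env.exists_halted (V := instEnv (regBits (inputSize a t)) a t)
      (Nat.succ_pos _) (c := init detCmd a t)
      (by intro c hc; rw [List.mem_singleton.1 hc]; exact detCmd_coinFree) hB
    refine ⟨k, h1, h2, h3.trans (hle.trans ?_)⟩
    rw [Polynomial.eval_add, hr]
    exact Nat.mul_le_mul_left _ (Nat.le_add_left _ _)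

end SubsetSum

theorem mainTheorem6 :
    (∃ (P : RAM.Cmd) (q : Polynomial ℕ),
      SubsetSum.SpaceBound P q ∧ SubsetSum.NeverErrs P ∧
      ∀ (n : ℕ) (a : Fin n → ℤ) (t : ℤ),
        RAM.expectedTime (SubsetSum.init P a t) ≤
          ((SubsetSum.numSums a * q.eval (SubsetSum.inputSize a t) : ℕ) : ℝ≥0∞)) ∧
    (∃ (P : RAM.Cmd) (q : Polynomial ℕ),
      P.CoinFree ∧ SubsetSum.SpaceBound P q ∧
      ∀ (n : ℕ) (a : Fin n → ℤ) (t : ℤ), ∃ k : ℕ,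
        (RAM.run (SubsetSum.init P a t) k).Halted ∧
        SubsetSum.IsAnswer a t (RAM.run (SubsetSum.init P a t) k).output ∧
        RAM.time (SubsetSum.init P a t) k ≤
          SubsetSum.numSums a ^ 2 * q.eval (SubsetSum.inputSize a t)) :=
  ⟨SubsetSum.randomized, SubsetSum.deterministic⟩
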